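/- **Model.** A radio network is a finite simple undirected connected graph $G=(V,E)$ with $n$ nodes, diameter $D$ and a source $s\in V$ that holds a message. Nodes act in synchronous rounds, numbered from $0$; all start in the same round. In each round a node transmits or listens, and a listening node hears a message iff exactly one of its neighbours transmits (there is no collision detection). All nodes run the same deterministic algorithm; a node initially knows only its own label (a binary string), and the source in addition its message. Broadcast is accomplished in $R$ rounds if after $R$ rounds every node knows the message. Logarithms are to base $2$; $L_l$ is the set of nodes at distance $l$ from $s$. **Levelled Executor Algorithm.** A label consists of $5$ bits: $\mathit{Join}$, $\mathit{Lev}\in\{0,1,2\}$ (two bits), $\mathit{Stay}$, $\mathit{Go}$. Block $r=0,1,2,\dots$ consists of the rounds $3r$ (Broadcast step), $3r+1$ (Feedback step) and $3r+2$ (Go step). Each node knows whether it is in the dominating set; initially only $s$ is (its $\mathit{Join}$ bit is $1$). In block $r$: - Broadcast step: the nodes of the dominating set with $\mathit{Lev}=r\bmod 3$ transmit the message. - Feedback step: the nodes informed in this block's Broadcast step whose $\mathit{Stay}$ or $\mathit{Go}$ bit is $1$ transmit these two bits. A node of the dominating set with $\mathit{Lev}=r\bmod 3$ stays in the dominating set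 iff it hears $\mathit{Stay}=1$. - Go step: the nodes with $\mathit{Lev}=r\bmod 3$ that have just heard $\mathit{Go}=1$ transmit the message. An uninformed node accepts the message only in Broadcast and Go steps of blocks $r$ with $\mathit{Lev}\equiv r+1 \pmod 3$; it then enters the dominating set iff its $\mathit{Join}$ bit is $1$. **Labeling scheme.** Let $\mathbf{INF}_r$ and $\mathbf{DOM}_r$ be the set of informed nodes and the dominating set at the beginning of block $r$. The labels are assigned along the execution so that the following holds. - $\mathit{Lev}(v)$ is the distance from $s$ to $v$ modulo $3$, and $s$ has $\mathit{Join}=1$, $\mathit{Stay}=\mathit{Go}=0$. - For all $r\ge 1$ and $l\equiv r\pmod 3$, $\mathbf{DOM}_r\cap L_l$ is an inclusion-minimal subset of $\mathbf{INF}_r\cap L_l$ such that every uninformed node of $L_{l+1}$ with a neighbour in $\mathbf{INF}_r\cap L_l$ has a neighbour in the subset (the $\mathit{Join}$ and $\mathit{Stay}$ bits are chosen to this end). - In each block $r$, every $v\in\mathbf{DOM}_r\cap L_l$ with $l\equiv r\pmod 3$ that informs some node of $L_{l+1}$ in the Broadcast step is assigned one such node, its feedback node. Nodes that are never feedback nodes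 have $\mathit{Stay}=\mathit{Go}=0$. - The blocks are divided into consecutive stages of $15\lceil\log n\rceil^2$ blocks. For a block $r$ in the stage that starts with block $r_0$ (for $n=1$, $r_0=0$) and for $l\equiv r\pmod 3$, let $A=\mathbf{DOM}_{r_0}\cap\mathbf{DOM}_r\cap L_l$, and let $B$ be the set of nodes of $L_{l+1}\setminus\mathbf{INF}_r$ with a neighbour in $A$. There are $A'\subseteq A$ and $B'\subseteq B$ such that each node of $B'$ has exactly one neighbour in $A'$ and $|B|\le 15\max(1,\log|A|)\,|B'|$ (a bipartite selection), and for each $v\in\mathbf{DOM}_r\cap L_l$ with a feedback node in block $r$, the $\mathit{Go}$ bit of this feedback node is $1$ iff $v\in A'$. **Corollary 4.3.** 1. There is a constant $C$ such that for every radio network, with every labeling produced by this scheme (all labels have length $5$), the Levelled Executor Algorithm accomplishes broadcast in at most $C\,D\log^2 n$ rounds. 2. The scheme is constructive: there are a single deterministic algorithm and a polynomial $p$ such that for every radio network on $\{0,\dots,n-1\}$, given $n$, $s$ and the adjacency matrix, the algorithm outputs a labeling produced by the scheme in at most $p(n)$ steps of a random access machine (memory cells holding natural numbers, addition, truncated subtraction,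 indirect addressing, zero tests; unit cost). -/

import Mathlib

/-! ## Radio networks -/

/-- A deterministic distributed algorithm for radio networks in which one node (the source) starts
with a payload of type `M`.  All nodes run the same algorithm; the initial state of a node depends
only on its own label and on the payload, if it holds one (`some m` for the source, `none`
otherwise). `transmit` tells whether the node transmits (`some message`) or listens (`none`) in the
current round; `update` is the change of state at the end of the round, its second argument being
what the node has heard (`none` for silence and for a collision); `output` is the payload known to
the node. -/
structure RadioAlgorithm.{u} (M : Type u) where
  State : Type u
  Msg : Type u
  init : List Bool → Option M → State
  transmit : State → Option Msg
  update : State → Option Msg → State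
  output : State → Option M

namespace RadioAlgorithm

open Classical in
/-- What `v` hears in a round in which node `w` performs the action `act w`: the message of `w`, if
`v` listens and `w` is the only transmitting neighbour of `v`, and nothing otherwise. -/
noncomputable def heard {V Msg : Type*} (G : SimpleGraph V) (act : V → Option Msg) (v : V) :
    Option Msg :=
  if h : act v = none ∧ ∃! w, G.Adj v w ∧ act w ≠ none then act h.2.choose else none

open Classical in
/-- The states of all nodes after `t` rounds, when the source `s` holds the payload `m` and the
nodes have the labels `ℓ`. -/
noncomputable def run {M V : Type*} (A : RadioAlgorithm M) (G : SimpleGraph V) (s : V)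
    (ℓ : V → List Bool) (m : M) : ℕ → V → A.State
  | 0 => fun v => A.init (ℓ v) (if v = s then some m else none)
  | t + 1 => fun v =>
      A.update (run A G s ℓ m t v) (heard G (fun w => A.transmit (run A G s ℓ m t w)) v)

/-- After `R` rounds every node knows the payload of the source. -/
def BroadcastsIn {M V : Type*} (A : RadioAlgorithm M) (G : SimpleGraph V) (s : V)
    (ℓ : V → List Bool) (m : M) (R : ℕ) : Prop :=
  ∀ v, A.output (A.run G s ℓ m R v) = some m

end RadioAlgorithm

/-! ## The Levelled Executor Algorithm -/

namespace LevelledExecutor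

/-- Labels are the binary strings `Join, Lev (two bits), Stay, Go`. -/
def joinBit (l : List Bool) : Bool := l.getD 0 false

def lev (l : List Bool) : ℕ := 2 * (l.getD 1 false).toNat + (l.getD 2 false).toNat

def stayBit (l : List Bool) : Bool := l.getD 3 false

def goBit (l : List Bool) : Bool := l.getD 4 false

inductive Msg (M : Type*) where
  | data (m : M)
  | feedback (stay go : Bool)

structure State (M : Type*) where
  label : List Bool
  /-- the number of rounds completed so far -/
  clock : ℕ
  payload : Option M
  /-- is the node currently in the dominating set? -/
  inDom : Bool
  /-- was the node informed in the Broadcast step of the current block? -/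
  fresh : Bool
  /-- has the node been told to transmit in the Go step of the current block? -/
  goNow : Bool

namespace State

variable {M : Type*}

/-- the number of the current block; a block consists of three rounds -/
def block (σ : State M) : ℕ := σ.clock / 3

/-- Nodes of the dominating set with this property transmit in the Broadcast and Go steps of the
current block and listen in its Feedback step. -/
def isSender (σ : State M) : Prop := lev σ.label = σ.block % 3

/-- Nodes with this property listen in the Broadcast and Go steps of the current block and may
transmit in its Feedback step. -/
def isReceiver (σ : State M) : Prop := lev σ.label = (σ.block + 1) % 3

instance (σ : State M) : Decidable σ.isSender := inferInstanceAs (Decidable (_ = _))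

instance (σ : State M) : Decidable σ.isReceiver := inferInstanceAs (Decidable (_ = _))

/-- In a Broadcast or Go step, an uninformed receiver that hears the payload becomes informed, and
enters the dominating set iff its `Join` bit is 1. -/
def accept (σ : State M) (h : Option (Msg M)) (inBroadcastStep : Bool) : State M :=
  match σ.payload, h with
  | none, some (Msg.data m) =>
      if σ.isReceiver then
        { σ with payload := some m, inDom := joinBit σ.label, fresh := inBroadcastStep }
      else σ
  | _, _ => σ

/-- In a Feedback step, a sender of the dominating set follows the bits that it hears; without
feedback it leaves the dominating set and stays silent in the Go step. -/
def obey (σ : State M) (h : Option (Msg M)) : State M :=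
  if σ.inDom = true ∧ σ.isSender then
    match h with
    | some (Msg.feedback stay go) => { σ with inDom := stay, goNow := go }
    | _ => { σ with inDom := false, goNow := false }
  else σ

end State

/-- Rounds `3r`, `3r+1`, `3r+2` are the Broadcast, Feedback and Go steps of block `r`. -/
def algorithm (M : Type*) : RadioAlgorithm M where
  State := State M
  Msg := Msg M
  init l p :=
    { label := l, clock := 0, payload := p, inDom := p.isSome && joinBit l,
      fresh := false, goNow := false }
  transmit σ :=
    if σ.clock % 3 = 0 then
      if σ.inDom = true ∧ σ.isSender then σ.payload.map Msg.data else none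
    else if σ.clock % 3 = 1 then
      if σ.fresh = true ∧ (stayBit σ.label = true ∨ goBit σ.label = true) then
        some (Msg.feedback (stayBit σ.label) (goBit σ.label))
      else none
    else
      if σ.goNow = true ∧ σ.isSender then σ.payload.map Msg.data else none
  update σ h :=
    if σ.clock % 3 = 0 then { σ.accept h true with clock := σ.clock + 1 }
    else if σ.clock % 3 = 1 then { σ.obey h with clock := σ.clock + 1, fresh := false }
    else { σ.accept h false with clock := σ.clock + 1, goNow := false }
  output σ := σ.payload

/-! ## The labeling scheme -/

section Scheme

variable {V : Type*} (G : SimpleGraph V) (s : V) (ℓ : V → List Bool)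

/-- The nodes that are informed at the beginning of block `r` (which nodes these are does not depend
on the payload, so that the one-element type serves as the type of payloads). -/
def informed (r : ℕ) : Set V :=
  {v | ((algorithm Unit).output ((algorithm Unit).run G s ℓ () (3 * r) v)).isSome = true}

/-- The nodes that are in the dominating set at the beginning of block `r`. -/
def dom (r : ℕ) : Set V :=
  {v | ((algorithm Unit).run G s ℓ () (3 * r) v : State Unit).inDom = true}

/-- The nodes at distance `l` from the source. -/
def level (l : ℕ) : Set V := {v | G.dist s v = l}

/-- The members of the dominating set that transmit in the Broadcast step of block `r`. -/
def activeDom (r : ℕ) : Set V := {v ∈ dom G s ℓ r | G.dist s v % 3 = r % 3}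

/-- `S` is a set of informed nodes of level `l`, `I` being the set of all informed nodes, and every
uninformed node of level `l + 1` with an informed neighbour on level `l` has a neighbour in `S`. -/
def DominatesFrontier (I : Set V) (l : ℕ) (S : Set V) : Prop :=
  S ⊆ I ∩ level G s l ∧
    ∀ w ∈ level G s (l + 1) \ I, (∃ u ∈ I ∩ level G s l, G.Adj u w) → ∃ u ∈ S, G.Adj u w

/-- `u` is an uninformed node of the next level that receives the payload from `v` in the Broadcast
step of block `r`. -/
def InformedBy (r : ℕ) (v u : V) : Prop :=
  v ∈ activeDom G s ℓ r ∧ u ∉ informed G s ℓ r ∧ G.dist s u = G.dist s v + 1 ∧ G.Adj v u ∧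
    ∀ w ∈ activeDom G s ℓ r, G.Adj w u → w = v

/-- `A'` and `B'` are as provided by the bipartite selection lemma for the bipartite graph between
`A` and `B`: each node of `B'` has exactly one neighbour in `A'`, and `|B'| ≥ |B| / (15 log |A|)`
(with `log |A|` replaced by `1` if `|A| ≤ 1`). -/
def IsSelection (A B A' B' : Set V) : Prop :=
  A' ⊆ A ∧ B' ⊆ B ∧ (∀ b ∈ B', ∃! a, a ∈ A' ∧ G.Adj a b) ∧
    (B.ncard : ℝ) ≤ 15 * max 1 (Real.logb 2 A.ncard) * B'.ncard

/-- The number of blocks in a stage: `15 log² n`, with the logarithm rounded up. -/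
def stageLength (n : ℕ) : ℕ := 15 * Nat.clog 2 n ^ 2

/-- The first block of the stage that contains block `r`. -/
def stageStart (n r : ℕ) : ℕ := stageLength n * (r / stageLength n)

/-- The set `A_r` of block `r` and level `l`: the nodes of level `l` that are in the dominating set
now and were in it at the beginning of the stage. -/
def stageDom (l r : ℕ) : Set V :=
  dom G s ℓ (stageStart (Nat.card V) r) ∩ dom G s ℓ r ∩ level G s l

/-- The set `B_r`: the uninformed neighbours of `A_r` on level `l + 1`. -/
def stageFrontier (l r : ℕ) : Set V :=
  {w ∈ level G s (l + 1) \ informed G s ℓ r | ∃ u ∈ stageDom G s ℓ l r, G.Adj u w}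

/-- The labels `ℓ` result from the deterministic label assignment along the execution, in which
`fb r v` is the feedback node (if any) chosen for `v` in block `r`.  The sets `informed` and `dom`
are those of the execution with the labels `ℓ` itself, so the `Join` and `Stay` bits are governed by
the condition `minimal`. -/
structure IsLabelingWith (fb : ℕ → V → Option V) : Prop where
  length_eq : ∀ v, (ℓ v).length = 5
  lev_eq : ∀ v, lev (ℓ v) = G.dist s v % 3
  source : ℓ s = [true, false, false, false, false]
  /-- On each level whose turn it is, the dominating set is an inclusion-minimal set that dominates
  the frontier (the dominating set of block `0` is `{s}`). -/
  minimal : ∀ r l, 1 ≤ r → l % 3 = r % 3 →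
    Minimal (DominatesFrontier G s (informed G s ℓ r) l) (dom G s ℓ r ∩ level G s l)
  /-- The feedback node of `v` is a node informed by `v`. -/
  fb_informedBy : ∀ r v u, fb r v = some u → InformedBy G s ℓ r v u
  /-- A feedback node is chosen for every node of the dominating set that informs some node. -/
  fb_exists : ∀ r v, (∃ u, InformedBy G s ℓ r v u) → ∃ u, fb r v = some u
  /-- All nodes that are not feedback nodes have `Stay = Go = 0`. -/
  non_fb : ∀ u, (∀ r v, fb r v ≠ some u) → stayBit (ℓ u) = false ∧ goBit (ℓ u) = false
  /-- The `Go` bits follow the selection lemma. -/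
  go_selection : ∀ r l, l % 3 = r % 3 → ∃ A' B' : Set V,
    IsSelection G (stageDom G s ℓ l r) (stageFrontier G s ℓ l r) A' B' ∧
      ∀ v ∈ level G s l, ∀ u, fb r v = some u → (goBit (ℓ u) = true ↔ v ∈ A')

/-- `ℓ` is a labeling of `(G, s)` produced by the labeling scheme. -/
def IsLabeling : Prop := ∃ fb : ℕ → V → Option V, IsLabelingWith G s ℓ fb

end Scheme

end LevelledExecutor

/-! ## Random access machines

Structured programs for a random access machine whose memory cells hold natural numbers.  The only
arithmetical operations are addition and truncated subtraction, and every operation takes one unit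
of time; polynomial time on this machine is polynomial time on Turing machines. -/

namespace RAM

abbrev Memory : Type := ℕ → ℕ

inductive Term where
  | lit (k : ℕ)
  /-- the content of the cell with the given address -/
  | load (a : Term)
  | add (a b : Term)
  | sub (a b : Term)

namespace Term

def eval (σ : Memory) : Term → ℕ
  | lit k => k
  | load a => σ (a.eval σ)
  | add a b => a.eval σ + b.eval σ
  | sub a b => a.eval σ - b.eval σ

/-- the time needed to evaluate a term -/
def cost : Term → ℕ
  | lit _ => 1
  | load a => a.cost + 1
  | add a b => a.cost + b.cost + 1
  | sub a b => a.cost + b.cost + 1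

end Term

inductive Program where
  | skip
  /-- write the value of `e` into the cell with address `a` -/
  | store (a e : Term)
  | seq (p q : Program)
  /-- run `p` if `e` is nonzero, and `q` otherwise -/
  | cond (e : Term) (p q : Program)
  /-- repeat `p` as long as `e` is nonzero -/
  | loop (e : Term) (p : Program)

/-- `Exec p σ t τ`: started on memory `σ`, the program `p` halts after `t` steps with memory `τ`. -/
inductive Exec : Program → Memory → ℕ → Memory → Prop where
  | skip (σ : Memory) : Exec .skip σ 1 σ
  | store (a e : Term) (σ : Memory) :
      Exec (.store a e) σ (a.cost + e.cost + 1) (Function.update σ (a.eval σ) (e.eval σ))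
  | seq {p q : Program} {σ τ ρ : Memory} {t u : ℕ} :
      Exec p σ t τ → Exec q τ u ρ → Exec (.seq p q) σ (t + u) ρ
  | cond_pos {e : Term} {p : Program} (q : Program) {σ τ : Memory} {t : ℕ} :
      e.eval σ ≠ 0 → Exec p σ t τ → Exec (.cond e p q) σ (e.cost + 1 + t) τ
  | cond_zero {e : Term} (p : Program) {q : Program} {σ τ : Memory} {t : ℕ} :
      e.eval σ = 0 → Exec q σ t τ → Exec (.cond e p q) σ (e.cost + 1 + t) τ
  | loop_pos {e : Term} {p : Program} {σ τ ρ : Memory} {t u : ℕ} :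
      e.eval σ ≠ 0 → Exec p σ t τ → Exec (.loop e p) τ u ρ →
        Exec (.loop e p) σ (e.cost + 1 + t + u) ρ
  | loop_zero {e : Term} (p : Program) {σ : Memory} :
      e.eval σ = 0 → Exec (.loop e p) σ (e.cost + 1) σ

open Classical in
/-- The input: cell `0` holds `n`, cell `1` the source, and cell `2 + i * n + j` the entry `(i, j)`
of the adjacency matrix; all other cells hold `0`. -/
noncomputable def input {n : ℕ} (G : SimpleGraph (Fin n)) (s : Fin n) : Memory := fun a =>
  if a = 0 then n
  else if a = 1 then s
  else if ∃ i j : Fin n, a = 2 + i * n + j ∧ G.Adj i j then 1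
  else 0

/-- The memory `τ` holds the labels `ℓ`, each consisting of `c` bits: bit `j` of the label of node
`v` is in cell `c * v + j`. -/
def HoldsLabels {n : ℕ} (c : ℕ) (τ : Memory) (ℓ : Fin n → List Bool) : Prop :=
  ∀ v : Fin n, (ℓ v).length = c ∧
    ∀ j (h : j < (ℓ v).length), τ (c * v + j) = ((ℓ v)[j]).toNat

end RAM

/-! ## Polynomial-time computations on graphs

The memory cells above a base address serve as registers and as arrays that are indexed by the
nodes of the network. -/

namespace RAM

/-! Running time. Neighbouring nodes lie on equal or consecutive levels, so residues modulo 3 tell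
them apart: in block r a receiver on level l + 1 hears only level l. After block 0, minimality of
the dominating set gives each transmitting node a private uninformed neighbour
(`exists_private_of_minimal`). Hence every transmitting node informs somebody and owns a feedback
node. A node is informed by a Broadcast step at most once and by a single transmitter
(`InformedBy.unique`), so its Stay and Go bits are instructions for one node in one block, and
feedback never collides (`hearsFeedback_iff`). Thus the Go step realises the bipartite selection:
all of B' is informed when the block ends (`selected_informed`). Suppose level l is completely
informed when a stage starts. Then A is the whole current dominating set of level l, B is everything
uninformed on level l + 1, and each turn of level l removes at least a fraction 1/(15k) of B, where
k = ⌈log n⌉. Within three stages the level has 15k² turns, and n (1 - 1/(15k))^(15k²) ≤ 2^k e^(-k) <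
1, so level l + 1 is completely informed (`level_succ_subset`). Induction on l gives 3 D stages.

Construction. The conditions on the labels refer to the execution that the labels themselves
produce. A `Schedule` breaks this circle: it prescribes who is informed, who transmits, who gives
feedback and who is selected. A valid schedule determines labels, and the execution with these
labels is the schedule (`informed_eq_and_dom_eq`, `isLabelingWith`). Valid schedules are computed
block by block. Minimal dominating sets arise by discarding redundant nodes one at a time. The
selection comes from a deterministic local search that maximises the sum of 2c - c² over frontier
nodes of similar degree, c being the number of selected neighbours. As 2c - c² ≤ 1, with equality
only for c = 1, the objective is at most the number of frontier nodes with exactly one selected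
neighbour, and n improvements reach a local optimum. There the optimality conditions, summed over
all candidates, show that a constant fraction of these frontier nodes is served
(`mul_card_le_mul_score`); the degree classes cost the logarithm. As long as somebody is uninformed,
three blocks inform a new node, so 3n blocks determine all labels. Polynomial time follows from
closure properties: `Computes`, `Decides` and `Transforms` are stable under the operations (sums and
quantifiers over nodes, array updates, sweeps) from which the construction is assembled. -/

/-- The input of the construction: a graph on `n` nodes together with a source. -/
structure Network (n : ℕ) where
  graph : SimpleGraph (Fin n)
  source : Fin n

/-- Node-indexed arrays of natural numbers. -/
abbrev Arrays (n : ℕ) := ℕ → Fin n → ℕ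

/-- All cells below this address are reserved for the input and the output. -/
def Network.base {n : ℕ} (N : Network n) : ℕ := N.source + 5 * n + 2 + n * n

/-- The address of entry `i` of block `a` above the base address `b`.  Block `0` consists of the
registers, block `1` is an auxiliary array, and block `a + 2` is the array `a`. -/
def slot (b a i : ℕ) : ℕ := b + 2 ^ a * (2 * i + 1)

/-- A positive integer splits in only one way into a power of two and an odd number. So the blocks
of cells are disjoint and unbounded, and since block numbers are fixed in the program, doublings
suffice to compute addresses. -/
theorem two_pow_mul_odd_inj {a i a' i' : ℕ} (h : 2 ^ a * (2 * i + 1) = 2 ^ a' * (2 * i' + 1)) :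
    a = a' ∧ i = i' := by
  induction a generalizing a' with
  | zero =>
    cases a' with
    | zero => exact ⟨rfl, by omega⟩
    | succ a' => rw [pow_succ, mul_comm (2 ^ a'), mul_assoc] at h; omega
  | succ a ih =>
    cases a' with
    | zero => rw [pow_succ, mul_comm (2 ^ a), mul_assoc] at h; omega
    | succ a' =>
      rw [pow_succ, pow_succ, mul_comm (2 ^ a), mul_comm (2 ^ a'), mul_assoc, mul_assoc] at h
      obtain ⟨h1, h2⟩ := ih (Nat.eq_of_mul_eq_mul_left two_pos h)
      exact ⟨by rw [h1], h2⟩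

theorem slot_inj {b a i a' i' : ℕ} : slot b a i = slot b a' i' ↔ a = a' ∧ i = i' := by
  constructor
  · intro h
    exact two_pow_mul_odd_inj (Nat.add_left_cancel h)
  · rintro ⟨rfl, rfl⟩
    rfl

theorem lt_slot (b a i : ℕ) : b < slot b a i := by
  have : 0 < 2 ^ a * (2 * i + 1) := by positivity
  unfold slot
  omega

theorem Network.lt_slot_of_lt {n : ℕ} (N : Network n) {c : ℕ} (h : c < N.base) (a i : ℕ) :
    c ≠ slot N.base a i := (h.trans (lt_slot _ a i)).ne

theorem Network.entry_lt_base {n : ℕ} (N : Network n) (i j : Fin n) :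
    2 + i * n + j < N.base := by
  have h1 : (i : ℕ) * n + n ≤ n * n := by
    have := Nat.mul_le_mul_right n i.2
    rwa [Nat.succ_mul] at this
  have := j.2
  unfold base
  omega

/-- The memory `σ` holds the network `N` and the arrays `A`. -/
structure Represents {n : ℕ} (N : Network n) (A : Arrays n) (σ : Memory) : Prop where
  size : σ 0 = n
  base : σ 1 = N.base
  adj : ∀ i j : Fin n, σ (2 + i * n + j) ≠ 0 ↔ N.graph.Adj i j
  arrays : ∀ a (i : Fin n), σ (slot N.base (a + 2) i) = A a i

/-- The memories agree except for the registers from `d` on. -/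
def AgreesBelow (b d : ℕ) (σ τ : Memory) : Prop := ∀ c, (∀ j, d ≤ j → c ≠ slot b 0 j) → τ c = σ c

theorem AgreesBelow.trans {b d : ℕ} {σ τ ρ : Memory} (h₁ : AgreesBelow b d σ τ)
    (h₂ : AgreesBelow b d τ ρ) : AgreesBelow b d σ ρ := fun c hc => (h₂ c hc).trans (h₁ c hc)

theorem AgreesBelow.mono {b d d' : ℕ} {σ τ : Memory} (h : AgreesBelow b d' σ τ) (hd : d ≤ d') :
    AgreesBelow b d σ τ := fun c hc => h c fun j hj => hc j (hd.trans hj)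

theorem AgreesBelow.register {b d : ℕ} {σ τ : Memory} (h : AgreesBelow b d σ τ) {j : ℕ}
    (hj : j < d) : τ (slot b 0 j) = σ (slot b 0 j) :=
  h _ fun j' hj' e => by have := (slot_inj.1 e).2; omega

theorem agreesBelow_update (b d j : ℕ) (σ : Memory) (x : ℕ) (hj : d ≤ j) :
    AgreesBelow b d σ (Function.update σ (slot b 0 j) x) := fun _ hc =>
  Function.update_of_ne (hc j hj) _ _

theorem Represents.of_agreesBelow {n : ℕ} {N : Network n} {A : Arrays n} {σ τ : Memory} {d : ℕ}
    (h : Represents N A σ) (hτ : AgreesBelow N.base d σ τ) : Represents N A τ where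
  size := by
    rw [hτ 0 fun j _ => N.lt_slot_of_lt (by unfold Network.base; omega) 0 j, h.size]
  base := by
    rw [hτ 1 fun j _ => N.lt_slot_of_lt (by unfold Network.base; omega) 0 j, h.base]
  adj i j := by
    rw [hτ _ fun k _ => N.lt_slot_of_lt (N.entry_lt_base i j) 0 k, h.adj]
  arrays a i := by
    rw [hτ _ fun j _ e => by have := (slot_inj.1 e).1; omega, h.arrays]

/-! ### Terms -/

namespace Term

/-- multiplication by a power of `2` -/
def shift : ℕ → Term → Term
  | 0, t => t
  | a + 1, t => add (shift a t) (shift a t)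

theorem eval_shift (σ : Memory) (a : ℕ) (t : Term) : (shift a t).eval σ = 2 ^ a * t.eval σ := by
  induction a with
  | zero => simp [shift]
  | succ a ih => simp only [shift, eval, ih, pow_succ]; ring

/-- the address of an entry of a block -/
def slot (a : ℕ) (t : Term) : Term := add (load (lit 1)) (shift a (add (add t t) (lit 1)))

theorem eval_slot {σ : Memory} {b : ℕ} (h : σ 1 = b) (a : ℕ) (t : Term) :
    (slot a t).eval σ = RAM.slot b a (t.eval σ) := by
  simp only [slot, eval, eval_shift, h, RAM.slot]
  ring

/-- the address of a register -/
def reg (j : ℕ) : Term := slot 0 (lit j)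

theorem eval_reg {σ : Memory} {b : ℕ} (h : σ 1 = b) (j : ℕ) :
    (reg j).eval σ = RAM.slot b 0 j := eval_slot h 0 (lit j)

end Term

/-! ### Loops -/

/-- The guard equals the number of iterations still to come, so it vanishes exactly when the loop is
done; a uniform bound on the body then bounds the total time. -/
theorem exec_for {P : Program} {e : Term} {n T : ℕ} (Inv : ℕ → Memory → Prop)
    (he : ∀ m ≤ n, ∀ σ, Inv m σ → e.eval σ = n - m)
    (hP : ∀ m < n, ∀ σ, Inv m σ → ∃ t τ, Exec P σ t τ ∧ t ≤ T ∧ Inv (m + 1) τ) {σ : Memory}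
    (hσ : Inv 0 σ) :
    ∃ t τ, Exec (.loop e P) σ t τ ∧ t ≤ n * (e.cost + 1 + T) + (e.cost + 1) ∧ Inv n τ := by
  suffices ∀ k m, m + k = n → ∀ σ, Inv m σ →
      ∃ t τ, Exec (.loop e P) σ t τ ∧ t ≤ k * (e.cost + 1 + T) + (e.cost + 1) ∧ Inv n τ from
    this n 0 (by omega) σ hσ
  intro k
  induction k with
  | zero =>
    intro m hm σ hσ
    obtain rfl : m = n := by omega
    exact ⟨_, σ, .loop_zero P (by rw [he m le_rfl σ hσ]; omega), by omega, hσ⟩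
  | succ k ih =>
    intro m hm σ hσ
    obtain ⟨t, τ, h1, h2, h3⟩ := hP m (by omega) σ hσ
    obtain ⟨u, ρ, h4, h5, h6⟩ := ih (m + 1) (by omega) τ h3
    refine ⟨_, ρ, .loop_pos (by rw [he m (by omega) σ hσ]; omega) h1 h4, ?_, h6⟩
    rw [Nat.succ_mul]
    omega

/-- Apply `F 0`, `F 1`, …, `F (m - 1)` in this order. -/
def sweep {n : ℕ} {S : Type*} (F : Fin n → S → S) : ℕ → S → S
  | 0, x => x
  | m + 1, x => if h : m < n then F ⟨m, h⟩ (sweep F m x) else sweep F m x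

theorem sweep_succ {n : ℕ} {S : Type*} (F : Fin n → S → S) {m : ℕ} (h : m < n) (x : S) :
    sweep F (m + 1) x = F ⟨m, h⟩ (sweep F m x) := by simp [sweep, h]

theorem sweep_induction {n : ℕ} {S : Type*} {F : Fin n → S → S} (Inv : ℕ → S → Prop) {x : S}
    (h0 : Inv 0 x) (hs : ∀ (m : Fin n) y, Inv m y → Inv (m + 1) (F m y)) : Inv n (sweep F n x) := by
  suffices ∀ m ≤ n, Inv m (sweep F m x) from this n le_rfl
  intro m
  induction m with
  | zero => exact fun _ => h0
  | succ m ih =>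
    intro hm
    rw [sweep_succ F hm]
    exact hs ⟨m, hm⟩ _ (ih (by omega))

theorem sweep_add {n : ℕ} (f : Fin n → ℕ) :
    sweep (fun i x => x + f i) n 0 = ∑ i, f i := by
  have := sweep_induction (F := fun i x => x + f i) (x := 0)
    (fun m x => x = ∑ i : Fin n with i.val < m, f i) (by simp) (by
      rintro m y rfl
      rw [show (Finset.univ.filter fun i : Fin n => i.val < m + 1) =
        insert m (Finset.univ.filter fun i : Fin n => i.val < m) by ext i; simp; omega,
        Finset.sum_insert (by simp), add_comm])
  rw [this]
  congr 1
  ext i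
  simp

/-! ### Computable functions -/

/-- The function `f` of the network, the arrays and the values of `k` node variables is computable
in polynomial time.  The variables are in the registers `m j`; the registers from `d` on are free,
and register `d` receives the result. -/
def Computes {k : ℕ} (f : ∀ n, Network n → Arrays n → (Fin k → Fin n) → ℕ) : Prop :=
  ∀ (m : Fin k → ℕ) (d : ℕ), (∀ j, m j < d) → ∃ (P : Program) (p : Polynomial ℕ),
    ∀ n (N : Network n) (A : Arrays n) (x : Fin k → Fin n) (σ : Memory), Represents N A σ →
      (∀ j, σ (slot N.base 0 (m j)) = x j) → ∃ t τ, Exec P σ t τ ∧ t ≤ p.eval n ∧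
        AgreesBelow N.base d σ τ ∧ τ (slot N.base 0 d) = f n N A x

/-- The predicate `p` is decidable in polynomial time. -/
def Decides {k : ℕ} (p : ∀ n, Network n → Arrays n → (Fin k → Fin n) → Prop) : Prop :=
  ∃ f, Computes f ∧ ∀ n (N : Network n) A (x : Fin k → Fin n), f n N A x ≠ 0 ↔ p n N A x

/-- The transformation `F` of the arrays is computable in polynomial time. -/
def Transforms {k : ℕ} (F : ∀ n, Network n → Arrays n → (Fin k → Fin n) → Arrays n) : Prop :=
  ∀ (m : Fin k → ℕ) (d : ℕ), (∀ j, m j < d) → ∃ (P : Program) (p : Polynomial ℕ),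
    ∀ n (N : Network n) (A : Arrays n) (x : Fin k → Fin n) (σ : Memory), Represents N A σ →
      (∀ j, σ (slot N.base 0 (m j)) = x j) → ∃ t τ, Exec P σ t τ ∧ t ≤ p.eval n ∧
        Represents N (F n N A x) τ ∧ ∀ j < d, τ (slot N.base 0 j) = σ (slot N.base 0 j)

section

variable {k : ℕ} {f g : ∀ n, Network n → Arrays n → (Fin k → Fin n) → ℕ}

theorem Computes.of_term
    (h : ∀ m : Fin k → ℕ, ∃ e : Term, ∀ n (N : Network n) A (x : Fin k → Fin n) σ,
      Represents N A σ → (∀ j, σ (slot N.base 0 (m j)) = x j) → e.eval σ = f n N A x) :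
    Computes f := by
  intro m d hm
  obtain ⟨e, he⟩ := h m
  refine ⟨.store (.reg d) e, .C ((Term.reg d).cost + e.cost + 1), fun n N A x σ hσ hx => ?_⟩
  refine ⟨_, _, .store _ _ σ, by simp, ?_, ?_⟩
  · rw [Term.eval_reg hσ.base]
    exact agreesBelow_update _ _ _ _ _ le_rfl
  · rw [Term.eval_reg hσ.base, Function.update_self, he n N A x σ hσ hx]

theorem Computes.const (c : ℕ) :
    Computes (fun n _ _ (_ : Fin k → Fin n) => c) :=
  .of_term fun _ => ⟨.lit c, fun _ _ _ _ _ _ _ => rfl⟩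

theorem Computes.size : Computes (fun n _ _ (_ : Fin k → Fin n) => n) :=
  .of_term fun _ => ⟨.load (.lit 0), fun _ _ _ _ _ h _ => h.size⟩

theorem Computes.var (i : Fin k) : Computes (fun n _ _ (x : Fin k → Fin n) => (x i : ℕ)) :=
  .of_term fun m => ⟨.load (.reg (m i)), fun n N A x σ h hx => by
    rw [Term.eval, Term.eval_reg h.base, hx]⟩

theorem Computes.base :
    Computes (fun n N _ (_ : Fin k → Fin n) => N.base) :=
  .of_term fun _ => ⟨.load (.lit 1), fun _ _ _ _ _ h _ => h.base⟩

theorem Computes.array (a : ℕ) (i : Fin k) :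
    Computes (fun n _ A (x : Fin k → Fin n) => A a (x i)) :=
  .of_term fun m => ⟨.load (.slot (a + 2) (.load (.reg (m i)))), fun n N A x σ h hx => by
    rw [Term.eval, Term.eval_slot h.base, Term.eval, Term.eval_reg h.base, hx, h.arrays]⟩

/-- Evaluate `f` into register `d` and `g` into register `d + 1`, and combine the results. -/
theorem Computes.binary (hf : Computes f) (hg : Computes g) (op : ℕ → ℕ → ℕ)
    (top : Term → Term → Term)
    (htop : ∀ σ s t, (top s t).eval σ = op (s.eval σ) (t.eval σ)) :
    Computes (fun n N A x => op (f n N A x) (g n N A x)) := by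
  intro m d hm
  obtain ⟨P, p, hP⟩ := hf m d hm
  obtain ⟨Q, q, hQ⟩ := hg m (d + 1) fun j => (hm j).trans (Nat.lt_succ_self d)
  set e := top (.load (.reg d)) (.load (.reg (d + 1))) with he
  refine ⟨.seq P (.seq Q (.store (.reg d) e)), p + (q + .C ((Term.reg d).cost + e.cost + 1)),
    fun n N A x σ hσ hx => ?_⟩
  obtain ⟨t, τ, h1, h2, h3, h4⟩ := hP n N A x σ hσ hx
  have hτ := hσ.of_agreesBelow h3
  obtain ⟨u, ρ, k1, k2, k3, k4⟩ := hQ n N A x τ hτ fun j => by rw [h3.register (hm j), hx]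
  have hρ := hτ.of_agreesBelow k3
  refine ⟨_, _, .seq h1 (.seq k1 (.store _ _ ρ)), ?_, ?_, ?_⟩
  · simp only [Polynomial.eval_add, Polynomial.eval_C]
    omega
  · rw [Term.eval_reg hρ.base]
    exact (h3.trans (k3.mono (Nat.le_succ d))).trans (agreesBelow_update _ _ _ _ _ le_rfl)
  · rw [Term.eval_reg hρ.base, Function.update_self, he, htop]
    simp only [Term.eval, Term.eval_reg hρ.base]
    rw [k4, k3.register (Nat.lt_succ_self d), h4]

theorem Computes.add (hf : Computes f) (hg : Computes g) :
    Computes (fun n N A x => f n N A x + g n N A x) :=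
  hf.binary hg _ .add fun _ _ _ => rfl

theorem Computes.sub (hf : Computes f) (hg : Computes g) :
    Computes (fun n N A x => f n N A x - g n N A x) :=
  hf.binary hg _ .sub fun _ _ _ => rfl

theorem Computes.const_mul (c : ℕ) (hf : Computes f) :
    Computes (fun n N A x => c * f n N A x) := by
  induction c with
  | zero => simpa using Computes.const 0
  | succ c ih => simpa only [Nat.succ_mul] using ih.add hf

theorem Computes.ite {p : ∀ n, Network n → Arrays n → (Fin k → Fin n) → Prop}
    {inst : ∀ n N A x, Decidable (p n N A x)} (hp : Decides p) (hf : Computes f)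
    (hg : Computes g) :
    Computes (fun n N A x => @ite _ (p n N A x) (inst n N A x) (f n N A x) (g n N A x)) := by
  intro m d hm
  obtain ⟨c, hc, hcp⟩ := hp
  obtain ⟨R, r, hR⟩ := hc m d hm
  obtain ⟨P, p', hP⟩ := hf m d hm
  obtain ⟨Q, q, hQ⟩ := hg m d hm
  set e : Term := .load (.reg d) with he
  refine ⟨.seq R (.cond e P Q), r + (.C (e.cost + 1) + (p' + q)), fun n N A x σ hσ hx => ?_⟩
  obtain ⟨t, τ, h1, h2, h3, h4⟩ := hR n N A x σ hσ hx
  have hτ := hσ.of_agreesBelow h3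
  have hx' : ∀ j, τ (slot N.base 0 (m j)) = x j := fun j => by rw [h3.register (hm j), hx]
  have hev : e.eval τ = c n N A x := by rw [he, Term.eval, Term.eval_reg hτ.base, h4]
  simp only [Polynomial.eval_add, Polynomial.eval_C]
  by_cases h : p n N A x
  · obtain ⟨u, ρ, k1, k2, k3, k4⟩ := hP n N A x τ hτ hx'
    refine ⟨_, _, .seq h1 (.cond_pos _ (by rw [hev]; exact (hcp ..).2 h) k1), by omega,
      h3.trans k3, by rw [k4, if_pos h]⟩
  · obtain ⟨u, ρ, k1, k2, k3, k4⟩ := hQ n N A x τ hτ hx'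
    refine ⟨_, _, .seq h1 (.cond_zero _ (by rw [hev]; exact not_not.1 (mt (hcp ..).1 h)) k1),
      by omega, h3.trans k3, by rw [k4, if_neg h]⟩

/-- Register `d` accumulates, register `d + 1` is the counter and at the same time the value of the
bound variable, and the summand is evaluated in the registers from `d + 2` on. Quantifiers, products
and first indices are all reduced to such sums. -/
theorem Computes.sum {f : ∀ n, Network n → Arrays n → (Fin k → Fin n) → Fin n → ℕ}
    (hf : Computes (k := k + 1)
      (fun n N A y => f n N A (fun j => y j.castSucc) (y (Fin.last k)))) :
    Computes (fun n N A x => ∑ i, f n N A x i) := by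
  intro m d hm
  obtain ⟨P, p, hP⟩ := hf (Fin.snoc (α := fun _ => ℕ) m (d + 1)) (d + 2) fun j => by
    refine Fin.lastCases ?_ (fun j => ?_) j
    · simp
    · have := hm j
      simp only [Fin.snoc_castSucc]
      omega
  set acc : Program := .store (.reg d) (.add (.load (.reg d)) (.load (.reg (d + 2)))) with hacc
  set inc : Program := .store (.reg (d + 1)) (.add (.load (.reg (d + 1))) (.lit 1)) with hinc
  set e : Term := .sub (.load (.lit 0)) (.load (.reg (d + 1))) with he
  obtain ⟨ca, hca⟩ : ∃ c, c = (Term.reg d).cost +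
    (Term.add (.load (.reg d)) (.load (.reg (d + 2)))).cost + 1 := ⟨_, rfl⟩
  obtain ⟨ci, hci⟩ : ∃ c, c = (Term.reg (d + 1)).cost +
    (Term.add (.load (.reg (d + 1))) (.lit 1)).cost + 1 := ⟨_, rfl⟩
  obtain ⟨c0, hc0⟩ : ∃ c, c = (Term.reg d).cost + (Term.lit 0).cost + 1 := ⟨_, rfl⟩
  obtain ⟨c1, hc1⟩ : ∃ c, c = (Term.reg (d + 1)).cost + (Term.lit 0).cost + 1 := ⟨_, rfl⟩
  refine ⟨.seq (.store (.reg d) (.lit 0)) (.seq (.store (.reg (d + 1)) (.lit 0))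
    (.loop e (.seq P (.seq acc inc)))),
    .C (c0 + c1) + (.X * (.C (e.cost + 1) + (p + .C (ca + ci))) + .C (e.cost + 1)),
    fun n N A x σ hσ hx => ?_⟩
  set F : Fin n → ℕ → ℕ := fun i s => s + f n N A x i with hF
  set b := N.base with hb
  set σ₁ := Function.update σ (slot b 0 d) 0 with hσ₁
  set σ₂ := Function.update σ₁ (slot b 0 (d + 1)) 0 with hσ₂
  have h1 : AgreesBelow b d σ σ₁ := agreesBelow_update _ _ _ _ _ le_rfl
  have h2 : AgreesBelow b d σ σ₂ := h1.trans (agreesBelow_update _ _ _ _ _ (Nat.le_succ d))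
  have hne : slot b 0 d ≠ slot b 0 (d + 1) := fun h => by have := (slot_inj.1 h).2; omega
  obtain ⟨t, τ, ht, htT, hτ⟩ := exec_for (P := .seq P (.seq acc inc)) (e := e) (n := n)
    (T := p.eval n + (ca + ci)) (fun m τ => AgreesBelow b d σ τ ∧
      τ (slot b 0 d) = sweep F m 0 ∧ τ (slot b 0 (d + 1)) = m)
    (by
      rintro m - τ ⟨hτ, -, hm⟩
      have hr := hσ.of_agreesBelow hτ
      simp only [he, Term.eval, Term.eval_reg hr.base, hr.size, ← hb, hm])
    (by
      rintro l hl τ ⟨hτ, ha, hi⟩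
      have hr := hσ.of_agreesBelow hτ
      obtain ⟨t, ρ, k1, k2, k3, k4⟩ := hP n N A (Fin.snoc (α := fun _ => Fin n) x ⟨l, hl⟩) τ hr
        fun j => by
          refine Fin.lastCases ?_ (fun j => ?_) j
          · simp [← hb, hi]
          · simp only [Fin.snoc_castSucc]
            rw [← hb, hτ.register (hm j), hx]
      have hrρ := hr.of_agreesBelow k3
      have hbase : (Function.update ρ (slot b 0 d)
          (ρ (slot b 0 d) + ρ (slot b 0 (d + 2)))) 1 = b := by
        rw [Function.update_of_ne, hrρ.base]
        exact N.lt_slot_of_lt (by unfold Network.base; omega) 0 d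
      refine ⟨_, _, .seq k1 (.seq (.store _ _ ρ) (.store _ _ _)), ?_, ?_, ?_, ?_⟩
      · omega
      · refine (hτ.trans (k3.mono (by omega))).trans ?_
        simp only [Term.eval, Term.eval_reg hrρ.base]
        rw [← hb, Term.eval_reg hbase]
        exact (agreesBelow_update _ _ _ _ _ le_rfl).trans (agreesBelow_update _ _ _ _ _ (by omega))
      · simp only [Term.eval, Term.eval_reg hrρ.base]
        rw [← hb, Term.eval_reg hbase, Function.update_of_ne hne, Function.update_self,
          sweep_succ F hl, k4, k3.register (by omega), ha]
        simp [hF]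
      · simp only [Term.eval, Term.eval_reg hrρ.base]
        rw [← hb, Term.eval_reg hbase, Function.update_self, Function.update_of_ne hne.symm,
          k3.register (by omega), hi])
    (σ := σ₂) ⟨h2, by rw [hσ₂, Function.update_of_ne hne, hσ₁, Function.update_self]; rfl,
      by rw [hσ₂, Function.update_self]⟩
  have e1 : (Term.reg d).eval σ = slot b 0 d := Term.eval_reg hσ.base d
  have e2 : (Term.reg (d + 1)).eval σ₁ = slot b 0 (d + 1) :=
    Term.eval_reg (hσ.of_agreesBelow h1).base (d + 1)
  have x1 := Exec.store (.reg d) (.lit 0) σ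
  have x2 := Exec.store (.reg (d + 1)) (.lit 0) σ₁
  rw [e1, Term.eval] at x1
  rw [e2, Term.eval] at x2
  refine ⟨_, τ, x1.seq (x2.seq ht), ?_, hτ.1, ?_⟩
  · simp only [Polynomial.eval_add, Polynomial.eval_C, Polynomial.eval_mul, Polynomial.eval_X]
    omega
  · rw [hτ.2.1, hF, sweep_add]

end

/-! ### Decidable predicates -/

section

variable {k : ℕ} {f g : ∀ n, Network n → Arrays n → (Fin k → Fin n) → ℕ}
  {p q : ∀ n, Network n → Arrays n → (Fin k → Fin n) → Prop}

theorem Decides.le (hf : Computes f) (hg : Computes g) :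
    Decides (fun n N A x => f n N A x ≤ g n N A x) :=
  ⟨_, (hg.add (.const 1)).sub hf, fun n N A x => by dsimp only; omega⟩

theorem Decides.lt (hf : Computes f) (hg : Computes g) :
    Decides (fun n N A x => f n N A x < g n N A x) :=
  ⟨_, hg.sub hf, fun n N A x => by dsimp only; omega⟩

theorem Decides.not (hp : Decides p) : Decides (fun n N A x => ¬p n N A x) := by
  obtain ⟨f, hf, h⟩ := hp
  refine ⟨_, (Computes.const 1).sub hf, fun n N A x => ?_⟩
  have := h n N A x
  dsimp only
  rw [← this]
  omega

theorem Decides.or (hp : Decides p) (hq : Decides q) :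
    Decides (fun n N A x => p n N A x ∨ q n N A x) := by
  obtain ⟨f, hf, h⟩ := hp
  obtain ⟨g, hg, h'⟩ := hq
  refine ⟨_, hf.add hg, fun n N A x => ?_⟩
  have h1 := h n N A x
  have h2 := h' n N A x
  dsimp only
  rw [← h1, ← h2]
  omega

theorem Decides.of_iff (hp : Decides p) (h : ∀ n N A x, q n N A x ↔ p n N A x) : Decides q := by
  obtain ⟨f, hf, hfp⟩ := hp
  exact ⟨f, hf, fun n N A x => by rw [hfp, h]⟩

theorem Decides.and (hp : Decides p) (hq : Decides q) :
    Decides (fun n N A x => p n N A x ∧ q n N A x) :=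
  (hp.not.or hq.not).not.of_iff fun _ _ _ _ => by tauto

theorem Decides.imp (hp : Decides p) (hq : Decides q) :
    Decides (fun n N A x => p n N A x → q n N A x) :=
  (hp.not.or hq).of_iff fun _ _ _ _ => by tauto

theorem Decides.eq (hf : Computes f) (hg : Computes g) :
    Decides (fun n N A x => f n N A x = g n N A x) :=
  ((Decides.le hf hg).and (.le hg hf)).of_iff fun _ _ _ _ => by omega

theorem Decides.ne (hf : Computes f) (hg : Computes g) :
    Decides (fun n N A x => f n N A x ≠ g n N A x) := (Decides.eq hf hg).not

theorem Decides.var_eq (i j : Fin k) : Decides (fun _ _ _ x => x i = x j) :=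
  (Decides.eq (.var i) (.var j)).of_iff fun _ _ _ _ => Fin.ext_iff

theorem Decides.var_ne (i j : Fin k) : Decides (fun _ _ _ x => x i ≠ x j) := (var_eq i j).not

/-- A sum of natural numbers is nonzero iff some summand is. -/
theorem Decides.exists {p : ∀ n, Network n → Arrays n → (Fin k → Fin n) → Fin n → Prop}
    (hp : Decides (k := k + 1)
      (fun n N A y => p n N A (fun j => y j.castSucc) (y (Fin.last k)))) :
    Decides (fun n N A x => ∃ i, p n N A x i) := by
  obtain ⟨f, hf, h⟩ := hp
  refine ⟨_, Computes.sum (f := fun n N A x i => f n N A (Fin.snoc (α := fun _ => Fin n) x i))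
    (by convert hf using 5 with n N A y; exact congrArg _ (Fin.snoc_init_self y)),
    fun n N A x => ?_⟩
  simp only [ne_eq, Finset.sum_eq_zero_iff, Finset.mem_univ, true_imp_iff, not_forall]
  refine exists_congr fun i => ?_
  have := h n N A (Fin.snoc (α := fun _ => Fin n) x i)
  simpa using this

theorem Decides.forall {p : ∀ n, Network n → Arrays n → (Fin k → Fin n) → Fin n → Prop}
    (hp : Decides (k := k + 1)
      (fun n N A y => p n N A (fun j => y j.castSucc) (y (Fin.last k)))) :
    Decides (fun n N A x => ∀ i, p n N A x i) :=
  (Decides.exists (p := fun n N A x i => ¬p n N A x i) hp.not).not.of_iff fun _ _ _ _ => by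
    rw [not_exists_not]

/-- Cell 1 has been overwritten with the base address. The source is a summand of that address, so
it is recognised by adding the remaining summands to the candidate. -/
theorem Decides.eq_source (i : Fin k) : Decides (fun _ N _ x => x i = N.source) := by
  refine (Decides.eq ((((Computes.var i).add (.const_mul 5 .size)).add (.const 2)).add
    (.sum (f := fun n _ _ _ _ => n) .size)) .base).of_iff fun n N A x => ?_
  simp [Network.base, Fin.ext_iff]

/-- The machine cannot multiply: the offset of row `x i` is obtained as the sum of `n` over all
nodes smaller than `x i`. -/
theorem Decides.adj (i j : Fin k) : Decides (fun _ N _ x => N.graph.Adj (x i) (x j)) := by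
  classical
  suffices Computes (fun n N A x => if N.graph.Adj (x i) (x j) then 1 else 0) from
    ⟨_, this, by simp⟩
  have hg : Computes (fun n (_ : Network n) _ (x : Fin k → Fin n) =>
      2 + (∑ q : Fin n, if (q : ℕ) < x i then n else 0) + x j) :=
    ((Computes.const 2).add (Computes.sum (.ite (.lt (.var _) (.var _)) .size (.const 0)))).add
      (.var j)
  intro m d hm
  obtain ⟨P, p, hP⟩ := hg m d hm
  refine ⟨.seq P (.cond (.load (.load (.reg d))) (.store (.reg d) (.lit 1))
    (.store (.reg d) (.lit 0))), p + .C ((Term.load (.load (.reg d))).cost + 1 +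
      ((Term.reg d).cost + (Term.lit 1).cost + 1)), fun n N A x σ hσ hx => ?_⟩
  obtain ⟨t, τ, h1, h2, h3, h4⟩ := hP n N A x σ hσ hx
  have hτ := hσ.of_agreesBelow h3
  have hsum : (∑ q : Fin n, if (q : ℕ) < x i then n else 0) = x i * n := by
    rw [← Finset.sum_filter, Finset.sum_const, smul_eq_mul]
    congr 1
    rw [← Fin.card_Iio]
    congr 1
    ext q
    simp
  dsimp only at h4
  rw [hsum] at h4
  have hev : (Term.load (.load (.reg d))).eval τ ≠ 0 ↔ N.graph.Adj (x i) (x j) := by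
    rw [Term.eval, Term.eval, Term.eval_reg hτ.base, h4]
    exact hτ.adj _ _
  have y (b : ℕ) := Exec.store (.reg d) (.lit b) τ
  simp only [Term.eval, Term.eval_reg hτ.base] at y
  simp only [Polynomial.eval_add, Polynomial.eval_C]
  by_cases h : N.graph.Adj (x i) (x j)
  · exact ⟨_, _, h1.seq (.cond_pos _ (hev.2 h) (y 1)), by omega,
      h3.trans (agreesBelow_update _ _ _ _ _ le_rfl), by simp [h]⟩
  · exact ⟨_, _, h1.seq (.cond_zero _ (not_not.1 (mt hev.1 h)) (y 0)),
      by simp only [Term.cost] at *; omega,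
      h3.trans (agreesBelow_update _ _ _ _ _ le_rfl), by simp [h]⟩

end

/-! ### Transformations of the arrays -/

section

variable {k : ℕ} {F H : ∀ n, Network n → Arrays n → (Fin k → Fin n) → Arrays n}

theorem Represents.update_aux {n : ℕ} {N : Network n} {A : Arrays n} {σ : Memory}
    (h : Represents N A σ) {a : ℕ} (ha : a < 2) (i x : ℕ) :
    Represents N A (Function.update σ (slot N.base a i) x) where
  size := by
    rw [Function.update_of_ne, h.size]
    exact N.lt_slot_of_lt (by unfold Network.base; omega) a i
  base := by
    rw [Function.update_of_ne, h.base]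
    exact N.lt_slot_of_lt (by unfold Network.base; omega) a i
  adj i' j' := by
    rw [Function.update_of_ne, h.adj]
    exact N.lt_slot_of_lt (N.entry_lt_base i' j') a i
  arrays a' i' := by
    rw [Function.update_of_ne, h.arrays]
    intro e
    have := (slot_inj.1 e).1
    omega

theorem Represents.update_array {n : ℕ} {N : Network n} {A : Arrays n} {σ : Memory}
    (h : Represents N A σ) (a : ℕ) (i : Fin n) (x : ℕ) :
    Represents N (Function.update A a (Function.update (A a) i x))
      (Function.update σ (slot N.base (a + 2) i) x) where
  size := by
    rw [Function.update_of_ne, h.size]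
    exact N.lt_slot_of_lt (by unfold Network.base; omega) _ i
  base := by
    rw [Function.update_of_ne, h.base]
    exact N.lt_slot_of_lt (by unfold Network.base; omega) _ i
  adj i' j' := by
    rw [Function.update_of_ne, h.adj]
    exact N.lt_slot_of_lt (N.entry_lt_base i' j') _ i
  arrays a' i' := by
    by_cases ha : a' = a
    · subst ha
      by_cases hi : i' = i
      · subst hi
        simp
      · rw [Function.update_of_ne, Function.update_self, Function.update_of_ne hi, h.arrays]
        intro e
        exact hi (Fin.ext (slot_inj.1 e).2)
    · rw [Function.update_of_ne, Function.update_of_ne ha, h.arrays]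
      intro e
      have := (slot_inj.1 e).1
      omega

theorem Transforms.comp (hF : Transforms F) (hH : Transforms H) :
    Transforms (fun n N A x => H n N (F n N A x) x) := by
  intro m d hm
  obtain ⟨P, p, hP⟩ := hF m d hm
  obtain ⟨Q, q, hQ⟩ := hH m d hm
  refine ⟨.seq P Q, p + q, fun n N A x σ hσ hx => ?_⟩
  obtain ⟨t, τ, h1, h2, h3, h4⟩ := hP n N A x σ hσ hx
  obtain ⟨u, ρ, k1, k2, k3, k4⟩ := hQ n N _ x τ h3 fun j => by rw [h4 _ (hm j), hx]
  refine ⟨_, ρ, .seq h1 k1, ?_, k3, fun j hj => by rw [k4 j hj, h4 j hj]⟩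
  rw [Polynomial.eval_add]
  omega

/-- A loop over all nodes whose counter is in register `d`. -/
theorem exists_exec_forEach (d : ℕ) (P : Program) (p : Polynomial ℕ) :
    ∃ (Q : Program) (q : Polynomial ℕ), ∀ n (N : Network n) (B : ℕ → Arrays n)
      (Inv : ℕ → Memory → Prop),
      (∀ m < n, ∀ σ, Represents N (B m) σ → σ (slot N.base 0 d) = m → Inv m σ →
        ∃ t τ, Exec P σ t τ ∧ t ≤ p.eval n ∧ Represents N (B (m + 1)) τ ∧
          τ (slot N.base 0 d) = m ∧ Inv (m + 1) τ) →
      (∀ m σ x, Inv m σ → Inv m (Function.update σ (slot N.base 0 d) x)) →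
      ∀ σ, Represents N (B 0) σ → Inv 0 σ → ∃ t τ, Exec Q σ t τ ∧ t ≤ q.eval n ∧
        Represents N (B n) τ ∧ Inv n τ := by
  set e : Term := .sub (.load (.lit 0)) (.load (.reg d)) with he
  set inc : Program := .store (.reg d) (.add (.load (.reg d)) (.lit 1)) with hinc
  obtain ⟨ci, hci⟩ : ∃ c, c = (Term.reg d).cost +
    (Term.add (.load (.reg d)) (.lit 1)).cost + 1 := ⟨_, rfl⟩
  obtain ⟨c0, hc0⟩ : ∃ c, c = (Term.reg d).cost + (Term.lit 0).cost + 1 := ⟨_, rfl⟩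
  refine ⟨.seq (.store (.reg d) (.lit 0)) (.loop e (.seq P inc)),
    .C c0 + (.X * (.C (e.cost + 1) + (p + .C ci)) + .C (e.cost + 1)), ?_⟩
  intro n N B Inv hP hInv σ hσ hInvσ
  obtain ⟨t, τ, ht, htT, hτ⟩ := exec_for (P := .seq P inc) (e := e) (n := n)
    (T := p.eval n + ci) (fun m τ => Represents N (B m) τ ∧ τ (slot N.base 0 d) = m ∧ Inv m τ)
    (by
      rintro m - τ ⟨hτ, hm, -⟩
      simp only [he, Term.eval, Term.eval_reg hτ.base, hτ.size, hm])
    (by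
      rintro m hm τ ⟨hτ, hd, hi⟩
      obtain ⟨t, ρ, k1, k2, k3, k4, k5⟩ := hP m hm τ hτ hd hi
      have x := Exec.store (.reg d) (.add (.load (.reg d)) (.lit 1)) ρ
      simp only [Term.eval, Term.eval_reg k3.base, k4] at x
      exact ⟨_, _, k1.seq x, by omega, k3.update_aux two_pos _ _, by simp, hInv _ _ _ k5⟩)
    (σ := Function.update σ (slot N.base 0 d) 0)
    ⟨hσ.update_aux two_pos _ _, by simp, hInv _ _ _ hInvσ⟩
  have x := Exec.store (.reg d) (.lit 0) σ
  rw [Term.eval_reg hσ.base, Term.eval] at x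
  refine ⟨_, τ, x.seq ht, ?_, hτ.1, hτ.2.2⟩
  simp only [Polynomial.eval_add, Polynomial.eval_C, Polynomial.eval_mul, Polynomial.eval_X]
  omega

/-- All entries must be computed from the old arrays, and `f` may read array `a` itself. The values
are therefore first collected in the auxiliary block 1 and copied in a second loop. -/
theorem Transforms.update (a : ℕ)
    {f : ∀ n, Network n → Arrays n → (Fin k → Fin n) → Fin n → ℕ}
    (hf : Computes (k := k + 1)
      (fun n N A y => f n N A (fun j => y j.castSucc) (y (Fin.last k)))) :
    Transforms (fun n N A x => Function.update A a fun i => f n N A x i) := by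
  intro m d hm
  obtain ⟨P, p, hP⟩ := hf (Fin.snoc (α := fun _ => ℕ) m d) (d + 1) fun j => by
    refine Fin.lastCases ?_ (fun j => ?_) j
    · simp
    · have := hm j
      simp only [Fin.snoc_castSucc]
      omega
  set s₁ : Program := .store (.slot 1 (.load (.reg d))) (.load (.reg (d + 1))) with hs₁
  set s₂ : Program := .store (.slot (a + 2) (.load (.reg d)))
    (.load (.slot 1 (.load (.reg d)))) with hs₂
  obtain ⟨c1, hc1⟩ : ∃ c, c = (Term.slot 1 (.load (.reg d))).cost +
    (Term.load (.reg (d + 1))).cost + 1 := ⟨_, rfl⟩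
  obtain ⟨c2, hc2⟩ : ∃ c, c = (Term.slot (a + 2) (.load (.reg d))).cost +
    (Term.load (.slot 1 (.load (.reg d)))).cost + 1 := ⟨_, rfl⟩
  obtain ⟨Q₁, q₁, hQ₁⟩ := exists_exec_forEach d (.seq P s₁) (p + .C c1)
  obtain ⟨Q₂, q₂, hQ₂⟩ := exists_exec_forEach d s₂ (.C c2)
  refine ⟨.seq Q₁ Q₂, q₁ + q₂, fun n N A x σ hσ hx => ?_⟩
  have hne : ∀ {j j'}, j ≠ j' → slot N.base 0 j ≠ slot N.base 0 j' :=
    fun hj e => hj (slot_inj.1 e).2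
  have hne' : ∀ {a b}, a ≠ b → ∀ i j, slot N.base a i ≠ slot N.base b j :=
    fun hab i j e => hab (slot_inj.1 e).1
  obtain ⟨t, τ, h1, h2, h3, h4, h5⟩ := hQ₁ n N (fun _ => A)
    (fun l τ => (∀ j < d, τ (slot N.base 0 j) = σ (slot N.base 0 j)) ∧
      ∀ i : Fin n, i.val < l → τ (slot N.base 1 i) = f n N A x i)
    (by
      rintro l hl τ hτ hd ⟨hr, hi⟩
      obtain ⟨t, ρ, k1, k2, k3, k4⟩ := hP n N A (Fin.snoc (α := fun _ => Fin n) x ⟨l, hl⟩) τ hτ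
        fun j => by
          refine Fin.lastCases ?_ (fun j => ?_) j
          · simpa using hd
          · simp only [Fin.snoc_castSucc]
            rw [hr _ (hm j), hx]
      have hρ := hτ.of_agreesBelow k3
      have y := Exec.store (.slot 1 (.load (.reg d))) (.load (.reg (d + 1))) ρ
      simp only [Term.eval, Term.eval_reg hρ.base, Term.eval_slot hρ.base, k4,
        k3.register (Nat.lt_succ_self d), hd, Fin.snoc_castSucc, Fin.snoc_last] at y
      refine ⟨_, _, k1.seq y, ?_, hρ.update_aux one_lt_two _ _, ?_, ?_, ?_⟩
      · rw [Polynomial.eval_add, Polynomial.eval_C]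
        omega
      · rw [Function.update_of_ne (hne' zero_ne_one _ _), k3.register (Nat.lt_succ_self d), hd]
      · intro j hj
        rw [Function.update_of_ne (hne' zero_ne_one _ _), k3.register (by omega), hr j hj]
      · intro i hil
        rcases Nat.lt_succ_iff_lt_or_eq.1 hil with h | h
        · rw [Function.update_of_ne, k3 _ fun j _ => hne' one_ne_zero _ _, hi i h]
          intro e
          exact h.ne (slot_inj.1 e).2
        · subst h
          rw [Function.update_self])
    (by
      rintro l τ y ⟨hr, hi⟩
      refine ⟨fun j hj => ?_, fun i hil => ?_⟩
      · rw [Function.update_of_ne (hne hj.ne), hr j hj]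
      · rw [Function.update_of_ne (hne' one_ne_zero _ _), hi i hil])
    σ hσ ⟨fun _ _ => rfl, fun _ h => absurd h (Nat.not_lt_zero _)⟩
  obtain ⟨u, ρ, k1, k2, k3, k4, -⟩ := hQ₂ n N
    (fun l => Function.update A a fun i => if i.val < l then f n N A x i else A a i)
    (fun l τ => (∀ j < d, τ (slot N.base 0 j) = σ (slot N.base 0 j)) ∧
      ∀ i : Fin n, τ (slot N.base 1 i) = f n N A x i)
    (by
      rintro l hl τ hτ hd ⟨hr, hi⟩
      have y := Exec.store (.slot (a + 2) (.load (.reg d))) (.load (.slot 1 (.load (.reg d)))) τ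
      simp only [Term.eval, Term.eval_reg hτ.base, Term.eval_slot hτ.base, hd] at y
      have hil := hi ⟨l, hl⟩
      rw [Fin.val_mk] at hil
      rw [hil] at y
      refine ⟨_, _, y, ?_, ?_, ?_, ?_, ?_⟩
      · rw [Polynomial.eval_C, hc2]
      · have := hτ.update_array a ⟨l, hl⟩ (f n N A x ⟨l, hl⟩)
        convert this using 1
        rw [Function.update_idem, Function.update_self]
        congr 1
        ext i
        by_cases h : i = ⟨l, hl⟩
        · subst h
          simp
        · have h' : i.val ≠ l := fun e => h (Fin.ext e)
          rw [Function.update_of_ne h]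
          have : i.val < l + 1 ↔ i.val < l := by omega
          simp [this]
      · rw [Function.update_of_ne (hne' (by omega) _ _), hd]
      · intro j hj
        rw [Function.update_of_ne (hne' (by omega) _ _), hr j hj]
      · intro i
        rw [Function.update_of_ne (hne' (by omega) _ _), hi i])
    (by
      rintro l τ y ⟨hr, hi⟩
      refine ⟨fun j hj => ?_, fun i => ?_⟩
      · rw [Function.update_of_ne (hne hj.ne), hr j hj]
      · rw [Function.update_of_ne (hne' one_ne_zero _ _), hi i])
    τ (by simpa using h3) ⟨h4, fun i => h5 i i.2⟩
  refine ⟨_, ρ, h1.seq k1, ?_, by simpa using k3, k4⟩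
  rw [Polynomial.eval_add]
  omega

theorem Transforms.sweep
    {F : ∀ n, Network n → Arrays n → (Fin k → Fin n) → Fin n → Arrays n}
    (hF : Transforms (k := k + 1)
      (fun n N A y => F n N A (fun j => y j.castSucc) (y (Fin.last k)))) :
    Transforms (fun n N A x => RAM.sweep (fun i B => F n N B x i) n A) := by
  intro m d hm
  obtain ⟨P, p, hP⟩ := hF (Fin.snoc (α := fun _ => ℕ) m d) (d + 1) fun j => by
    refine Fin.lastCases ?_ (fun j => ?_) j
    · simp
    · have := hm j
      simp only [Fin.snoc_castSucc]
      omega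
  obtain ⟨Q, q, hQ⟩ := exists_exec_forEach d P p
  refine ⟨Q, q, fun n N A x σ hσ hx => ?_⟩
  obtain ⟨t, τ, h1, h2, h3, h4⟩ := hQ n N (fun l => RAM.sweep (fun i B => F n N B x i) l A)
    (fun _ τ => ∀ j < d, τ (slot N.base 0 j) = σ (slot N.base 0 j))
    (by
      intro l hl τ hτ hd hr
      obtain ⟨t, ρ, k1, k2, k3, k4⟩ := hP n N _ (Fin.snoc (α := fun _ => Fin n) x ⟨l, hl⟩) τ hτ
        fun j => by
          refine Fin.lastCases ?_ (fun j => ?_) j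
          · simpa using hd
          · simp only [Fin.snoc_castSucc]
            rw [hr _ (hm j), hx]
      refine ⟨t, ρ, k1, k2, ?_, by rw [k4 d (Nat.lt_succ_self d), hd],
        fun j hj => by rw [k4 j (by omega), hr j hj]⟩
      rw [sweep_succ _ hl]
      simpa using k3)
    (fun l τ y hr j hj => by
      rw [Function.update_of_ne, hr j hj]
      intro e
      exact hj.ne (slot_inj.1 e).2)
    σ hσ fun _ _ => rfl
  exact ⟨t, τ, h1, h2, h3, h4⟩

end

/-! ### Complete programs -/

theorem index_inj {n : ℕ} {i j i' j' : Fin n} (h : (i : ℕ) * n + j = i' * n + j') :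
    i = i' ∧ j = j' := by
  have hn : 0 < n := i.pos
  have h1 : ((i : ℕ) * n + j) / n = i := by
    rw [add_comm, Nat.add_mul_div_right _ _ hn, Nat.div_eq_of_lt j.2, zero_add]
  have h2 : ((i' : ℕ) * n + j') / n = i' := by
    rw [add_comm, Nat.add_mul_div_right _ _ hn, Nat.div_eq_of_lt j'.2, zero_add]
  have h3 : i = i' := Fin.ext (by rw [← h1, ← h2, h])
  subst h3
  exact ⟨rfl, Fin.ext (Nat.add_left_cancel h)⟩

/-- Without a base address there are no registers yet. The square of `n` is accumulated in cell 1,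
and cell 2 serves as the loop counter: it holds the diagonal entry (0, 0), which is 0 in the input
and 0 again when the loop ends. -/
theorem exists_exec_prepare : ∃ (P : Program) (p : Polynomial ℕ),
    ∀ n (N : Network n), ∃ t τ, Exec P (input N.graph N.source) t τ ∧ t ≤ p.eval n ∧
      Represents N (fun _ _ => 0) τ := by
  set n₀ : Term := .load (.lit 0) with hn₀
  set e₁ : Term := .add (.load (.lit 1)) (.add (.add (.add (.add (.add n₀ n₀) n₀) n₀) n₀) (.lit 2))
    with he₁
  set a₁ : Program := .store (.lit 1) (.add (.load (.lit 1)) n₀) with ha₁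
  set a₂ : Program := .store (.lit 2) (.sub (.load (.lit 2)) (.lit 1)) with ha₂
  obtain ⟨T, hT⟩ : ∃ T, T = ((Term.lit 1).cost + (Term.add (.load (.lit 1)) n₀).cost + 1) +
    ((Term.lit 2).cost + (Term.sub (.load (.lit 2)) (.lit 1)).cost + 1) := ⟨_, rfl⟩
  obtain ⟨c, hc⟩ : ∃ c, c = ((Term.lit 2).cost + n₀.cost + 1) +
    ((Term.lit 1).cost + e₁.cost + 1) := ⟨_, rfl⟩
  refine ⟨.seq (.store (.lit 2) n₀) (.seq (.store (.lit 1) e₁)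
    (.loop (.load (.lit 2)) (.seq a₁ a₂))), .C c + (.X * .C ((Term.load (.lit 2)).cost + 1 + T) +
      .C ((Term.load (.lit 2)).cost + 1)), fun n N => ?_⟩
  set σ := input N.graph N.source with hσ
  have hσ0 : σ 0 = n := rfl
  have hσ1 : σ 1 = N.source := rfl
  have hmem (m : ℕ) {a : ℕ} (h1 : a ≠ 1) (h2 : a ≠ 2) (x : ℕ) :
      Function.update (Function.update σ 1 x) 2 (n - m) a = σ a := by
    rw [Function.update_of_ne h2, Function.update_of_ne h1]
  obtain ⟨t, τ, h1, h2, h3⟩ := exec_for (P := .seq a₁ a₂) (e := .load (.lit 2)) (n := n) (T := T)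
    (fun m τ => τ = Function.update (Function.update σ 1 (N.source + 5 * n + 2 + m * n)) 2 (n - m))
    (by
      rintro m - τ rfl
      simp [Term.eval])
    (by
      rintro m hm τ rfl
      refine ⟨_, _, .seq (.store _ _ _) (.store _ _ _), hT.ge, ?_⟩
      simp only [Term.eval, hn₀]
      ext a
      by_cases ha1 : a = 1
      · subst ha1
        simp [hσ0]
        ring
      · by_cases ha2 : a = 2
        · subst ha2
          simp
          omega
        · simp [ha1, ha2])
    (σ := Function.update (Function.update σ 1 (N.source + 5 * n + 2)) 2 n) (by simp)
  have x1 := Exec.store (.lit 2) n₀ σ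
  have x2 := Exec.store (.lit 1) e₁ (Function.update σ 2 n)
  simp only [Term.eval, hn₀, he₁, hσ0] at x1 x2
  rw [show Function.update (Function.update σ 2 n) 1 _ =
    Function.update (Function.update σ 1 (N.source + 5 * n + 2)) 2 n by
      rw [Function.update_comm (by norm_num)]
      congr 2
      simp [hσ0, hσ1]
      ring] at x2
  refine ⟨_, τ, x1.seq (x2.seq h1), ?_, ?_⟩
  · simp only [Polynomial.eval_add, Polynomial.eval_C, Polynomial.eval_mul, Polynomial.eval_X]
    simp only [he₁, hn₀] at hc
    omega
  · have hlow : ∀ i j : Fin n, σ (2 + i * n + j) ≠ 0 ↔ N.graph.Adj i j := by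
      intro i j
      have h0 : 2 + i * n + j ≠ 0 := by omega
      have h1 : 2 + i * n + j ≠ 1 := by omega
      simp only [hσ, input, if_neg h0, if_neg h1]
      constructor
      · intro h
        obtain ⟨i', j', h2, h3⟩ : ∃ i' j' : Fin n, 2 + i * n + j = 2 + i' * n + j' ∧
            N.graph.Adj i' j' := by
          by_contra h'
          exact h (if_neg h')
        obtain ⟨rfl, rfl⟩ := index_inj (i := i) (j := j) (i' := i') (j' := j') (by omega)
        exact h3
      · intro h
        rw [if_pos ⟨i, j, rfl, h⟩]
        exact one_ne_zero
    subst h3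
    constructor
    · exact hmem _ (by norm_num) (by norm_num) _
    · rw [Function.update_of_ne (by norm_num), Function.update_self, Network.base]
    · intro i j
      -- In the cell of the counter the pair is diagonal, and a simple graph has no loops.
      by_cases h : 2 + (i : ℕ) * n + j = 2
      · have hi : (i : ℕ) * n + j = j * n + i := by
          have hj : (j : ℕ) = 0 := by omega
          have hi : (i : ℕ) = 0 := by
            have : (i : ℕ) * n = 0 := by omega
            rcases Nat.mul_eq_zero.1 this with h | h
            · exact h
            · exact absurd i.2 (by omega)
          rw [hi, hj]
        obtain ⟨rfl, -⟩ := index_inj hi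
        rw [h, Function.update_self]
        simp
      · rw [hmem _ (by omega) h, hlow]
    · intro a i
      have hb := lt_slot N.base (a + 2) i
      have hb2 : 2 ≤ N.base := by unfold Network.base; omega
      rw [hmem _ (by omega) (by omega)]
      simp only [hσ, input]
      rw [if_neg (by omega), if_neg (by omega), if_neg]
      rintro ⟨i', j', h, -⟩
      have := N.entry_lt_base i' j'
      omega

/-- Copy entry `v` of the arrays `o 0`, …, `o 4` to the cells `5 * v`, …, `5 * v + 4`, where `v` is
in register `0`.  Cell `1`, which may hold the base address, is the last one. -/
theorem exists_exec_emit (o : ℕ → ℕ) : ∃ (P : Program) (c : ℕ), ∀ n (N : Network n) (B : Arrays n)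
    (v : Fin n) (σ : Memory), σ 1 = N.base → (∀ a, σ (slot N.base (a + 2) v) = B a v) →
      σ (slot N.base 0 0) = v → ∃ τ, Exec P σ c τ ∧ (∀ j < 5, τ (5 * v + j) = B (o j) v) ∧
        ∀ a : ℕ, (∀ j < 5, a ≠ 5 * v + j) → τ a = σ a := by
  set r : Term := .load (.reg 0) with hr
  set w : ℕ → Term := fun j => .add (.add (.add (.add (.add r r) r) r) r) (.lit j) with hw
  set u : ℕ → Program := fun j => .store (w j) (.load (.slot (o j + 2) r)) with hu
  set κ : ℕ → ℕ := fun j => (w j).cost + (Term.load (.slot (o j + 2) r)).cost + 1 with hκ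
  refine ⟨.seq (u 4) (.seq (u 3) (.seq (u 2) (.seq (u 0) (u 1)))),
    κ 4 + (κ 3 + (κ 2 + (κ 0 + κ 1))), fun n N B v σ h1 hB h0 => ?_⟩
  have hlt : ∀ j < 5, ∀ a i, slot N.base a i ≠ 5 * v + j := fun j hj a i =>
    (N.lt_slot_of_lt (by have := v.2; unfold Network.base; omega) a i).symm
  have key : ∀ j (τ : Memory), τ 1 = N.base → (∀ a, τ (slot N.base (a + 2) v) = B a v) →
      τ (slot N.base 0 0) = v → Exec (u j) τ (κ j)
        (Function.update τ (5 * v + j) (B (o j) v)) := by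
    intro j τ h1 hB h0
    have := Exec.store (w j) (.load (.slot (o j + 2) r)) τ
    simp only [hw, Term.eval, hr, Term.eval_reg h1, Term.eval_slot h1, h0, hB] at this
    rw [show (v + v + v + v + v + j : ℕ) = 5 * v + j by ring] at this
    exact this
  have upd : ∀ j < 5, j ≠ 1 → ∀ τ : Memory, (τ 1 = N.base ∧
      (∀ a, τ (slot N.base (a + 2) v) = B a v) ∧ τ (slot N.base 0 0) = v) → ∀ x,
      (Function.update τ (5 * v + j) x 1 = N.base ∧
      (∀ a, Function.update τ (5 * v + j) x (slot N.base (a + 2) v) = B a v) ∧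
        Function.update τ (5 * v + j) x (slot N.base 0 0) = v) := by
    rintro j hj hj1 τ ⟨h1, hB, h0⟩ x
    refine ⟨?_, fun a => ?_, ?_⟩
    · rw [Function.update_of_ne (by omega), h1]
    · rw [Function.update_of_ne (hlt j hj _ _), hB]
    · rw [Function.update_of_ne (hlt j hj _ _), h0]
  have s4 : _ ∧ _ ∧ _ := ⟨h1, hB, h0⟩
  have s3 := upd 4 (by norm_num) (by norm_num) _ s4 (B (o 4) v)
  have s2 := upd 3 (by norm_num) (by norm_num) _ s3 (B (o 3) v)
  have s0 := upd 2 (by norm_num) (by norm_num) _ s2 (B (o 2) v)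
  have s1 := upd 0 (by norm_num) (by norm_num) _ s0 (B (o 0) v)
  refine ⟨_, (key 4 _ s4.1 s4.2.1 s4.2.2).seq ((key 3 _ s3.1 s3.2.1 s3.2.2).seq
    ((key 2 _ s2.1 s2.2.1 s2.2.2).seq ((key 0 _ s0.1 s0.2.1 s0.2.2).seq
    (key 1 _ s1.1 s1.2.1 s1.2.2)))), fun j hj => ?_, fun a ha => ?_⟩
  · interval_cases j <;> simp
  · have := ha 0 (by norm_num)
    have := ha 1 (by norm_num)
    have := ha 2 (by norm_num)
    have := ha 3 (by norm_num)
    have := ha 4 (by norm_num)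
    rw [Function.update_of_ne, Function.update_of_ne, Function.update_of_ne, Function.update_of_ne,
      Function.update_of_ne] <;> assumption

/-- The output overwrites cell 1, on which all addressing depends. The nodes are therefore emitted
in descending order, and node 0 comes after the loop, when no register has to be found any more. -/
theorem Transforms.exists_program
    {F : ∀ n, Network n → Arrays n → (Fin 0 → Fin n) → Arrays n} (hF : Transforms F) (o : ℕ → ℕ) :
    ∃ (P : Program) (p : Polynomial ℕ), ∀ n (N : Network n), ∃ t τ,
      Exec P (input N.graph N.source) t τ ∧ t ≤ p.eval n ∧
        ∀ (v : Fin n), ∀ j < 5, τ (5 * v + j) = F n N (fun _ _ => 0) Fin.elim0 (o j) v := by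
  obtain ⟨P, p, hP⟩ := exists_exec_prepare
  obtain ⟨Q, q, hQ⟩ := hF (fun _ => 0) 0 (fun j => j.elim0)
  obtain ⟨R, c, hR⟩ := exists_exec_emit o
  set r : Term := .load (.reg 0) with hr
  set dec : Program := .store (.reg 0) (.sub r (.lit 1)) with hdec
  set n₀ : Term := .sub (.load (.lit 0)) (.lit 1) with hn₀
  obtain ⟨T, hT⟩ : ∃ T, T = c + ((Term.reg 0).cost + (Term.sub r (.lit 1)).cost + 1) := ⟨_, rfl⟩
  obtain ⟨c', hc'⟩ : ∃ c', c' = (Term.reg 0).cost + n₀.cost + 1 := ⟨_, rfl⟩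
  refine ⟨.seq P (.seq Q (.seq (.store (.reg 0) n₀) (.seq (.loop r (.seq R dec)) R))),
    p + (q + (.C c' + ((.X * .C (r.cost + 1 + T) + .C (r.cost + 1)) + .C c))), fun n N => ?_⟩
  have hn : 0 < n := N.source.pos
  obtain ⟨t₁, σ₁, x1, y1, h1⟩ := hP n N
  obtain ⟨t₂, σ₂, x2, y2, h2, -⟩ := hQ n N _ Fin.elim0 σ₁ h1 fun j => j.elim0
  set B := F n N (fun _ _ => 0) Fin.elim0 with hB
  have x3 := Exec.store (.reg 0) n₀ σ₂
  simp only [Term.eval, Term.eval_reg h2.base, hn₀, h2.size] at x3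
  set σ₃ := Function.update σ₂ (slot N.base 0 0) (n - 1) with hσ₃
  have h3 : Represents N B σ₃ := h2.update_aux two_pos _ _
  have hlt : ∀ (v : Fin n), ∀ j < 5, ∀ a i, slot N.base a i ≠ 5 * v + j := fun v j hj a i =>
    (N.lt_slot_of_lt (by have := v.2; unfold Network.base; omega) a i).symm
  obtain ⟨t₄, σ₄, x4, y4, h4, h4a, h4r, h4v⟩ := exec_for (P := .seq R dec) (e := r)
    (n := n - 1) (T := T) (fun m τ => τ 1 = N.base ∧
      (∀ a (i : Fin n), τ (slot N.base (a + 2) i) = B a i) ∧ τ (slot N.base 0 0) = n - 1 - m ∧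
        ∀ v : Fin n, n - 1 - m < v → ∀ j < 5, τ (5 * v + j) = B (o j) v)
    (by
      rintro m - τ ⟨hτ, -, hm, -⟩
      rw [hr, Term.eval, Term.eval_reg hτ, hm])
    (by
      rintro m hm τ ⟨hτ1, hτa, hτ0, hτv⟩
      obtain ⟨ρ, z1, z2, z3⟩ := hR n N B ⟨n - 1 - m, by omega⟩ τ hτ1 (fun a => hτa a _) hτ0
      have hρ1 : ρ 1 = N.base := by rw [z3 1 fun j _ => by rw [Fin.val_mk]; omega, hτ1]
      have hρs : ∀ a i, ρ (slot N.base a i) = τ (slot N.base a i) := fun a i =>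
        z3 _ fun j hj => hlt _ j hj a i
      have z := Exec.store (.reg 0) (.sub r (.lit 1)) ρ
      simp only [Term.eval, hr, Term.eval_reg hρ1, hρs, hτ0] at z
      refine ⟨_, _, z1.seq z, by rw [hT], ?_, fun a i => ?_, ?_, fun v hv j hj => ?_⟩
      · rw [Function.update_of_ne, hρ1]
        exact N.lt_slot_of_lt (by unfold Network.base; omega) 0 0
      · rw [Function.update_of_ne, hρs, hτa]
        intro e
        have := (slot_inj.1 e).1
        omega
      · rw [Function.update_self]
        omega
      · rw [Function.update_of_ne (hlt v j hj 0 0).symm]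
        by_cases h : (v : ℕ) = n - 1 - m
        · have hv' : v = ⟨n - 1 - m, by omega⟩ := Fin.ext h
          rw [hv']
          exact z2 j hj
        · rw [z3 _ fun j' hj' => by dsimp only; omega]
          exact hτv v (by omega) j hj)
    (σ := σ₃) ⟨h3.base, h3.arrays, by rw [hσ₃, Function.update_self]; omega,
      fun v hv => absurd v.2 (by omega)⟩
  obtain ⟨σ₅, x5, z2, z3⟩ := hR n N B ⟨0, hn⟩ σ₄ h4 (fun a => h4a a _)
    (by rw [h4r, Fin.val_mk]; omega)
  refine ⟨_, σ₅, x1.seq (x2.seq (x3.seq (x4.seq x5))), ?_, fun v j hj => ?_⟩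
  · simp only [Polynomial.eval_add, Polynomial.eval_C, Polynomial.eval_mul, Polynomial.eval_X]
    have : (n - 1) * (r.cost + 1 + T) ≤ n * (r.cost + 1 + T) :=
      Nat.mul_le_mul_right _ (Nat.sub_le n 1)
    simp only [hn₀] at hc'
    omega
  · by_cases h : (v : ℕ) = 0
    · have hv' : v = ⟨0, hn⟩ := Fin.ext h
      rw [hv']
      exact z2 j hj
    · rw [z3 _ fun j' hj' => by dsimp only; omega]
      exact h4v v (by omega) j hj

end RAM

/-! ## The execution block by block -/

namespace RadioAlgorithm

variable {V Msg : Type*} {G : SimpleGraph V} {act : V → Option Msg} {v w : V}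

theorem heard_eq_some {x : Msg} (hv : act v = none) (hw : G.Adj v w) (hx : act w = some x)
    (h : ∀ u, G.Adj v u → act u ≠ none → u = w) : heard G act v = some x := by
  have h' : act v = none ∧ ∃! w, G.Adj v w ∧ act w ≠ none :=
    ⟨hv, w, ⟨hw, by simp [hx]⟩, fun u hu => h u hu.1 hu.2⟩
  rw [heard, dif_pos h', h _ h'.2.choose_spec.1.1 h'.2.choose_spec.1.2, hx]

theorem heard_eq_none (h : ¬(act v = none ∧ ∃! w, G.Adj v w ∧ act w ≠ none)) :
    heard G act v = none := dif_neg h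

open Classical in
theorem heard_ite (S : Set V) (x : Msg) :
    heard G (fun w => if w ∈ S then some x else none) v =
      if v ∉ S ∧ ∃! w, G.Adj v w ∧ w ∈ S then some x else none := by
  split_ifs with h
  · obtain ⟨h1, w, ⟨h2, h3⟩, h4⟩ := h
    exact heard_eq_some (by simp [h1]) h2 (by simp [h3]) fun u hu hu' =>
      h4 u ⟨hu, by simpa using hu'⟩
  · exact heard_eq_none (by simpa using h)

end RadioAlgorithm

namespace LevelledExecutor

open RadioAlgorithm

/-- one round of the execution -/
noncomputable def round {V M : Type*} (G : SimpleGraph V) (σ : V → State M) : V → State M :=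
  fun v => (algorithm M).update (σ v)
    (heard (Msg := Msg M) G (fun w => (algorithm M).transmit (σ w)) v)

section Blocks

variable {V : Type*} (G : SimpleGraph V) (ℓ : V → List Bool) (r : ℕ) (I D : Set V)

/-- the nodes that transmit in the Broadcast step of block `r`, if the dominating set is `D` -/
def senders : Set V := {v ∈ D | lev (ℓ v) = r % 3}

/-- the nodes that get informed in the Broadcast step -/
def broadcastInformed : Set V :=
  {u | u ∉ I ∧ lev (ℓ u) = (r + 1) % 3 ∧ ∃! w, G.Adj u w ∧ w ∈ senders ℓ r D}

/-- the nodes that transmit in the Feedback step -/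
def speakers : Set V :=
  {u ∈ broadcastInformed G ℓ r I D | stayBit (ℓ u) = true ∨ goBit (ℓ u) = true}

/-- The sender `v` hears the feedback of `u`. -/
def HearsFeedback (v u : V) : Prop :=
  v ∈ senders ℓ r D ∧ (G.Adj v u ∧ u ∈ speakers G ℓ r I D) ∧
    ∀ w, G.Adj v w ∧ w ∈ speakers G ℓ r I D → w = u

/-- the nodes that transmit in the Go step -/
def goSenders : Set V := {v | ∃ u, HearsFeedback G ℓ r I D v u ∧ goBit (ℓ u) = true}

/-- the nodes that get informed in the Go step -/
def goInformed : Set V :=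
  {u | u ∉ I ∪ broadcastInformed G ℓ r I D ∧ lev (ℓ u) = (r + 1) % 3 ∧
    ∃! w, G.Adj u w ∧ w ∈ goSenders G ℓ r I D}

/-- the informed nodes at the end of block `r` -/
def nextInformed : Set V := I ∪ broadcastInformed G ℓ r I D ∪ goInformed G ℓ r I D

/-- the dominating set at the end of block `r` -/
def nextDom : Set V :=
  {v ∈ D | lev (ℓ v) ≠ r % 3} ∪ {v | ∃ u, HearsFeedback G ℓ r I D v u ∧ stayBit (ℓ u) = true} ∪
    {v ∈ broadcastInformed G ℓ r I D ∪ goInformed G ℓ r I D | joinBit (ℓ v) = true}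

open Classical in
/-- the state of a node, given the clock, the informed nodes, the dominating set, the nodes that
were informed in the last Broadcast step and the nodes that transmit in the next Go step -/
noncomputable def config {M : Type*} (m : M) (c : ℕ) (I D F K : Set V) (v : V) : State M where
  label := ℓ v
  clock := c
  payload := if v ∈ I then some m else none
  inDom := decide (v ∈ D)
  fresh := decide (v ∈ F)
  goNow := decide (v ∈ K)

variable {G ℓ r I D}

theorem goSenders_subset : goSenders G ℓ r I D ⊆ senders ℓ r D := fun _ ⟨_, h, _⟩ => h.1

theorem nextDom_subset (h : D ⊆ I) : nextDom G ℓ r I D ⊆ nextInformed G ℓ r I D := by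
  rintro v ((⟨hv, -⟩ | ⟨u, hu, -⟩) | ⟨hv, -⟩)
  · exact Or.inl (Or.inl (h hv))
  · exact Or.inl (Or.inl (h hu.1.1))
  · exact hv.elim (fun h => Or.inl (Or.inr h)) Or.inr

variable {M : Type*} (m : M)

theorem add_one_mod_three_ne (r : ℕ) : (r + 1) % 3 ≠ r % 3 := by omega

/-- This and the next two lemmas follow one block. Between blocks the flags `fresh` and `goNow` are
clear, so two sets describe the whole system; the hypothesis that the dominating set is informed
ensures that its members have a payload to send. -/
theorem round_broadcast (h : D ⊆ I) :
    round G (config ℓ m (3 * r) I D ∅ ∅) =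
    config ℓ m (3 * r + 1) (I ∪ broadcastInformed G ℓ r I D)
      (D ∪ {v ∈ broadcastInformed G ℓ r I D | joinBit (ℓ v) = true})
      (broadcastInformed G ℓ r I D) ∅ := by
  classical
  have hact : (fun w => (algorithm M).transmit (config ℓ m (3 * r) I D ∅ ∅ w)) =
      fun w => if w ∈ senders ℓ r D then some (Msg.data m) else none := by
    ext1 w
    by_cases hw : w ∈ D
    · simp [algorithm, config, State.isSender, State.block, senders, hw, h hw]
    · simp [algorithm, config, senders, hw]
  ext1 v
  have hheard := congrArg (fun f => heard (Msg := Msg M) G f v) hact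
  simp only [heard_ite] at hheard
  refine (congrArg ((algorithm M).update _) hheard).trans ?_
  by_cases hI : v ∈ I
  · have hv : v ∉ broadcastInformed G ℓ r I D := fun h' => h'.1 hI
    simp [algorithm, config, State.accept, hI, hv]
  · have hD : v ∉ D := fun h' => hI (h h')
    have hs : v ∉ senders ℓ r D := fun h' => hD h'.1
    by_cases hx : ∃! w, G.Adj v w ∧ w ∈ senders ℓ r D
    · rw [if_pos ⟨hs, hx⟩]
      by_cases hl : lev (ℓ v) = (r + 1) % 3
      · have hv : v ∈ broadcastInformed G ℓ r I D := ⟨hI, hl, hx⟩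
        simp [algorithm, config, State.accept, State.isReceiver, State.block, hI, hv, hl, hD]
      · have hv : v ∉ broadcastInformed G ℓ r I D := fun h' => hl h'.2.1
        simp [algorithm, config, State.accept, State.isReceiver, State.block, hI, hv, hl, hD]
    · rw [if_neg fun h' => hx h'.2]
      have hv : v ∉ broadcastInformed G ℓ r I D := fun h' => hx h'.2.2
      simp [algorithm, config, State.accept, hI, hv, hD]

theorem round_feedback (h : D ⊆ I) :
    round G (config ℓ m (3 * r + 1) (I ∪ broadcastInformed G ℓ r I D)
      (D ∪ {v ∈ broadcastInformed G ℓ r I D | joinBit (ℓ v) = true})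
      (broadcastInformed G ℓ r I D) ∅) =
    config ℓ m (3 * r + 2) (I ∪ broadcastInformed G ℓ r I D)
      ({v ∈ D | lev (ℓ v) ≠ r % 3} ∪
        {v | ∃ u, HearsFeedback G ℓ r I D v u ∧ stayBit (ℓ u) = true} ∪
        {v ∈ broadcastInformed G ℓ r I D | joinBit (ℓ v) = true})
      ∅ (goSenders G ℓ r I D) := by
  classical
  have hmod : (3 * r + 1) % 3 = 1 := by omega
  have hdiv : (3 * r + 1) / 3 = r := by omega
  set act : V → Option (Msg M) := fun w => if w ∈ speakers G ℓ r I D then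
    some (Msg.feedback (stayBit (ℓ w)) (goBit (ℓ w))) else none with hact'
  have hact : (fun w => (algorithm M).transmit (config ℓ m (3 * r + 1)
      (I ∪ broadcastInformed G ℓ r I D)
      (D ∪ {v ∈ broadcastInformed G ℓ r I D | joinBit (ℓ v) = true})
      (broadcastInformed G ℓ r I D) ∅ w)) = act := by
    ext1 w
    simp [algorithm, config, hact', hmod, speakers, and_or_left]
  ext1 v
  have hact2 := congrArg (fun f => heard (Msg := Msg M) G f v) hact
  refine (congrArg ((algorithm M).update _) hact2).trans ?_
  clear hact2 hact
  by_cases hs : v ∈ senders ℓ r D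
  · have hN : v ∉ broadcastInformed G ℓ r I D := fun h' => h'.1 (h hs.1)
    have hsp : v ∉ speakers G ℓ r I D := fun h' => hN h'.1
    by_cases hx : ∃ u, HearsFeedback G ℓ r I D v u
    · obtain ⟨u, hu⟩ := hx
      have hheard : heard G act v = some (Msg.feedback (stayBit (ℓ u)) (goBit (ℓ u))) :=
        heard_eq_some (by simp [hact', hsp]) hu.2.1.1 (by simp [hact', hu.2.1.2])
          fun w hw hw' => hu.2.2 w ⟨hw, by by_contra hn; simp [hact', hn] at hw'⟩
      have huniq : ∀ w, HearsFeedback G ℓ r I D v w ↔ w = u := fun w =>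
        ⟨fun hw => hu.2.2 w hw.2.1, fun e => e ▸ hu⟩
      refine (congrArg ((algorithm M).update _) hheard).trans ?_
      simp [algorithm, config, State.obey, State.isSender, State.block, hmod, hdiv, hs.1, hs.2, hN,
        goSenders, huniq]
    · have hheard : heard G act v = none := by
        refine heard_eq_none ?_
        rintro ⟨-, u, ⟨hu1, hu2⟩, hu3⟩
        refine hx ⟨u, hs, ⟨hu1, by by_contra hn; simp [hact', hn] at hu2⟩, fun w hw =>
          hu3 w ⟨hw.1, by simp [hact', hw.2]⟩⟩
      rw [not_exists] at hx
      refine (congrArg ((algorithm M).update _) hheard).trans ?_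
      simp [algorithm, config, State.obey, State.isSender, State.block, hmod, hdiv, hs.1, hs.2, hN,
        goSenders, hx]
  · have hf : ∀ u, ¬HearsFeedback G ℓ r I D v u := fun u hu => hs hu.1
    have hlev : v ∈ D → lev (ℓ v) ≠ r % 3 := fun hD hl => hs ⟨hD, hl⟩
    -- A node that has joined in this very block has residue r + 1, so it does not mistake itself
    -- for a sender that awaits feedback.
    have hobey : ¬((v ∈ D ∨ v ∈ broadcastInformed G ℓ r I D ∧ joinBit (ℓ v) = true) ∧
        lev (ℓ v) = r % 3) := by
      rintro ⟨hD | hN, hl⟩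
      · exact hlev hD hl
      · exact add_one_mod_three_ne r (hN.1.2.1.symm.trans hl)
    simp only [algorithm, config, State.obey, State.isSender, State.block, hmod, hdiv]
    by_cases hD : v ∈ D
    · simp [hD, hlev hD, goSenders, hf]
    · simp only [hD] at hobey
      by_cases hN : v ∈ broadcastInformed G ℓ r I D
      · have : lev (ℓ v) ≠ r % 3 := fun e => add_one_mod_three_ne r (hN.2.1.symm.trans e)
        simp [hD, hN, goSenders, hf, this]
      · simp [hD, hN, goSenders, hf]

theorem round_go (h : D ⊆ I) :
    round G (config ℓ m (3 * r + 2) (I ∪ broadcastInformed G ℓ r I D)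
      ({v ∈ D | lev (ℓ v) ≠ r % 3} ∪
        {v | ∃ u, HearsFeedback G ℓ r I D v u ∧ stayBit (ℓ u) = true} ∪
        {v ∈ broadcastInformed G ℓ r I D | joinBit (ℓ v) = true})
      ∅ (goSenders G ℓ r I D)) =
    config ℓ m (3 * (r + 1)) (nextInformed G ℓ r I D) (nextDom G ℓ r I D) ∅ ∅ := by
  classical
  have hmod : (3 * r + 2) % 3 = 2 := by omega
  have hdiv : (3 * r + 2) / 3 = r := by omega
  have hclock : 3 * (r + 1) = 3 * r + 2 + 1 := by ring
  have hact : (fun w => (algorithm M).transmit (config ℓ m (3 * r + 2)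
        (I ∪ broadcastInformed G ℓ r I D)
        ({v ∈ D | lev (ℓ v) ≠ r % 3} ∪
          {v | ∃ u, HearsFeedback G ℓ r I D v u ∧ stayBit (ℓ u) = true} ∪
          {v ∈ broadcastInformed G ℓ r I D | joinBit (ℓ v) = true})
        ∅ (goSenders G ℓ r I D) w)) =
      fun w => if w ∈ goSenders G ℓ r I D then some (Msg.data m) else none := by
    ext1 w
    by_cases hw : w ∈ goSenders G ℓ r I D
    · have hs := goSenders_subset hw
      simp [algorithm, config, State.isSender, State.block, hw, hmod, hdiv, hs.2, h hs.1]
    · simp [algorithm, config, hw, hmod]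
  rw [hclock]
  ext1 v
  have hheard := congrArg (fun f => heard (Msg := Msg M) G f v) hact
  simp only [heard_ite] at hheard
  refine (congrArg ((algorithm M).update _) hheard).trans ?_
  by_cases hI : v ∈ I ∪ broadcastInformed G ℓ r I D
  · have hv : v ∉ goInformed G ℓ r I D := fun h' => h'.1 hI
    simp only [algorithm, config, State.accept, hmod, if_pos hI, nextInformed, nextDom]
    simpa [hv] using fun h' => hI.resolve_left h'
  · have hI' : v ∉ I := fun h' => hI (Or.inl h')
    have hB : v ∉ broadcastInformed G ℓ r I D := fun h' => hI (Or.inr h')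
    have hD : v ∉ D := fun h' => hI' (h h')
    have hs : v ∉ goSenders G ℓ r I D := fun h' => hD (goSenders_subset h').1
    have hf : ∀ u, ¬HearsFeedback G ℓ r I D v u := fun u hu => hD hu.1.1
    by_cases hx : ∃! w, G.Adj v w ∧ w ∈ goSenders G ℓ r I D
    · rw [if_pos ⟨hs, hx⟩]
      by_cases hl : lev (ℓ v) = (r + 1) % 3
      · have hv : v ∈ goInformed G ℓ r I D := ⟨hI, hl, hx⟩
        simp [algorithm, config, State.accept, State.isReceiver, State.block, hmod, hdiv, hI', hB,
          hv, hl, hD, nextInformed, nextDom, hf]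
      · have hv : v ∉ goInformed G ℓ r I D := fun h' => hl h'.2.1
        simp [algorithm, config, State.accept, State.isReceiver, State.block, hmod, hdiv, hI', hB,
          hv, hl, hD, nextInformed, nextDom, hf]
    · rw [if_neg fun h' => hx h'.2]
      have hv : v ∉ goInformed G ℓ r I D := fun h' => hx h'.2.2
      simp [algorithm, config, State.accept, hmod, hI', hB, hv, hD, nextInformed, nextDom, hf]

end Blocks

/-! ### The execution at the block boundaries -/

section Snapshots

variable {V : Type*} (G : SimpleGraph V) (s : V) (ℓ : V → List Bool)

/-- the informed nodes and the dominating set at the beginning of block `r` -/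
def snapshot : ℕ → Set V × Set V
  | 0 => ({s}, {v | v = s ∧ joinBit (ℓ v) = true})
  | r + 1 => (nextInformed G ℓ r (snapshot r).1 (snapshot r).2,
      nextDom G ℓ r (snapshot r).1 (snapshot r).2)

theorem snapshot_subset (r : ℕ) : (snapshot G s ℓ r).2 ⊆ (snapshot G s ℓ r).1 := by
  induction r with
  | zero => exact fun v hv => hv.1
  | succ r ih => exact nextDom_subset ih

/-- The sets in `snapshot` do not mention the payload. This carries statements about `informed` and
`dom`, which are defined with the one-element payload type, over to every payload. -/
theorem run_three_mul {M : Type*} (m : M) (r : ℕ) :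
    (algorithm M).run G s ℓ m (3 * r) =
      config ℓ m (3 * r) (snapshot G s ℓ r).1 (snapshot G s ℓ r).2 ∅ ∅ := by
  classical
  induction r with
  | zero =>
    ext1 v
    by_cases hv : v = s <;> simp [run, algorithm, config, snapshot, hv]
  | succ r ih =>
    have hsub := snapshot_subset G s ℓ r
    have h1 : (algorithm M).run G s ℓ m (3 * r + 1) = _ :=
      (congrArg (round G) ih).trans (round_broadcast m hsub)
    have h2 : (algorithm M).run G s ℓ m (3 * r + 2) = _ :=
      (congrArg (round G) h1).trans (round_feedback m hsub)
    exact (congrArg (round G) h2).trans (round_go m hsub)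

theorem informed_eq (r : ℕ) : informed G s ℓ r = (snapshot G s ℓ r).1 := by
  ext v
  simp only [informed, run_three_mul, Set.mem_ofPred_eq]
  by_cases h : v ∈ (snapshot G s ℓ r).1 <;> simp [algorithm, config, h]

theorem dom_eq (r : ℕ) : dom G s ℓ r = (snapshot G s ℓ r).2 := by
  ext v
  simp only [dom, run_three_mul, Set.mem_ofPred_eq]
  simp [config]

theorem informed_zero : informed G s ℓ 0 = {s} := by rw [informed_eq, snapshot]

theorem dom_zero : dom G s ℓ 0 = {v | v = s ∧ joinBit (ℓ v) = true} := by rw [dom_eq, snapshot]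

theorem informed_succ (r : ℕ) : informed G s ℓ (r + 1) =
    nextInformed G ℓ r (informed G s ℓ r) (dom G s ℓ r) := by
  rw [informed_eq, informed_eq, dom_eq, snapshot]

theorem dom_succ (r : ℕ) : dom G s ℓ (r + 1) =
    nextDom G ℓ r (informed G s ℓ r) (dom G s ℓ r) := by
  rw [informed_eq, dom_eq, dom_eq, snapshot]

theorem dom_subset_informed (r : ℕ) : dom G s ℓ r ⊆ informed G s ℓ r := by
  rw [informed_eq, dom_eq]
  exact snapshot_subset G s ℓ r

theorem broadcastsIn_of_informed {r : ℕ} (h : ∀ v, v ∈ informed G s ℓ r) {M : Type*} (m : M) :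
    (algorithm M).BroadcastsIn G s ℓ m (3 * r) := by
  intro v
  have := h v
  rw [informed_eq] at this
  rw [run_three_mul]
  simp [algorithm, config, this]

end Snapshots

end LevelledExecutor

/-! ## Distances from the source -/

namespace SimpleGraph

variable {V : Type*} {G : SimpleGraph V} {s v w : V}

theorem Adj.dist_le_succ (h : G.Adj v w) : G.dist s w ≤ G.dist s v + 1 := by
  rcases h.diff_dist_adj (u := s) with h | h | h <;> omega

/-- Neighbouring levels are told apart by their residues modulo `3`. -/
theorem Adj.dist_eq_succ (h : G.Adj v w) {r : ℕ} (hv : G.dist s v % 3 = r % 3)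
    (hw : G.dist s w % 3 = (r + 1) % 3) : G.dist s w = G.dist s v + 1 := by
  have := h.dist_le_succ (s := s)
  have := h.symm.dist_le_succ (s := s)
  omega

theorem Connected.exists_adj_dist_eq (hG : G.Connected) {l : ℕ} (h : G.dist s w = l + 1) :
    ∃ v, G.Adj v w ∧ G.dist s v = l := by
  obtain ⟨p, hp⟩ := hG.exists_walk_length_eq_dist w s
  rw [dist_comm, h] at hp
  cases p with
  | nil => simp at hp
  | @cons _ v _ hadj q =>
    refine ⟨v, hadj.symm, ?_⟩
    have h1 : G.dist s v ≤ q.length := by rw [dist_comm]; exact dist_le q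
    have h2 := hadj.symm.dist_le_succ (s := s)
    rw [Walk.length_cons] at hp
    omega

theorem Connected.dist_lt_card [Fintype V] (hG : G.Connected) (s v : V) :
    G.dist s v < Fintype.card V := by
  obtain ⟨p, hp, hl⟩ := hG.exists_path_of_dist s v
  exact hl ▸ hp.length_lt

end SimpleGraph

/-! ## Consequences of the labeling scheme -/

namespace LevelledExecutor

variable {V : Type*} {G : SimpleGraph V} {s : V} {ℓ : V → List Bool} {r : ℕ}

theorem informed_subset_succ (r : ℕ) : informed G s ℓ r ⊆ informed G s ℓ (r + 1) := by
  rw [informed_succ]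
  exact fun v hv => Or.inl (Or.inl hv)

theorem informed_mono : Monotone (informed G s ℓ) := monotone_nat_of_le_succ informed_subset_succ

/-- Nodes enter the dominating set only at the moment when they are informed; whoever has left never
returns. -/
theorem mem_dom_of_succ {v : V} (h : v ∈ dom G s ℓ (r + 1)) (hv : v ∈ informed G s ℓ r) :
    v ∈ dom G s ℓ r := by
  rw [dom_succ] at h
  rcases h with (h | ⟨u, hu, -⟩) | h
  · exact h.1
  · exact hu.1.1
  · exact h.1.elim (fun h => absurd hv h.1) fun h => absurd (Or.inl hv) h.1

theorem mem_dom_of_le {v : V} {r' : ℕ} (hr : r' ≤ r) (h : v ∈ dom G s ℓ r)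
    (hv : v ∈ informed G s ℓ r') : v ∈ dom G s ℓ r' := by
  induction r, hr using Nat.le_induction with
  | base => exact h
  | succ r hr ih => exact ih (mem_dom_of_succ h (informed_mono hr hv))

/-- Since there is no return, a present member that was informed at the earlier time was a member at
that time. This turns the set A of the scheme into one to which the domination condition applies. -/
theorem dom_inter_dom {r' : ℕ} (hr : r' ≤ r) :
    dom G s ℓ r' ∩ dom G s ℓ r = informed G s ℓ r' ∩ dom G s ℓ r := by
  ext v
  exact ⟨fun h => ⟨dom_subset_informed G s ℓ r' h.1, h.2⟩,
    fun h => ⟨mem_dom_of_le hr h.2 h.1, h.2⟩⟩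

/-- If the only neighbour of a sender that can speak is the sender's own feedback node, there are no
collisions. The function `f` is arbitrary because the lemma serves both a given labeling and a
schedule. -/
theorem hearsFeedback_iff {I D : Set V} {f : V → Option V}
    (h₁ : ∀ v ∈ senders ℓ r D, ∀ u, f v = some u → G.Adj v u ∧ u ∈ broadcastInformed G ℓ r I D)
    (h₂ : ∀ v ∈ senders ℓ r D, ∀ u ∈ speakers G ℓ r I D, G.Adj v u → f v = some u) (v u : V) :
    HearsFeedback G ℓ r I D v u ↔
      v ∈ senders ℓ r D ∧ f v = some u ∧ (stayBit (ℓ u) = true ∨ goBit (ℓ u) = true) := by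
  constructor
  · rintro ⟨hv, hu, -⟩
    exact ⟨hv, h₂ v hv u hu.2 hu.1, hu.2.2⟩
  · rintro ⟨hv, hf, hu⟩
    refine ⟨hv, ⟨(h₁ v hv u hf).1, (h₁ v hv u hf).2, hu⟩, fun w hw => ?_⟩
    exact Option.some_injective _ ((h₂ v hv w hw.2 hw.1).symm.trans hf)

theorem DominatesFrontier.minimal {I : Set V} {l : ℕ} {S : Set V} (h : DominatesFrontier G s I l S)
    (hS : ∀ v ∈ S, ∃ w ∈ level G s (l + 1) \ I, G.Adj v w ∧ ∀ u ∈ S, G.Adj u w → u = v) :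
    Minimal (DominatesFrontier G s I l) S := by
  refine ⟨h, fun S' hS' hsub v hv => ?_⟩
  obtain ⟨w, hw, hvw, hu⟩ := hS v hv
  obtain ⟨u, hu', huw⟩ := hS'.2 w hw ⟨v, h.1 hv, hvw⟩
  exact hu u (hsub hu') huw ▸ hu'

/-- A node without a private frontier node could be dropped from the set. Together with the
preceding lemma this identifies minimality with the existence of private frontier nodes. -/
theorem exists_private_of_minimal {I : Set V} {l : ℕ} {S : Set V}
    (h : Minimal (DominatesFrontier G s I l) S) {v : V} (hv : v ∈ S) :
    ∃ w ∈ level G s (l + 1) \ I, G.Adj v w ∧ ∀ u ∈ S, G.Adj u w → u = v := by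
  by_contra hcon
  push Not at hcon
  have hdom : DominatesFrontier G s I l (S \ {v}) := by
    refine ⟨fun u hu => h.prop.1 hu.1, fun w hw hI => ?_⟩
    obtain ⟨u, hu, huw⟩ := h.prop.2 w hw hI
    by_cases huv : u = v
    · subst huv
      obtain ⟨u', hu', hu'w, hne⟩ := hcon w hw huw
      exact ⟨u', ⟨hu', hne⟩, hu'w⟩
    · exact ⟨u, ⟨hu, huv⟩, huw⟩
  exact (h.le_of_le hdom Set.sdiff_subset hv).2 rfl

section

variable (hlev : ∀ v, lev (ℓ v) = G.dist s v % 3)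

include hlev

theorem activeDom_eq : activeDom G s ℓ r = senders ℓ r (dom G s ℓ r) := by
  ext v
  simp [activeDom, senders, hlev]

theorem mem_broadcastInformed_iff {u : V} :
    u ∈ broadcastInformed G ℓ r (informed G s ℓ r) (dom G s ℓ r) ↔
      ∃ v, InformedBy G s ℓ r v u := by
  constructor
  · rintro ⟨hu, hl, v, ⟨h1, h2⟩, h3⟩
    have h2' := h2
    rw [← activeDom_eq hlev] at h2'
    rw [hlev] at hl
    refine ⟨v, h2', hu, h1.symm.dist_eq_succ h2'.2 hl, h1.symm, fun w hw hwu => ?_⟩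
    rw [activeDom_eq hlev] at hw
    exact h3 w ⟨hwu.symm, hw⟩
  · rintro ⟨v, h1, h2, h3, h4, h5⟩
    refine ⟨h2, ?_, v, ⟨h4.symm, ?_⟩, fun w hw => h5 w ?_ hw.1.symm⟩
    · rw [hlev, h3]
      have := h1.2
      omega
    · rwa [← activeDom_eq hlev]
    · rw [activeDom_eq hlev]
      exact hw.2

theorem InformedBy.mem_informed_succ {v u : V} (h : InformedBy G s ℓ r v u) :
    u ∈ informed G s ℓ (r + 1) := by
  rw [informed_succ]
  exact Or.inl (Or.inr ((mem_broadcastInformed_iff hlev).2 ⟨v, h⟩))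

/-- Being informed is permanent, which fixes the block, and hearing requires a single transmitter,
which fixes the sender. Hence one pair of bits per node can never receive two conflicting tasks. -/
theorem InformedBy.unique {v u v' : V} {r' : ℕ} (h : InformedBy G s ℓ r v u)
    (h' : InformedBy G s ℓ r' v' u) : r' = r ∧ v' = v := by
  have hr : r' = r := by
    by_contra hne
    rcases Nat.lt_or_gt_of_ne hne with hlt | hlt
    · exact h.2.1 (informed_mono hlt (h'.mem_informed_succ hlev))
    · exact h'.2.1 (informed_mono hlt (h.mem_informed_succ hlev))
  subst hr
  exact ⟨rfl, h.2.2.2.2 v' h'.1 h'.2.2.2.1⟩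

end

/-! ### Feedback and Go steps under the labeling scheme -/

section

variable {fb : ℕ → V → Option V} (h : IsLabelingWith G s ℓ fb)

include h

theorem IsLabelingWith.dom_zero : dom G s ℓ 0 = {s} := by
  ext v
  simp only [LevelledExecutor.dom_zero, Set.mem_ofPred_eq, Set.mem_singleton_iff]
  exact ⟨fun h => h.1, fun e => ⟨e, by rw [e, h.source]; rfl⟩⟩

/-- The private frontier node of `v` hears `v` alone. Block 0 is excluded, because minimality is not
required there. -/
theorem IsLabelingWith.exists_informedBy (hr : 1 ≤ r) {v : V} (hv : v ∈ activeDom G s ℓ r) :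
    ∃ u, InformedBy G s ℓ r v u := by
  obtain ⟨u, hu, hvu, huniq⟩ := exists_private_of_minimal (h.minimal r _ hr hv.2) ⟨hv.1, rfl⟩
  refine ⟨u, hv, hu.2, hu.1, hvu, fun w hw hwu => huniq w ⟨hw.1, ?_⟩ hwu⟩
  have h1 : G.dist s u = G.dist s v + 1 := hu.1
  have h2 := hv.2
  -- Active nodes of other levels are at least three levels away, hence not adjacent to `u`.
  have := hwu.dist_eq_succ (s := s) (r := r) hw.2 (by omega)
  simp only [level, Set.mem_ofPred_eq]
  omega

theorem IsLabelingWith.hearsFeedback_iff (v u : V) :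
    HearsFeedback G ℓ r (informed G s ℓ r) (dom G s ℓ r) v u ↔ v ∈ activeDom G s ℓ r ∧
      fb r v = some u ∧ (stayBit (ℓ u) = true ∨ goBit (ℓ u) = true) := by
  rw [activeDom_eq h.lev_eq]
  refine LevelledExecutor.hearsFeedback_iff (fun v hv u hu => ?_) (fun v hv u hu hvu => ?_) v u
  · have := h.fb_informedBy r v u hu
    exact ⟨this.2.2.2.1, (mem_broadcastInformed_iff h.lev_eq).2 ⟨v, this⟩⟩
  · obtain ⟨v', hv'⟩ := (mem_broadcastInformed_iff h.lev_eq).1 hu.1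
    have hfb : ∃ r'' v'', fb r'' v'' = some u := by
      by_contra hn
      push Not at hn
      have := h.non_fb u hn
      rcases hu.2 with h' | h' <;> simp [this] at h'
    obtain ⟨r'', v'', hfb⟩ := hfb
    obtain ⟨rfl, rfl⟩ := hv'.unique h.lev_eq (h.fb_informedBy _ _ _ hfb)
    rw [← activeDom_eq h.lev_eq] at hv
    rwa [hv'.2.2.2.2 v hv hvu]

theorem IsLabelingWith.mem_goSenders_iff (v : V) :
    v ∈ goSenders G ℓ r (informed G s ℓ r) (dom G s ℓ r) ↔
      v ∈ activeDom G s ℓ r ∧ ∃ u, fb r v = some u ∧ goBit (ℓ u) = true := by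
  simp only [goSenders, h.hearsFeedback_iff, Set.mem_ofPred_eq]
  constructor
  · rintro ⟨u, ⟨h1, h2, -⟩, h3⟩
    exact ⟨h1, u, h2, h3⟩
  · rintro ⟨h1, u, h2, h3⟩
    exact ⟨u, ⟨h1, h2, Or.inr h3⟩, h3⟩

/-- Every node of A' is active and has a feedback node, whose Go bit is 1; no other node of level
`l` transmits in the Go step. So a node of B' that missed the Broadcast step now hears its unique
neighbour in A'. -/
theorem IsLabelingWith.selected_informed [Finite V] {l : ℕ} (hl : l % 3 = r % 3) {A' B' : Set V}
    (hsel : IsSelection G (stageDom G s ℓ l r) (stageFrontier G s ℓ l r) A' B')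
    (hgo : ∀ v ∈ level G s l, ∀ u, fb r v = some u → (goBit (ℓ u) = true ↔ v ∈ A')) :
    B' ⊆ informed G s ℓ (r + 1) := by
  intro b hb
  have hbF := hsel.2.1 hb
  have hbl : G.dist s b = l + 1 := hbF.1.1
  have hbI : b ∉ informed G s ℓ r := hbF.1.2
  obtain ⟨a, ⟨haA, hab⟩, ha⟩ := hsel.2.2.1 b hb
  have haS := hsel.1 haA
  have hal : G.dist s a = l := haS.2
  have hact : a ∈ activeDom G s ℓ r := ⟨haS.1.2, by rw [hal, hl]⟩
  have hlev_b : lev (ℓ b) = (r + 1) % 3 := by rw [h.lev_eq, hbl]; omega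
  have hinf : ∃ u, InformedBy G s ℓ r a u := by
    -- In block 0 the only sender is the source, which informs `b` itself.
    rcases Nat.eq_zero_or_pos r with hr | hr
    · subst hr
      refine ⟨b, hact, hbI, by rw [hal, hbl], hab, fun w hw _ => ?_⟩
      have hw' := hw.1
      have ha' := hact.1
      rw [h.dom_zero] at hw' ha'
      rw [hw', ha']
    · exact h.exists_informedBy hr hact
  obtain ⟨u, hu⟩ := h.fb_exists r a hinf
  have hgoA : a ∈ goSenders G ℓ r (informed G s ℓ r) (dom G s ℓ r) :=
    (h.mem_goSenders_iff a).2 ⟨hact, u, hu, (hgo a hal u hu).2 haA⟩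
  rw [informed_succ]
  by_cases hbB : b ∈ broadcastInformed G ℓ r (informed G s ℓ r) (dom G s ℓ r)
  · exact Or.inl (Or.inr hbB)
  · refine Or.inr ⟨fun hn => hn.elim hbI hbB, hlev_b, a, ⟨hab.symm, hgoA⟩, ?_⟩
    rintro w ⟨hbw, hw⟩
    obtain ⟨hwact, u', hu', hgo'⟩ := (h.mem_goSenders_iff w).1 hw
    have hwl : G.dist s w = l := by
      have := hbw.symm.dist_eq_succ (s := s) (r := r) hwact.2 (by rw [hbl]; omega)
      omega
    exact ha w ⟨(hgo w hwl u' hu').1 hgo', hbw.symm⟩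

/-! ### Progress of the broadcast, level by level -/

variable (hG : G.Connected)

include hG

/-- When level `l` is complete at the start of the stage, A contains every present member of the
dominating set on this level, and these dominate all that is still uninformed on the next level: by
connectedness each such node has a neighbour on level `l`. -/
theorem IsLabelingWith.stageFrontier_eq {l r' : ℕ} (hl : l % 3 = r % 3)
    (hr' : stageStart (Nat.card V) r = r') (hr'r : r' ≤ r)
    (hlevel : level G s l ⊆ informed G s ℓ r') :
    stageFrontier G s ℓ l r = level G s (l + 1) \ informed G s ℓ r := by
  ext w
  refine ⟨fun hw => hw.1, fun hw => ⟨hw, ?_⟩⟩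
  obtain ⟨v, hvw, hv⟩ := hG.exists_adj_dist_eq hw.1
  rw [stageDom, hr', dom_inter_dom hr'r]
  rcases Nat.eq_zero_or_pos r with hr | hr
  · obtain rfl : r' = 0 := by omega
    have hvi : v ∈ informed G s ℓ 0 := hlevel hv
    refine ⟨v, ⟨⟨hvi, ?_⟩, hv⟩, hvw⟩
    rw [hr, h.dom_zero]
    rwa [informed_zero] at hvi
  · obtain ⟨u, hu, huw⟩ := (h.minimal r l hr hl).prop.2 w hw
      ⟨v, ⟨informed_mono hr'r (hlevel hv), hv⟩, hvw⟩
    exact ⟨u, ⟨⟨hlevel hu.2, hu.1⟩, hu.2⟩, huw⟩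

/-- At least |B| / (15 max(1, log |A|)) nodes are served, and the logarithm is at most the rounded
logarithm of n. -/
theorem IsLabelingWith.ncard_uninformed_succ_le [Finite V] {l : ℕ} (hl : l % 3 = r % 3)
    (hcard : 2 ≤ Nat.card V) (hlevel : level G s l ⊆ informed G s ℓ (stageStart (Nat.card V) r)) :
    ((level G s (l + 1) \ informed G s ℓ (r + 1)).ncard : ℝ) ≤
      (1 - 1 / (15 * (Nat.clog 2 (Nat.card V) : ℝ))) *
        (level G s (l + 1) \ informed G s ℓ r).ncard := by
  set k := Nat.clog 2 (Nat.card V) with hk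
  have hk1 : 1 ≤ k := Nat.clog_pos (by norm_num) (by omega)
  have hk1' : (1 : ℝ) ≤ k := by exact_mod_cast hk1
  obtain ⟨A', B', hsel, hgo⟩ := h.go_selection r l hl
  have hinf := h.selected_informed hl hsel hgo
  have hfr := h.stageFrontier_eq hG hl rfl (Nat.mul_div_le _ _) hlevel
  set U := level G s (l + 1) \ informed G s ℓ r with hU
  set U' := level G s (l + 1) \ informed G s ℓ (r + 1) with hU'
  have hB' : B' ⊆ U := hfr ▸ hsel.2.1
  have h1 : U'.ncard + B'.ncard ≤ U.ncard := by
    rw [← Set.ncard_union_eq (Set.disjoint_left.2 fun v hv hv' => hv.2 (hinf hv'))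
      (Set.toFinite _) (Set.toFinite _)]
    exact Set.ncard_le_ncard (Set.union_subset (fun v hv =>
      ⟨hv.1, fun hn => hv.2 (informed_subset_succ r hn)⟩) hB') (Set.toFinite _)
  have hlog : max 1 (Real.logb 2 (stageDom G s ℓ l r).ncard) ≤ k := by
    refine max_le hk1' ?_
    rcases Nat.eq_zero_or_pos (stageDom G s ℓ l r).ncard with h0 | h0
    · rw [h0]
      simp
    · rw [Real.logb_le_iff_le_rpow (by norm_num) (by exact_mod_cast h0), Real.rpow_natCast]
      have : (stageDom G s ℓ l r).ncard ≤ 2 ^ k :=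
        (Set.ncard_le_card _).trans (Nat.le_pow_clog (by norm_num) _)
      exact_mod_cast this
  have h2 : (U.ncard : ℝ) ≤ 15 * k * B'.ncard := by
    have := hsel.2.2.2
    rw [hfr] at this
    refine this.trans ?_
    gcongr
  have h3 : (U'.ncard : ℝ) + B'.ncard ≤ U.ncard := by exact_mod_cast h1
  have h4 : (U.ncard : ℝ) / (15 * k) ≤ B'.ncard := by
    rw [div_le_iff₀ (by positivity)]
    linarith
  calc (U'.ncard : ℝ) ≤ U.ncard - U.ncard / (15 * k) := by linarith
    _ = _ := by ring

/-- A level has its turn only in every third block, so three stages contain the `T` turns that are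
needed. All of them belong to stages that start when level `l` is already complete. -/
theorem IsLabelingWith.level_succ_subset [Finite V] (hcard : 2 ≤ Nat.card V) {l j : ℕ}
    (hlevel : level G s l ⊆ informed G s ℓ (stageLength (Nat.card V) * j)) :
    level G s (l + 1) ⊆ informed G s ℓ (stageLength (Nat.card V) * (j + 3)) := by
  set n := Nat.card V with hn
  set k := Nat.clog 2 n with hk
  set T := stageLength n with hT
  have hTk : T = 15 * k ^ 2 := rfl
  have hk1 : 1 ≤ k := Nat.clog_pos (by norm_num) (by omega)
  have hk1' : (1 : ℝ) ≤ k := by exact_mod_cast hk1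
  have hT0 : 0 < T := by rw [hTk]; positivity
  set q : ℝ := 1 - 1 / (15 * (k : ℝ)) with hq
  have hq0 : 0 ≤ q := by
    rw [hq, sub_nonneg, div_le_one (by positivity)]
    linarith
  set U : ℕ → Set V := fun r => level G s (l + 1) \ informed G s ℓ r with hU
  have hanti : ∀ {r r'}, r ≤ r' → (U r').ncard ≤ (U r).ncard := fun hr =>
    Set.ncard_le_ncard (fun v hv => ⟨hv.1, fun hn => hv.2 (informed_mono hr hn)⟩) (Set.toFinite _)
  have step : ∀ i, ((U (T * j + l % 3 + 3 * i + 1)).ncard : ℝ) ≤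
      q * (U (T * j + l % 3 + 3 * i)).ncard := by
    intro i
    -- The length of a stage is divisible by 3, so the offset `l % 3` points to a turn of level `l`.
    have hmod : l % 3 = (T * j + l % 3 + 3 * i) % 3 := by
      have : T * j = 3 * (5 * k ^ 2 * j) := by rw [hTk]; ring
      omega
    have hstage : T * j ≤ stageStart n (T * j + l % 3 + 3 * i) := by
      unfold stageStart
      refine Nat.mul_le_mul_left _ ?_
      rw [Nat.le_div_iff_mul_le hT0, mul_comm]
      omega
    exact h.ncard_uninformed_succ_le hG hmod hcard (hlevel.trans (informed_mono hstage))
  have key : ∀ i, ((U (T * j + l % 3 + 3 * i)).ncard : ℝ) ≤ q ^ i * n := by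
    intro i
    induction i with
    | zero =>
      rw [pow_zero, one_mul]
      exact_mod_cast Set.ncard_le_card _
    | succ i ih =>
      calc ((U (T * j + l % 3 + 3 * (i + 1))).ncard : ℝ)
          ≤ (U (T * j + l % 3 + 3 * i + 1)).ncard := by exact_mod_cast hanti (by omega)
        _ ≤ q * (U (T * j + l % 3 + 3 * i)).ncard := step i
        _ ≤ q * (q ^ i * n) := by gcongr
        _ = q ^ (i + 1) * n := by ring
  have hlt : ((U (T * (j + 3))).ncard : ℝ) < 1 := by
    -- The last of the `T` turns starts at offset at most 2 + 3 (T - 1), just in time.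
    have h1 : T * j + l % 3 + 3 * (T - 1) + 1 ≤ T * (j + 3) := by
      rw [mul_add]
      omega
    have h2 : q * (q ^ (T - 1) * n) = q ^ T * n := by
      rw [← mul_assoc, ← pow_succ', Nat.sub_add_cancel hT0]
    have hqexp : q ≤ Real.exp (-(1 / (15 * k))) := by
      have := Real.add_one_le_exp (-(1 / (15 * (k : ℝ))))
      linarith
    have hqT : q ^ T ≤ Real.exp (-k) := by
      calc q ^ T ≤ Real.exp (-(1 / (15 * k))) ^ T := by gcongr
        _ = Real.exp (-k) := by
          rw [← Real.exp_nat_mul, hTk]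
          congr 1
          push_cast
          field_simp
    have hn2 : (n : ℝ) ≤ 2 ^ k := by exact_mod_cast Nat.le_pow_clog (by norm_num) n
    have h2e : (2 : ℝ) ^ k < Real.exp k := by
      rw [← Real.exp_one_pow]
      refine pow_lt_pow_left₀ ?_ (by norm_num) (by omega)
      have := Real.exp_one_gt_d9
      linarith
    calc ((U (T * (j + 3))).ncard : ℝ)
        ≤ (U (T * j + l % 3 + 3 * (T - 1) + 1)).ncard := by exact_mod_cast hanti h1
      _ ≤ q * (U (T * j + l % 3 + 3 * (T - 1))).ncard := step _
      _ ≤ q * (q ^ (T - 1) * n) := by gcongr; exact key _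
      _ = q ^ T * n := h2
      _ ≤ Real.exp (-k) * 2 ^ k := by gcongr
      _ < Real.exp (-k) * Real.exp k := by gcongr
      _ = 1 := by rw [← Real.exp_add]; simp
  have hempty : (U (T * (j + 3))).ncard = 0 := by
    have : (U (T * (j + 3))).ncard < 1 := by exact_mod_cast hlt
    omega
  rw [Set.ncard_eq_zero (Set.toFinite _)] at hempty
  intro v hv
  by_contra hn
  exact (hempty.subset ⟨hv, hn⟩ : v ∈ (∅ : Set V))

theorem IsLabelingWith.level_subset [Finite V] (hcard : 2 ≤ Nat.card V) (l : ℕ) :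
    level G s l ⊆ informed G s ℓ (stageLength (Nat.card V) * (3 * l)) := by
  induction l with
  | zero =>
    intro v hv
    obtain rfl : s = v := hG.dist_eq_zero_iff.1 hv
    rw [mul_zero, mul_zero, informed_zero]
    rfl
  | succ l ih => exact h.level_succ_subset hG hcard ih

/-- Three rounds per block, 15k² blocks per stage and 3 D stages make 135 D k² rounds. Rounding the
logarithm up at most doubles it when n ≥ 2, whence 540. For n = 1 the right-hand side is 0 and no
round is needed. -/
theorem IsLabelingWith.exists_broadcastsIn [Fintype V] :
    ∃ R : ℕ, (R : ℝ) ≤ 540 * G.diam * Real.logb 2 (Fintype.card V) ^ 2 ∧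
      ∀ (M : Type*) (m : M), (algorithm M).BroadcastsIn G s ℓ m R := by
  rcases Nat.lt_or_ge (Nat.card V) 2 with hcard | hcard
  · refine ⟨0, by simp; positivity, fun M m => ?_⟩
    have : Subsingleton V := Finite.card_le_one_iff_subsingleton.1 (by omega)
    exact broadcastsIn_of_informed (r := 0) G s ℓ (fun v => by
      rw [informed_zero]
      exact Subsingleton.elim v s) m
  · have : Nonempty V := ⟨s⟩
    set k := Nat.clog 2 (Nat.card V) with hk
    refine ⟨3 * (stageLength (Nat.card V) * (3 * G.diam)), ?_, fun M m => ?_⟩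
    · have hk1 : (k : ℝ) ≤ 2 * Real.logb 2 (Fintype.card V) := by
        have hn : (2 : ℝ) ≤ Fintype.card V := by
          rw [← Nat.card_eq_fintype_card]
          exact_mod_cast hcard
        have h1 : 1 ≤ Real.logb 2 (Fintype.card V) := by
          rw [Real.le_logb_iff_rpow_le (by norm_num) (by linarith)]
          simpa using hn
        have h2 : ((k - 1 : ℕ) : ℝ) ≤ Real.logb 2 (Fintype.card V) := by
          rw [Real.le_logb_iff_rpow_le (by norm_num) (by linarith), Real.rpow_natCast]
          have := Nat.pow_pred_clog_lt_self (b := 2) (by norm_num) (show 1 < Nat.card V by omega)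
          rw [← hk, Nat.card_eq_fintype_card] at this
          exact_mod_cast this.le
        have h3 : 1 ≤ k := Nat.clog_pos (by norm_num) (by omega)
        rw [Nat.cast_sub h3] at h2
        push_cast at h2
        linarith
      have : ((3 * (stageLength (Nat.card V) * (3 * G.diam)) : ℕ) : ℝ) =
          135 * G.diam * (k : ℝ) ^ 2 := by
        rw [stageLength]
        push_cast
        ring
      rw [this]
      calc 135 * G.diam * (k : ℝ) ^ 2
          ≤ 135 * G.diam * (2 * Real.logb 2 (Fintype.card V)) ^ 2 := by gcongr
        _ = 540 * G.diam * Real.logb 2 (Fintype.card V) ^ 2 := by ring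
    · refine broadcastsIn_of_informed G s ℓ (fun v => ?_) m
      have hd : G.dist s v ≤ G.diam :=
        SimpleGraph.dist_le_diam (SimpleGraph.connected_iff_ediam_ne_top.1 hG)
      exact informed_mono (by gcongr) (h.level_subset hG hcard (G.dist s v) rfl)

end

end LevelledExecutor

/-! ## Schedules

A schedule describes an execution without reference to labels.  It determines a labeling for which
it is the execution. -/

namespace LevelledExecutor

/-- `inf r` are the informed nodes at the beginning of block `r`, `act r` the nodes that transmit in
its Broadcast step, `fb r` the feedback nodes, and `sel r` the nodes chosen by the selections. -/
structure Schedule (V : Type*) where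
  inf : ℕ → Set V
  act : ℕ → Set V
  fb : ℕ → V → Option V
  sel : ℕ → Set V

namespace Schedule

variable {V : Type*} (S : Schedule V) (G : SimpleGraph V) (s : V)

/-- `u` is an uninformed node of the next level that receives the payload from `v` in the Broadcast
step of block `r`. -/
def Informs (r : ℕ) (v u : V) : Prop :=
  v ∈ S.act r ∧ u ∉ S.inf r ∧ G.dist s u = G.dist s v + 1 ∧ G.Adj v u ∧
    ∀ w ∈ S.act r, G.Adj w u → w = v

/-- The nodes of level `l` to which the selection of block `r` applies. -/
def selectable (l r : ℕ) : Set V := S.inf (stageStart (Nat.card V) r) ∩ S.act r ∩ level G s l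

/-- The schedule follows the labeling scheme. -/
structure IsValid : Prop where
  inf_zero : S.inf 0 = {s}
  act_zero : S.act 0 = {s}
  mem_inf_succ : ∀ r u, u ∈ S.inf (r + 1) ↔ u ∈ S.inf r ∨ (G.dist s u % 3 = (r + 1) % 3 ∧
    ((∃! w, G.Adj u w ∧ w ∈ S.act r) ∨ ∃! w, G.Adj u w ∧ w ∈ S.act r ∧ w ∈ S.sel r))
  act_subset : ∀ r, S.act r ⊆ S.inf r
  act_level : ∀ r, ∀ v ∈ S.act r, G.dist s v % 3 = r % 3
  act_minimal : ∀ r l, 1 ≤ r → l % 3 = r % 3 →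
    Minimal (DominatesFrontier G s (S.inf r) l) (S.act r ∩ level G s l)
  -- Blocks r and r + 3 are successive turns of the level. A node that was not informed in block r +
  -- 2, just before the second turn, must have used the first one, since the dominating set cannot
  -- be re-entered.
  act_old : ∀ r, ∀ v ∈ S.act (r + 3), v ∈ S.inf (r + 2) → v ∈ S.act r
  fb_informs : ∀ r v u, S.fb r v = some u → S.Informs G s r v u
  fb_exists : ∀ r v, (∃ u, S.Informs G s r v u) → ∃ u, S.fb r v = some u
  selection : ∀ r l, l % 3 = r % 3 → ∃ B', IsSelection G (S.selectable G s l r)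
    {w ∈ level G s (l + 1) \ S.inf r | ∃ u ∈ S.selectable G s l r, G.Adj u w}
    (S.sel r ∩ level G s l) B'

/-- The labels are those that the schedule determines. -/
structure Labels (ℓ : V → List Bool) : Prop where
  length_eq : ∀ v, (ℓ v).length = 5
  lev_eq : ∀ v, lev (ℓ v) = G.dist s v % 3
  source : ℓ s = [true, false, false, false, false]
  join_iff : ∀ v, joinBit (ℓ v) = true ↔ ∃ r, v ∈ S.act r
  stay_iff : ∀ u, stayBit (ℓ u) = true ↔ ∃ r v, S.fb r v = some u ∧ v ∈ S.act (r + 3)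
  go_iff : ∀ u, goBit (ℓ u) = true ↔ ∃ r v, S.fb r v = some u ∧ v ∈ S.sel r

variable {S G s}

namespace IsValid

variable (h : S.IsValid G s)

include h

theorem inf_subset_succ (r : ℕ) : S.inf r ⊆ S.inf (r + 1) := fun u hu =>
  (h.mem_inf_succ r u).2 (Or.inl hu)

theorem inf_mono : Monotone S.inf := monotone_nat_of_le_succ h.inf_subset_succ

theorem source_mem_inf (r : ℕ) : s ∈ S.inf r := h.inf_mono (Nat.zero_le r) (by rw [h.inf_zero]; rfl)

theorem exists_informs_iff {r : ℕ} {u : V} : (∃ v, S.Informs G s r v u) ↔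
    u ∉ S.inf r ∧ G.dist s u % 3 = (r + 1) % 3 ∧ ∃! w, G.Adj u w ∧ w ∈ S.act r := by
  constructor
  · rintro ⟨v, h1, h2, h3, h4, h5⟩
    refine ⟨h2, ?_, v, ⟨h4.symm, h1⟩, fun w hw => h5 w hw.2 hw.1.symm⟩
    have := h.act_level r v h1
    omega
  · rintro ⟨h1, h2, v, ⟨h3, h4⟩, h5⟩
    exact ⟨v, h4, h1, h3.symm.dist_eq_succ (h.act_level r v h4) h2, h3.symm,
      fun w hw hwu => h5 w ⟨hwu.symm, hw⟩⟩

theorem informs_mem_inf_succ {r : ℕ} {v u : V} (hu : S.Informs G s r v u) : u ∈ S.inf (r + 1) :=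
  (h.mem_inf_succ r u).2 (Or.inr ((h.exists_informs_iff.1 ⟨v, hu⟩).2.imp_right Or.inl))

theorem informs_unique {r r' : ℕ} {v v' u : V} (hu : S.Informs G s r v u)
    (hu' : S.Informs G s r' v' u) : r' = r ∧ v' = v := by
  have hr : r' = r := by
    by_contra hne
    rcases Nat.lt_or_gt_of_ne hne with hlt | hlt
    · exact hu.2.1 (h.inf_mono hlt (h.informs_mem_inf_succ hu'))
    · exact hu'.2.1 (h.inf_mono hlt (h.informs_mem_inf_succ hu))
  subst hr
  exact ⟨rfl, hu.2.2.2.2 v' hu'.1 hu'.2.2.2.1⟩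

theorem exists_informs {r : ℕ} (hr : 1 ≤ r) {v : V} (hv : v ∈ S.act r) :
    ∃ u, S.Informs G s r v u := by
  have hl := h.act_level r v hv
  obtain ⟨u, hu, hvu, huniq⟩ := exists_private_of_minimal (h.act_minimal r _ hr hl) ⟨hv, rfl⟩
  have h1 : G.dist s u = G.dist s v + 1 := hu.1
  refine ⟨u, hv, hu.2, h1, hvu, fun w hw hwu => huniq w ⟨hw, ?_⟩ hwu⟩
  have := hwu.dist_eq_succ (s := s) (r := r) (h.act_level r w hw) (by omega)
  simp only [level, Set.mem_ofPred_eq]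
  omega

/-- The extra neighbour `u` is needed only in block 0, where no private frontier node is guaranteed
but the source is the sole sender. -/
theorem exists_informs_of_adj {r : ℕ} {v u : V} (hv : v ∈ S.act r) (hvu : G.Adj v u)
    (hu : u ∉ S.inf r) (hd : G.dist s u % 3 = (r + 1) % 3) : ∃ u, S.Informs G s r v u := by
  rcases Nat.eq_zero_or_pos r with hr | hr
  · subst hr
    refine ⟨u, hv, hu, hvu.dist_eq_succ (h.act_level 0 v hv) hd, hvu, fun w hw _ => ?_⟩
    rw [h.act_zero] at hv hw
    rw [hv, hw]
  · exact h.exists_informs hr hv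

/-- A node that ever transmits does so from its first opportunity on. -/
theorem mem_act_succ_of_mem_act {r r' : ℕ} {v : V} (hv : v ∈ S.inf (r + 1)) (hv' : v ∉ S.inf r)
    (hact : v ∈ S.act r') : v ∈ S.act (r + 1) := by
  have hlt : r < r' := by
    by_contra hn
    exact hv' (h.inf_mono (not_lt.1 hn) (h.act_subset r' hact))
  have hd : G.dist s v % 3 = (r + 1) % 3 :=
    (((h.mem_inf_succ r v).1 hv).resolve_left hv').1
  have hd' := h.act_level r' v hact
  obtain ⟨i, rfl⟩ : ∃ i, r' = r + 1 + 3 * i := ⟨(r' - (r + 1)) / 3, by omega⟩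
  clear hlt hd'
  induction i with
  | zero => exact hact
  | succ i ih =>
    exact ih (h.act_old (r + 1 + 3 * i) v hact (h.inf_mono (by omega) hv))

variable {ℓ : V → List Bool} (hℓ : S.Labels G s ℓ)

include hℓ

/-- The labels say that some sender in some block gives the order; as a node is informed by a
Broadcast step only once, sender and block are those at hand. -/
theorem stay_iff {r : ℕ} {v u : V} (hu : S.fb r v = some u) :
    stayBit (ℓ u) = true ↔ v ∈ S.act (r + 3) := by
  rw [hℓ.stay_iff]
  constructor
  · rintro ⟨r', v', h1, h2⟩
    obtain ⟨rfl, rfl⟩ := h.informs_unique (h.fb_informs _ _ _ hu) (h.fb_informs _ _ _ h1)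
    exact h2
  · exact fun h' => ⟨r, v, hu, h'⟩

theorem go_iff {r : ℕ} {v u : V} (hu : S.fb r v = some u) :
    goBit (ℓ u) = true ↔ v ∈ S.sel r := by
  rw [hℓ.go_iff]
  constructor
  · rintro ⟨r', v', h1, h2⟩
    obtain ⟨rfl, rfl⟩ := h.informs_unique (h.fb_informs _ _ _ hu) (h.fb_informs _ _ _ h1)
    exact h2
  · exact fun h' => ⟨r, v, hu, h'⟩

/-- the dominating set at the beginning of block `r`: the nodes that transmit at the next
opportunity -/
theorem informed_eq_and_dom_eq (r : ℕ) : informed G s ℓ r = S.inf r ∧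
    dom G s ℓ r = {v ∈ S.inf r | v ∈ S.act (r + (G.dist s v + 2 * r) % 3)} := by
  induction r with
  | zero =>
    refine ⟨by rw [informed_zero, h.inf_zero], ?_⟩
    ext v
    rw [dom_zero, h.inf_zero]
    constructor
    · rintro ⟨rfl, -⟩
      refine ⟨rfl, ?_⟩
      rw [SimpleGraph.dist_self, h.act_zero]
      rfl
    · rintro ⟨hv, -⟩
      obtain rfl : v = s := hv
      exact ⟨rfl, by rw [hℓ.source]; rfl⟩
  | succ r ih =>
    obtain ⟨hI, hD⟩ := ih
    have hDI : dom G s ℓ r ⊆ S.inf r := fun v hv => by rw [hD] at hv; exact hv.1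
    -- The offset `(dist + 2 * r) % 3` is the waiting time until the next turn of the level; it is 0
    -- exactly for the levels of block r.
    have hsend : senders ℓ r (dom G s ℓ r) = S.act r := by
      ext v
      constructor
      · rintro ⟨hv, hl⟩
        rw [hD] at hv
        rw [hℓ.lev_eq] at hl
        have : (G.dist s v + 2 * r) % 3 = 0 := by omega
        simpa [this] using hv.2
      · intro hv
        have hl := h.act_level r v hv
        have : (G.dist s v + 2 * r) % 3 = 0 := by omega
        refine ⟨?_, by rw [hℓ.lev_eq, hl]⟩
        rw [hD]
        exact ⟨h.act_subset r hv, by simpa [this] using hv⟩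
    have hB : ∀ u, u ∈ broadcastInformed G ℓ r (S.inf r) (dom G s ℓ r) ↔
        ∃ v, S.Informs G s r v u := by
      intro u
      rw [h.exists_informs_iff, ← hℓ.lev_eq, ← hsend]
      rfl
    have hF : ∀ v u, HearsFeedback G ℓ r (S.inf r) (dom G s ℓ r) v u ↔
        v ∈ S.act r ∧ S.fb r v = some u ∧ (stayBit (ℓ u) = true ∨ goBit (ℓ u) = true) := by
      intro v u
      rw [← hsend]
      refine hearsFeedback_iff (fun v hv u hu => ?_) (fun v hv u hu hvu => ?_) v u
      · have := h.fb_informs r v u hu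
        exact ⟨this.2.2.2.1, (hB u).2 ⟨v, this⟩⟩
      · obtain ⟨v', hv'⟩ := (hB u).1 hu.1
        obtain ⟨r'', v'', hfb⟩ : ∃ r'' v'', S.fb r'' v'' = some u := by
          rcases hu.2 with h' | h'
          · obtain ⟨r'', v'', hfb, -⟩ := (hℓ.stay_iff u).1 h'
            exact ⟨r'', v'', hfb⟩
          · obtain ⟨r'', v'', hfb, -⟩ := (hℓ.go_iff u).1 h'
            exact ⟨r'', v'', hfb⟩
        obtain ⟨rfl, rfl⟩ := h.informs_unique hv' (h.fb_informs _ _ _ hfb)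
        rw [hsend] at hv
        rwa [hv'.2.2.2.2 v hv hvu]
    -- A selected sender without an uninformed neighbour may lack a feedback node and stay silent.
    -- The equivalence is therefore claimed only for neighbours `w` of uninformed nodes, which is
    -- all that matters for receiving.
    have hgo : ∀ u w, G.Adj u w → u ∉ S.inf r → G.dist s u % 3 = (r + 1) % 3 →
        (w ∈ goSenders G ℓ r (S.inf r) (dom G s ℓ r) ↔ w ∈ S.act r ∧ w ∈ S.sel r) := by
      intro u w huw hu hd
      constructor
      · rintro ⟨u', hu', hg⟩
        rw [hF] at hu'
        exact ⟨hu'.1, (h.go_iff hℓ hu'.2.1).1 hg⟩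
      · rintro ⟨h1, h2⟩
        obtain ⟨u', hu'⟩ := h.fb_exists r w (h.exists_informs_of_adj h1 huw.symm hu hd)
        have hg := (h.go_iff hℓ hu').2 h2
        exact ⟨u', (hF w u').2 ⟨h1, hu', Or.inr hg⟩, hg⟩
    have hinf : nextInformed G ℓ r (S.inf r) (dom G s ℓ r) = S.inf (r + 1) := by
      ext u
      rw [h.mem_inf_succ]
      by_cases hu : u ∈ S.inf r
      · exact ⟨fun _ => Or.inl hu, fun _ => Or.inl (Or.inl hu)⟩
      by_cases hd : G.dist s u % 3 = (r + 1) % 3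
      · have hex : (∃! w, G.Adj u w ∧ w ∈ goSenders G ℓ r (S.inf r) (dom G s ℓ r)) ↔
            ∃! w, G.Adj u w ∧ w ∈ S.act r ∧ w ∈ S.sel r :=
          existsUnique_congr fun w => and_congr_right fun huw => hgo u w huw hu hd
        have hb := hB u
        rw [h.exists_informs_iff] at hb
        simp only [nextInformed, Set.mem_union, hu, hd, false_or, true_and, goInformed,
          Set.mem_ofPred_eq, hℓ.lev_eq, hex, hb, not_false_eq_true]
        tauto
      · simp only [nextInformed, broadcastInformed, goInformed, Set.mem_union, Set.mem_ofPred_eq,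
          hu, hd, hℓ.lev_eq]
        tauto
    rw [informed_succ, dom_succ, hI]
    refine ⟨hinf, ?_⟩
    ext v
    by_cases hv : v ∈ S.inf r
    · have hv1 := h.inf_subset_succ r hv
      have hnew₁ : v ∉ broadcastInformed G ℓ r (S.inf r) (dom G s ℓ r) := fun hn => hn.1 hv
      have hnew₂ : v ∉ goInformed G ℓ r (S.inf r) (dom G s ℓ r) := fun hn => hn.1 (Or.inl hv)
      by_cases hd : G.dist s v % 3 = r % 3
      · have hmod : r + 1 + (G.dist s v + 2 * (r + 1)) % 3 = r + 3 := by omega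
        simp only [nextDom, Set.mem_union, Set.mem_ofPred_eq, hℓ.lev_eq, hd, ne_eq,
          not_true_eq_false, and_false, false_or, hnew₁, hnew₂, false_and, or_false, hF,
          hv1, true_and, hmod]
        constructor
        · rintro ⟨u, ⟨-, hu, -⟩, hst⟩
          exact (h.stay_iff hℓ hu).1 hst
        · intro hact
          -- A node that transmits in block r + 3 informs some `w` there. This `w` is uninformed in
          -- block r too, so `v` already has a feedback node in block r, which can tell it to stay.
          have hact' := h.act_old r v hact (h.inf_mono (by omega) hv)
          obtain ⟨w, hw⟩ := h.exists_informs (by omega) hact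
          obtain ⟨u, hu⟩ := h.fb_exists r v (h.exists_informs_of_adj hact' hw.2.2.2.1
            (fun hn => hw.2.1 (h.inf_mono (by omega) hn)) (by have := hw.2.2.1; omega))
          have hst := (h.stay_iff hℓ hu).2 hact
          exact ⟨u, ⟨hact', hu, Or.inl hst⟩, hst⟩
      · have hmod : r + 1 + (G.dist s v + 2 * (r + 1)) % 3 = r + (G.dist s v + 2 * r) % 3 := by
          omega
        have hf : ∀ u, ¬HearsFeedback G ℓ r (S.inf r) (dom G s ℓ r) v u := fun u hu =>
          hd (h.act_level r v ((hF v u).1 hu).1)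
        simp only [nextDom, Set.mem_union, Set.mem_ofPred_eq, hℓ.lev_eq, hd, ne_eq,
          not_false_eq_true, and_true, hnew₁, hnew₂, false_and, or_false, hf,
          exists_false, hv1, true_and, hmod]
        rw [hD]
        simp [hv]
    · have hvD : v ∉ dom G s ℓ r := fun hn => hv (hDI hn)
      have hf : ∀ u, ¬HearsFeedback G ℓ r (S.inf r) (dom G s ℓ r) v u := fun u hu =>
        hv (h.act_subset r ((hF v u).1 hu).1)
      have hmem : v ∈ broadcastInformed G ℓ r (S.inf r) (dom G s ℓ r) ∪
          goInformed G ℓ r (S.inf r) (dom G s ℓ r) ↔ v ∈ S.inf (r + 1) := by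
        rw [← hinf]
        simp only [nextInformed, Set.mem_union, hv, false_or]
      have hdom : v ∈ nextDom G ℓ r (S.inf r) (dom G s ℓ r) ↔
          v ∈ S.inf (r + 1) ∧ joinBit (ℓ v) = true := by
        rw [← hmem]
        simp only [nextDom, Set.mem_union, Set.mem_ofPred_eq, hvD, hf, false_and, exists_false,
          false_or]
      rw [hdom]
      -- A newly informed node enters by its Join bit, which records whether it ever transmits; if
      -- it does, it starts in the next block.
      refine and_congr_right fun hv1 => ?_
      have hd : G.dist s v % 3 = (r + 1) % 3 := (((h.mem_inf_succ r v).1 hv1).resolve_left hv).1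
      have hmod : r + 1 + (G.dist s v + 2 * (r + 1)) % 3 = r + 1 := by omega
      rw [hmod, hℓ.join_iff]
      exact ⟨fun ⟨r', hr'⟩ => h.mem_act_succ_of_mem_act hv1 hv hr', fun h' => ⟨_, h'⟩⟩

theorem activeDom_eq (r : ℕ) : activeDom G s ℓ r = S.act r := by
  ext v
  constructor
  · rintro ⟨hv, hl⟩
    rw [(h.informed_eq_and_dom_eq hℓ r).2] at hv
    have : (G.dist s v + 2 * r) % 3 = 0 := by omega
    simpa [this] using hv.2
  · intro hv
    have hl := h.act_level r v hv
    have : (G.dist s v + 2 * r) % 3 = 0 := by omega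
    refine ⟨?_, hl⟩
    rw [(h.informed_eq_and_dom_eq hℓ r).2]
    exact ⟨h.act_subset r hv, by simpa [this] using hv⟩

theorem dom_inter_level {r l : ℕ} (hl : l % 3 = r % 3) :
    dom G s ℓ r ∩ level G s l = S.act r ∩ level G s l := by
  rw [← h.activeDom_eq hℓ]
  ext v
  refine ⟨fun hv => ⟨⟨hv.1, ?_⟩, hv.2⟩, fun hv => ⟨hv.1.1, hv.2⟩⟩
  have : G.dist s v = l := hv.2
  rw [this, hl]

theorem informedBy_iff {r : ℕ} {v u : V} : InformedBy G s ℓ r v u ↔ S.Informs G s r v u := by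
  rw [InformedBy, Informs, h.activeDom_eq hℓ, (h.informed_eq_and_dom_eq hℓ r).1]

theorem isLabelingWith : IsLabelingWith G s ℓ S.fb where
  length_eq := hℓ.length_eq
  lev_eq := hℓ.lev_eq
  source := hℓ.source
  minimal r l hr hl := by
    rw [h.dom_inter_level hℓ hl, (h.informed_eq_and_dom_eq hℓ r).1]
    exact h.act_minimal r l hr hl
  fb_informedBy r v u hu := (h.informedBy_iff hℓ).2 (h.fb_informs r v u hu)
  fb_exists r v hu := h.fb_exists r v (hu.imp fun _ => (h.informedBy_iff hℓ).1)
  non_fb u hu := by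
    constructor
    · rw [Bool.eq_false_iff]
      intro hn
      obtain ⟨r, v, h1, -⟩ := (hℓ.stay_iff u).1 hn
      exact hu r v h1
    · rw [Bool.eq_false_iff]
      intro hn
      obtain ⟨r, v, h1, -⟩ := (hℓ.go_iff u).1 hn
      exact hu r v h1
  go_selection r l hl := by
    have hdom : stageDom G s ℓ l r = S.selectable G s l r := by
      rw [stageDom, dom_inter_dom (show stageStart _ r ≤ r from Nat.mul_div_le _ _),
        Set.inter_assoc, h.dom_inter_level hℓ hl,
        (h.informed_eq_and_dom_eq hℓ _).1, selectable, Set.inter_assoc]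
    obtain ⟨B', hB'⟩ := h.selection r l hl
    refine ⟨S.sel r ∩ level G s l, B', ?_, fun v hv u hu => ?_⟩
    · rw [stageFrontier, hdom, (h.informed_eq_and_dom_eq hℓ r).1]
      exact hB'
    · rw [h.go_iff hℓ hu]
      exact ⟨fun h' => ⟨h', hv⟩, fun h' => h'.1⟩

end IsValid

end Schedule

end LevelledExecutor

/-! ## Bipartite selection by local search -/

namespace LevelledExecutor

section LocalSearch

open Classical

variable {V : Type*} [Fintype V] (G : SimpleGraph V) (P Q : V → Prop) (x : V → ℕ)

/-- the number of neighbours of `b` that `x` selects -/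
noncomputable def cover (b : V) : ℕ := ∑ a, if x a ≠ 0 ∧ G.Adj a b then 1 else 0

/-- the number of neighbours of `b` that satisfy `P` -/
noncomputable def degreeIn (b : V) : ℕ := ∑ a, if P a ∧ G.Adj a b then 1 else 0

/-- Selecting the node `a` instead of not selecting it, or vice versa, increases the sum of
`2 c - c ^ 2` over all nodes of `Q`, where `c` is the number of selected neighbours. -/
def Improving (a : V) : Prop :=
  P a ∧ ((x a = 0 ∧ (∑ b, if Q b ∧ G.Adj a b then 2 * cover G x b else 0) <
      ∑ b, if Q b ∧ G.Adj a b then 1 else 0) ∨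
    (x a ≠ 0 ∧ (∑ b, if Q b ∧ G.Adj a b then 3 else 0) <
      ∑ b, if Q b ∧ G.Adj a b then 2 * cover G x b else 0))

/-- Flip the selection of the first node for which this is an improvement. -/
noncomputable def improve [LinearOrder V] (a : V) : ℕ :=
  if Improving G P Q x a ∧ ∀ a', a' < a → ¬Improving G P Q x a' then 1 - x a else x a

/-- the objective of the local search -/
noncomputable def potential : ℤ :=
  ∑ b, if Q b then 2 * (cover G x b : ℤ) - (cover G x b : ℤ) ^ 2 else 0

/-- the number of nodes of `Q` with exactly one selected neighbour -/
noncomputable def score : ℕ := ∑ b, if Q b ∧ cover G x b = 1 then 1 else 0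

variable {G P Q x}

theorem cover_update [DecidableEq V] (hx : ∀ a, x a ≤ 1) (a b : V) :
    (cover G (Function.update x a (1 - x a)) b : ℤ) =
      cover G x b + if G.Adj a b then 1 - 2 * (x a : ℤ) else 0 := by
  unfold cover
  rw [← Finset.add_sum_erase _ _ (Finset.mem_univ a),
    ← Finset.add_sum_erase _ (fun a => if x a ≠ 0 ∧ G.Adj a b then 1 else 0) (Finset.mem_univ a)]
  rw [Finset.sum_congr rfl (g := fun a => if x a ≠ 0 ∧ G.Adj a b then 1 else 0) fun a' ha' => by
    rw [Function.update_of_ne (Finset.ne_of_mem_erase ha')]]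
  have := hx a
  push_cast
  by_cases hab : G.Adj a b
  · interval_cases h : x a
    all_goals simp [hab]
    all_goals ring
  · simp [hab]

/-- Adding a neighbour changes 2c - c² by 1 - 2c, and removing one changes it by 2c - 3. The two
clauses of `Improving` say that these changes have a positive sum, which is an integer, hence at
least 1. -/
theorem potential_update [DecidableEq V] (hx : ∀ a, x a ≤ 1) {a : V} (ha : Improving G P Q x a) :
    potential G Q x + 1 ≤ potential G Q (Function.update x a (1 - x a)) := by
  have key : potential G Q (Function.update x a (1 - x a)) = potential G Q x +
      ∑ b, if Q b ∧ G.Adj a b then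
        (1 - 2 * (x a : ℤ)) * (2 - 2 * (cover G x b : ℤ) - (1 - 2 * (x a : ℤ))) else 0 := by
    unfold potential
    rw [← Finset.sum_add_distrib]
    refine Finset.sum_congr rfl fun b _ => ?_
    rw [cover_update hx]
    by_cases hQ : Q b <;> by_cases hab : G.Adj a b <;> simp [hQ, hab]
    ring
  rw [key]
  have hxa := hx a
  refine add_le_add le_rfl (Int.add_one_le_of_lt (a := 0) ?_)
  rcases ha.2 with ⟨h0, h⟩ | ⟨h1, h⟩
  · have h' : (∑ b, if Q b ∧ G.Adj a b then 2 * (cover G x b : ℤ) else 0) <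
        ∑ b, if Q b ∧ G.Adj a b then 1 else 0 := by exact_mod_cast h
    rw [← sub_pos, ← Finset.sum_sub_distrib] at h'
    refine h'.trans_eq (Finset.sum_congr rfl fun b _ => ?_)
    rw [h0]
    split_ifs <;> simp
    ring
  · have h1 : x a = 1 := by omega
    have h' : (∑ b, if Q b ∧ G.Adj a b then (3 : ℤ) else 0) <
        ∑ b, if Q b ∧ G.Adj a b then 2 * (cover G x b : ℤ) else 0 := by exact_mod_cast h
    rw [← sub_pos, ← Finset.sum_sub_distrib] at h'
    refine h'.trans_eq (Finset.sum_congr rfl fun b _ => ?_)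
    rw [h1]
    split_ifs <;> simp
    ring

/-- Each term is 1 - (c - 1)², which equals 1 for c = 1 and is at most 0 for every other natural
number. -/
theorem potential_le_score : potential G Q x ≤ score G Q x := by
  unfold potential score
  push_cast
  refine Finset.sum_le_sum fun b _ => ?_
  by_cases hQ : Q b
  · by_cases hc : cover G x b = 1
    · simp [hQ, hc]
    · have : (cover G x b : ℤ) ≤ 0 ∨ 2 ≤ (cover G x b : ℤ) := by omega
      simp only [hQ, hc, if_true, and_false, if_false]
      rcases this with h | h <;> nlinarith
  · simp [hQ]

theorem score_le_card : score G Q x ≤ Fintype.card V := by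
  unfold score
  refine (Finset.sum_le_card_nsmul _ _ 1 fun b _ => by split_ifs <;> simp).trans ?_
  simp

/-! ### Convergence of the local search -/

section Improve

variable [LinearOrder V]

theorem improve_eq_self (h : ∀ a, ¬Improving G P Q x a) : improve G P Q x = x := by
  ext a
  simp [improve, h]

theorem exists_improve_eq_update (h : ∃ a, Improving G P Q x a) :
    ∃ a, Improving G P Q x a ∧ improve G P Q x = Function.update x a (1 - x a) := by
  obtain ⟨a, ha, hmin⟩ := Finset.exists_min_image (Finset.univ.filter (Improving G P Q x)) id
    (by simpa [Finset.filter_nonempty_iff] using h)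
  have ha' : Improving G P Q x a := (Finset.mem_filter.1 ha).2
  have hlt : ∀ a', a' < a → ¬Improving G P Q x a' := fun a' hlt hi =>
    absurd (hmin a' (Finset.mem_filter.2 ⟨Finset.mem_univ _, hi⟩)) (not_le.2 hlt)
  refine ⟨a, ha', funext fun b => ?_⟩
  by_cases hb : b = a
  · subst hb
    rw [improve, if_pos ⟨ha', hlt⟩, Function.update_self]
  · rw [improve, if_neg, Function.update_of_ne hb]
    rintro ⟨h1, h2⟩
    rcases lt_or_gt_of_ne hb with h' | h'
    · exact hlt b h' h1
    · exact h2 a h' ha'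

theorem improve_le_one (hx : ∀ a, x a ≤ 1) (a : V) : improve G P Q x a ≤ 1 := by
  have := hx a
  unfold improve
  split_ifs <;> omega

theorem of_improve_ne_zero (hx : ∀ a, x a ≠ 0 → P a) {a : V} (ha : improve G P Q x a ≠ 0) :
    P a := by
  unfold improve at ha
  split_ifs at ha with h
  · exact h.1.1
  · exact hx a ha

/-- Progress of the local search: there is a guaranteed objective value, or a local optimum has been
reached. -/
theorem improve_progress (hx : ∀ a, x a ≤ 1) {m : ℕ}
    (h : (m : ℤ) ≤ potential G Q x ∨ ∀ a, ¬Improving G P Q x a) :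
    ((m + 1 : ℕ) : ℤ) ≤ potential G Q (improve G P Q x) ∨
      ∀ a, ¬Improving G P Q (improve G P Q x) a := by
  by_cases hi : ∃ a, Improving G P Q x a
  · obtain ⟨a, ha, heq⟩ := exists_improve_eq_update hi
    left
    have := potential_update hx ha
    rw [← heq] at this
    have := h.resolve_right fun hn => hn a ha
    push_cast
    omega
  · push Not at hi
    right
    rwa [improve_eq_self hi]

/-- The potential never exceeds the number of nodes, so nothing can be improved once it has reached
this value. -/
theorem not_improving_of_card_le_potential (hx : ∀ a, x a ≤ 1)
    (h : (Fintype.card V : ℤ) ≤ potential G Q x ∨ ∀ a, ¬Improving G P Q x a) (a : V) :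
    ¬Improving G P Q x a := by
  rcases h with h | h
  · intro ha
    have h1 := potential_update hx ha
    have h2 := potential_le_score (G := G) (Q := Q) (x := Function.update x a (1 - x a))
    have h3 := score_le_card (G := G) (Q := Q) (x := Function.update x a (1 - x a))
    omega
  · exact h a

end Improve

/-- In a local optimum a constant fraction of the nodes of `Q` has exactly one selected neighbour,
if the degrees of these nodes differ at most by a factor of two. -/
theorem mul_card_le_mul_score (hxP : ∀ a, x a ≠ 0 → P a)
    (hopt : ∀ a, ¬Improving G P Q x a) {d : ℕ} (hd : 1 ≤ d)
    (hQ : ∀ b, Q b → d ≤ degreeIn G P b ∧ degreeIn G P b < 2 * d) :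
    d * (Finset.univ.filter Q).card ≤ (4 * d - 3) * (2 * score G Q x) := by
  set c : V → ℤ := fun b => cover G x b with hc
  set u : V → ℤ := fun b => ∑ a, if P a ∧ x a = 0 ∧ G.Adj a b then 1 else 0 with hu
  have hu0 : ∀ b, 0 ≤ u b := fun b => Finset.sum_nonneg fun a _ => by split_ifs <;> simp
  have hc0 : ∀ b, 0 ≤ c b := fun b => Int.natCast_nonneg _
  have hdeg : ∀ b, (degreeIn G P b : ℤ) = u b + c b := by
    intro b
    simp only [degreeIn, hu, hc, cover]
    push_cast
    rw [← Finset.sum_add_distrib]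
    refine Finset.sum_congr rfl fun a _ => ?_
    by_cases h0 : x a = 0
    · simp [h0]
    · simp [h0, hxP a h0]
  set B := Finset.univ.filter Q with hB
  -- Sum over all unselected `a` in P of the condition that adding `a` is no improvement; `u b`
  -- counts the unselected neighbours of `b` in P.
  have h1 : ∑ b ∈ B, u b ≤ ∑ b ∈ B, 2 * (u b * c b) := by
    have : ∀ a, (∑ b ∈ B, if P a ∧ x a = 0 ∧ G.Adj a b then (1 : ℤ) else 0) ≤
        ∑ b ∈ B, if P a ∧ x a = 0 ∧ G.Adj a b then 2 * c b else 0 := by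
      intro a
      by_cases ha : P a ∧ x a = 0
      · have := hopt a
        simp only [Improving, ha.1, ha.2, true_and, ne_eq, not_true_eq_false, false_and, or_false,
          not_lt] at this
        rw [hB, Finset.sum_filter, Finset.sum_filter]
        simp only [ha.1, ha.2, true_and, ← ite_and]
        simp only [hc]
        exact_mod_cast this
      · simp only [← and_assoc, ha, false_and, if_false, le_refl]
    have := Finset.sum_le_sum fun a (_ : a ∈ Finset.univ) => this a
    rw [Finset.sum_comm, Finset.sum_comm (s := Finset.univ) (t := B)] at this
    refine this.trans_eq (Finset.sum_congr rfl fun b _ => ?_)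
    simp only [hu, Finset.sum_mul, Finset.mul_sum]
    refine Finset.sum_congr rfl fun a _ => ?_
    split_ifs <;> simp
  -- The same for removals: sum over all selected `a`.
  have h2 : ∑ b ∈ B, 2 * (c b * c b) ≤ ∑ b ∈ B, 3 * c b := by
    have : ∀ a, (∑ b ∈ B, if x a ≠ 0 ∧ G.Adj a b then 2 * c b else 0) ≤
        ∑ b ∈ B, if x a ≠ 0 ∧ G.Adj a b then 3 else 0 := by
      intro a
      by_cases ha : x a = 0
      · simp [ha]
      · have := hopt a
        simp only [Improving, hxP a ha, ha, true_and, ne_eq, not_false_eq_true, false_and, false_or,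
          not_lt] at this
        rw [hB, Finset.sum_filter, Finset.sum_filter]
        simp only [ha, ne_eq, not_false_eq_true, true_and, ← ite_and]
        simp only [hc]
        exact_mod_cast this
    have := Finset.sum_le_sum fun a (_ : a ∈ Finset.univ) => this a
    rw [Finset.sum_comm, Finset.sum_comm (s := Finset.univ) (t := B)] at this
    have hcb : ∀ b, c b = ∑ a, if x a ≠ 0 ∧ G.Adj a b then 1 else 0 := fun b => by
      simp only [hc, cover]
      push_cast
      rfl
    calc ∑ b ∈ B, 2 * (c b * c b)
        = ∑ b ∈ B, ∑ a, if x a ≠ 0 ∧ G.Adj a b then 2 * c b else 0 := by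
          refine Finset.sum_congr rfl fun b _ => ?_
          conv_lhs => rw [← mul_assoc, hcb b, ← hcb b, mul_comm]
          conv_lhs => arg 1; rw [hcb b]
          rw [Finset.sum_mul]
          refine Finset.sum_congr rfl fun a _ => ?_
          split_ifs <;> simp
      _ ≤ _ := this
      _ = ∑ b ∈ B, 3 * c b := by
          refine Finset.sum_congr rfl fun b _ => ?_
          rw [hcb b, Finset.mul_sum]
          refine Finset.sum_congr rfl fun a _ => ?_
          split_ifs <;> simp
  -- By `h2` the sum of c² is at most 3/2 of the sum of c, so the potential is at least half the sum
  -- of c.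
  have h3 : ∑ b ∈ B, c b ≤ 2 * score G Q x := by
    have hp : ∑ b ∈ B, (2 * c b - c b * c b) ≤ score G Q x := by
      have := potential_le_score (G := G) (Q := Q) (x := x)
      unfold potential at this
      rw [← Finset.sum_filter] at this
      simpa only [hc, sq] using this
    rw [Finset.sum_sub_distrib] at hp
    rw [← Finset.mul_sum] at hp h2
    rw [← Finset.mul_sum] at h2
    linarith
  -- By `h1` it suffices to show d + 2uc - u ≤ (4d - 3) c for each node. If c = 0, this is u ≥ d.
  -- Otherwise u ≤ 2d - 2 bounds 2uc by (4d - 4) c, and d - u ≤ c.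
  have h4 : (d : ℤ) * B.card ≤ (4 * d - 3) * ∑ b ∈ B, c b := by
    have hle : ∑ b ∈ B, ((d : ℤ) + 2 * (u b * c b) - u b) ≤ ∑ b ∈ B, (4 * (d : ℤ) - 3) * c b := by
      refine Finset.sum_le_sum fun b hb => ?_
      have hQb := hQ b (Finset.mem_filter.1 hb).2
      have e1 : (d : ℤ) ≤ u b + c b := by rw [← hdeg]; exact_mod_cast hQb.1
      have e2 : u b + c b + 1 ≤ 2 * (d : ℤ) := by rw [← hdeg]; exact_mod_cast hQb.2
      have := hu0 b
      rcases (hc0 b).eq_or_lt with h | h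
      · rw [← h] at e1 ⊢
        linarith
      · nlinarith [mul_le_mul_of_nonneg_left (show u b ≤ 2 * d - 2 by omega) (hc0 b)]
    rw [Finset.sum_sub_distrib, Finset.sum_add_distrib, Finset.sum_const, nsmul_eq_mul,
      ← Finset.mul_sum (f := c)] at hle
    linarith
  have hd' : (0 : ℤ) ≤ 4 * d - 3 := by omega
  have h5 := h4.trans (mul_le_mul_of_nonneg_left h3 hd')
  zify [show 3 ≤ 4 * d by omega]
  exact h5

theorem degreeIn_le_card (b : V) : degreeIn G P b ≤ (Finset.univ.filter P).card := by
  rw [degreeIn, ← Finset.card_filter]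
  exact Finset.card_le_card (Finset.monotone_filter_right _ fun _ _ h => h.1)

/-- The nodes of positive degree are covered by logarithmically many sets of nodes of similar
degree. -/
theorem card_le_mul_of_buckets {F : V → Prop} {best : ℕ}
    (h : ∀ d, 1 ≤ d → d ≤ Fintype.card V →
      d * (Finset.univ.filter fun b => F b ∧ d ≤ degreeIn G P b ∧ degreeIn G P b < 2 * d).card ≤
        (4 * d - 3) * (2 * best)) :
    ((Finset.univ.filter fun b => F b ∧ 0 < degreeIn G P b).card : ℝ) ≤
      15 * max 1 (Real.logb 2 (Finset.univ.filter P).card) * best := by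
  set p := (Finset.univ.filter P).card with hp
  have hpV : p ≤ Fintype.card V := Finset.card_le_univ _
  rcases Nat.eq_zero_or_pos p with hp0 | hp0
  · have : (Finset.univ.filter fun b => F b ∧ 0 < degreeIn G P b) = ∅ := by
      refine Finset.filter_eq_empty_iff.2 fun b _ hb => ?_
      have := degreeIn_le_card (G := G) (P := P) b
      omega
    rw [this, Finset.card_empty, Nat.cast_zero]
    positivity
  set Q : ℕ → Finset V := fun i => Finset.univ.filter fun b =>
    F b ∧ 2 ^ i ≤ degreeIn G P b ∧ degreeIn G P b < 2 * 2 ^ i with hQ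
  have hpow : ∀ i ≤ Nat.log 2 p, 2 ^ i ≤ p := fun i hi =>
    (Nat.pow_le_pow_right two_pos hi).trans (Nat.pow_log_le_self 2 hp0.ne')
  -- For d = 1 the factor 4d - 3 is 1, so the first class loses only a factor 2 instead of 8.
  have h0 : (Q 0).card ≤ 2 * best := by
    have := h 1 le_rfl (by omega)
    simpa [hQ] using this
  have h8 : ∀ i ≤ Nat.log 2 p, (Q i).card ≤ 8 * best := by
    intro i hi
    have h1 : 1 ≤ 2 ^ i := Nat.one_le_two_pow
    have h2 := h (2 ^ i) h1 ((hpow i hi).trans hpV)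
    refine Nat.le_of_mul_le_mul_left (h2.trans ?_) h1
    calc (4 * 2 ^ i - 3) * (2 * best) ≤ (4 * 2 ^ i) * (2 * best) :=
          Nat.mul_le_mul_right _ (Nat.sub_le _ _)
      _ = 2 ^ i * (8 * best) := by ring
  have hsub : (Finset.univ.filter fun b => F b ∧ 0 < degreeIn G P b) ⊆
      (Finset.range (Nat.log 2 p + 1)).biUnion Q := by
    intro b hb
    obtain ⟨hF, hb⟩ := (Finset.mem_filter.1 hb).2
    refine Finset.mem_biUnion.2 ⟨Nat.log 2 (degreeIn G P b), ?_, ?_⟩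
    · exact Finset.mem_range.2 (Nat.lt_succ_of_le (Nat.log_mono_right (degreeIn_le_card b)))
    · refine Finset.mem_filter.2 ⟨Finset.mem_univ _, hF, Nat.pow_log_le_self 2 hb.ne', ?_⟩
      have := Nat.lt_pow_succ_log_self one_lt_two (degreeIn G P b)
      rwa [pow_succ, mul_comm] at this
  have hcard : (Finset.univ.filter fun b => F b ∧ 0 < degreeIn G P b).card ≤
      (2 + 8 * Nat.log 2 p) * best := by
    refine (Finset.card_le_card hsub).trans (Finset.card_biUnion_le.trans ?_)
    rw [Finset.sum_range_succ']
    have : ∑ i ∈ Finset.range (Nat.log 2 p), (Q (i + 1)).card ≤ Nat.log 2 p * (8 * best) := by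
      refine (Finset.sum_le_card_nsmul _ _ (8 * best) fun i hi => h8 _ ?_).trans (by simp)
      have := Finset.mem_range.1 hi
      omega
    nlinarith
  -- The constant is generous: 10 would do.
  have hlog : (2 + 8 * Nat.log 2 p : ℝ) ≤ 15 * max 1 (Real.logb 2 p) := by
    have h1 := Real.natLog_le_logb p 2
    have h2 := le_max_left 1 (Real.logb 2 p)
    have h3 := le_max_right 1 (Real.logb 2 p)
    push_cast at h1
    linarith
  calc ((Finset.univ.filter fun b => F b ∧ 0 < degreeIn G P b).card : ℝ)
      ≤ (2 + 8 * Nat.log 2 p) * best := by exact_mod_cast hcard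
    _ ≤ _ := mul_le_mul_of_nonneg_right hlog (Nat.cast_nonneg _)

end LocalSearch

end LevelledExecutor

/-! ### Valid schedules come to an end -/

namespace LevelledExecutor.Schedule.IsValid

variable {V : Type*} [Fintype V] {S : Schedule V} {G : SimpleGraph V} {s : V}

/-- Take an uninformed node `w` closest to the source. It has an informed neighbour on the preceding
level, which has its turn in one of the three blocks. Then some active node is adjacent to `w`, and
so it informs somebody. -/
theorem inf_ne_of_ne_univ (h : S.IsValid G s) (hG : G.Connected) {r : ℕ}
    (hr : S.inf r ≠ Set.univ) : S.inf r ⊂ S.inf (r + 3) := by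
  refine (h.inf_mono (by omega)).ssubset_of_ne fun heq => ?_
  have hmono : ∀ r', r ≤ r' → r' ≤ r + 3 → S.inf r' = S.inf r := fun r' h1 h2 =>
    (heq ▸ h.inf_mono h2).antisymm (h.inf_mono h1)
  obtain ⟨w, hw, hmin⟩ := Set.exists_min_image (S.inf r)ᶜ (G.dist s) (Set.toFinite _)
    (Set.nonempty_compl.2 hr)
  have hws : G.dist s w ≠ 0 := fun h0 =>
    hw ((hG.dist_eq_zero_iff.1 h0) ▸ h.source_mem_inf r)
  obtain ⟨u, huw, hu⟩ := hG.exists_adj_dist_eq (s := s) (l := G.dist s w - 1) (w := w) (by omega)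
  have hur : u ∈ S.inf r := by
    by_contra hn
    have := hmin u hn
    omega
  obtain ⟨r', h1, h2, h3⟩ : ∃ r', r ≤ r' ∧ r' < r + 3 ∧ G.dist s u % 3 = r' % 3 :=
    ⟨r + (G.dist s u + 2 * r) % 3, by omega, by omega, by omega⟩
  have hur' : u ∈ S.inf r' := h.inf_mono h1 hur
  have hwr' : w ∉ S.inf r' := by rwa [hmono r' h1 (by omega)]
  obtain ⟨v, hv, hvw⟩ : ∃ v ∈ S.act r', G.Adj v w := by
    rcases Nat.eq_zero_or_pos r' with h0 | h0
    · subst h0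
      rw [h.inf_zero] at hur'
      exact ⟨u, by rwa [h.act_zero], huw⟩
    · obtain ⟨v, hv, hvw⟩ := (h.act_minimal r' _ h0 h3).1.2 w
        ⟨show G.dist s w = G.dist s u + 1 by omega, hwr'⟩ ⟨u, ⟨hur', rfl⟩, huw⟩
      exact ⟨v, hv.1, hvw⟩
  obtain ⟨u', hu'⟩ := h.exists_informs_of_adj hv hvw hwr' (by omega)
  refine hu'.2.1 ?_
  rw [hmono r' h1 (by omega), ← hmono (r' + 1) (by omega) (by omega)]
  exact h.informs_mem_inf_succ hu'

theorem inf_eq_univ (h : S.IsValid G s) (hG : G.Connected) {r : ℕ}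
    (hr : 3 * Fintype.card V ≤ r) : S.inf r = Set.univ := by
  have key : ∀ m, S.inf (3 * m) = Set.univ ∨ m < (S.inf (3 * m)).ncard := by
    intro m
    induction m with
    | zero => exact Or.inr (by rw [h.inf_zero, Set.ncard_singleton]; exact one_pos)
    | succ m ih =>
      by_cases hm : S.inf (3 * m) = Set.univ
      · left
        exact Set.eq_univ_of_univ_subset (hm ▸ h.inf_mono (by omega))
      · right
        have h1 := ih.resolve_left hm
        have h2 := Set.ncard_lt_ncard (h.inf_ne_of_ne_univ hG hm)
        rw [show 3 * (m + 1) = 3 * m + 3 by ring]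
        omega
  refine Set.eq_univ_of_univ_subset (le_trans ?_ (h.inf_mono hr))
  rcases key (Fintype.card V) with h1 | h1
  · exact h1.ge
  · have := Set.ncard_le_card (S.inf (3 * Fintype.card V))
    rw [Nat.card_eq_fintype_card] at this
    omega

/-- When all nodes are informed there are no private frontier nodes, so nobody transmits. This
justifies stopping the simulation after 3n blocks. -/
theorem act_eq_empty (h : S.IsValid G s) (hG : G.Connected) {r : ℕ}
    (hr : 3 * Fintype.card V ≤ r) (v : V) : v ∉ S.act r := by
  intro hv
  have hpos : 0 < Fintype.card V := Fintype.card_pos_iff.2 ⟨s⟩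
  obtain ⟨u, hu⟩ := h.exists_informs (by omega) hv
  exact hu.2.1 (by rw [h.inf_eq_univ hG hr]; trivial)

end LevelledExecutor.Schedule.IsValid

/-! ## The construction of the labels -/

namespace LevelledExecutor.Construction

open Classical RAM

local notation "DIST" => (0 : ℕ)
local notation "BALL" => (1 : ℕ)
local notation "POW" => (2 : ℕ)
local notation "CLOG" => (3 : ℕ)
local notation "LEN" => (4 : ℕ)
local notation "INF" => (5 : ℕ)
local notation "CAND" => (6 : ℕ)
local notation "ACT" => (7 : ℕ)
local notation "FB" => (8 : ℕ)
local notation "JOIN" => (9 : ℕ)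
local notation "STAY" => (10 : ℕ)
local notation "GO" => (11 : ℕ)
local notation "OLD" => (12 : ℕ)
local notation "CNT" => (13 : ℕ)
local notation "STARTED" => (14 : ℕ)
local notation "SEL" => (15 : ℕ)
local notation "CUR" => (16 : ℕ)
local notation "BEST" => (17 : ℕ)
local notation "BSET" => (18 : ℕ)
local notation "NEW" => (19 : ℕ)
local notation "OUT₀" => (20 : ℕ)
local notation "OUT₁" => (21 : ℕ)
local notation "OUT₂" => (22 : ℕ)
local notation "OUT₃" => (23 : ℕ)
local notation "OUT₄" => (24 : ℕ)

section Definitions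

variable {n : ℕ} (N : Network n) (A : Arrays n)

/-- The distance of `v` from the source is `c` modulo `3`. -/
def InClass (c : ℕ) (v : Fin n) : Prop := ∃ q : Fin n, A DIST v = 3 * q + c

/-! ### Preparation -/

noncomputable def markSource (a : ℕ) : Arrays n :=
  Function.update A a fun v => if v = N.source then 1 else 0

/-- The entry `n` in the feedback array is no node and stands for "none". -/
noncomputable def start : Arrays n :=
  Function.update (Function.update (markSource N (markSource N (markSource N A BALL) INF) CAND)
    POW fun _ => 1) FB fun _ => n

/-- The distance counts the steps until the ball around the source reaches the node. In the same way
the rounded logarithm counts the powers of two below `n`. -/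
noncomputable def growDist : Arrays n :=
  Function.update A DIST fun v => A DIST v + if A BALL v = 0 then 1 else 0

noncomputable def growBall : Arrays n :=
  Function.update A BALL fun v =>
    if A BALL v ≠ 0 ∨ ∃ u, N.graph.Adj u v ∧ A BALL u ≠ 0 then 1 else 0

noncomputable def growLog : Arrays n :=
  Function.update A CLOG fun v => A CLOG v + if A POW v < n then 1 else 0

noncomputable def growPow : Arrays n := Function.update A POW fun v => A POW v + A POW v

noncomputable def grow : Arrays n := growPow (growLog (growBall N (growDist A)))

noncomputable def setLength : Arrays n :=
  Function.update A LEN fun v => 15 * ∑ i : Fin n, if i < A CLOG v then A CLOG v else 0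

noncomputable def prepare : Arrays n :=
  setLength (sweep (fun (_ : Fin n) B => grow N B) n (start N A))

/-! ### The nodes that transmit in the Broadcast step -/

/-- The counter is 0 exactly in the first block of a stage, so during a stage `OLD` remembers who
was informed at its start. -/
noncomputable def saveInformed : Arrays n :=
  Function.update A OLD fun v => if A CNT v = 0 then A INF v else A OLD v

noncomputable def advanceCounter : Arrays n :=
  Function.update A CNT fun v => if A CNT v + 1 = A LEN v then 0 else A CNT v + 1

noncomputable def activate (c : ℕ) : Arrays n :=
  Function.update A ACT fun v => if A CAND v ≠ 0 ∧ InClass A c v then 1 else 0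

/-- Without `v` the active nodes dominate the same uninformed nodes. -/
def Redundant (v : Fin n) : Prop :=
  A STARTED v ≠ 0 ∧ ∀ w, A INF w = 0 → A DIST w = A DIST v + 1 → N.graph.Adj v w →
    ∃ v', v' ≠ v ∧ A ACT v' ≠ 0 ∧ A DIST v' = A DIST v ∧ N.graph.Adj v' w

noncomputable def prune (i : Fin n) : Arrays n :=
  Function.update A ACT fun v => if v = i ∧ Redundant N A v then 0 else A ACT v

noncomputable def chooseActive (c : ℕ) : Arrays n :=
  sweep (fun i B => prune N B i) n (activate (advanceCounter (saveInformed A)) c)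

/-! ### The selection -/

def Selectable (l a : Fin n) : Prop := A ACT a ≠ 0 ∧ A OLD a ≠ 0 ∧ A DIST a = l

def Frontier (l b : Fin n) : Prop := A INF b = 0 ∧ A DIST b = l + 1

/-- The frontier nodes whose degree is between `d + 1` and `2 d + 1`. -/
def Bucket (l d b : Fin n) : Prop :=
  Frontier A l b ∧ d + 1 ≤ degreeIn N.graph (Selectable A l) b ∧
    degreeIn N.graph (Selectable A l) b < 2 * (d + 1)

noncomputable def searchStep (l d : Fin n) : Arrays n :=
  Function.update A CUR (improve N.graph (Selectable A l) (Bucket N A l d) (A CUR))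

noncomputable def search (l d : Fin n) : Arrays n :=
  sweep (fun (_ : Fin n) B => searchStep N B l d) n (Function.update A CUR fun _ => 0)

noncomputable def keepSet (l : Fin n) : Arrays n :=
  Function.update A BSET fun v =>
    if A BEST v < score N.graph (Frontier A l) (A CUR) then A CUR v else A BSET v

noncomputable def keepScore (l : Fin n) : Arrays n :=
  Function.update A BEST fun v =>
    if A BEST v < score N.graph (Frontier A l) (A CUR) then score N.graph (Frontier A l) (A CUR)
    else A BEST v

/-- All thresholds from 1 to n are tried rather than the powers of two only; this contains what the
analysis needs and computes no powers. -/
noncomputable def searchBuckets (l : Fin n) : Arrays n :=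
  sweep (fun d B => keepScore N (keepSet N (search N B l d) l) l) n A

noncomputable def storeSelection (l : Fin n) : Arrays n :=
  Function.update (Function.update (Function.update A SEL fun v =>
    if A DIST v = l then A BSET v else A SEL v) BSET fun _ => 0) BEST fun _ => 0

noncomputable def select : Arrays n :=
  sweep (fun l B => storeSelection (searchBuckets N B l) l) n A

/-! ### The labels and the effect of the block -/

noncomputable def recordJoin : Arrays n :=
  Function.update A JOIN fun v => if A JOIN v ≠ 0 ∨ A ACT v ≠ 0 then 1 else 0

/-- This runs before the feedback array is rewritten: the entry of an active node is still the
feedback node of its previous turn, which has to say that the node stays. -/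
noncomputable def recordStay : Arrays n :=
  Function.update A STAY fun u =>
    if A STAY u ≠ 0 ∨ ∃ v, A ACT v ≠ 0 ∧ A FB v = (u : ℕ) then 1 else 0

/-- `u` may become the feedback node of `v`. -/
def Eligible (v u : Fin n) : Prop :=
  A INF u = 0 ∧ A DIST u = A DIST v + 1 ∧ N.graph.Adj v u ∧
    ∀ w, A ACT w ≠ 0 → N.graph.Adj w u → w = v

/-- The sum counts the nodes up to which no eligible node has occurred. This is the index of the
first eligible node, or `n` if there is none. -/
noncomputable def chooseFeedback : Arrays n :=
  Function.update A FB fun v => if A ACT v ≠ 0 then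
    ∑ u : Fin n, if ∀ u' : Fin n, (u' : ℕ) ≤ (u : ℕ) → ¬Eligible N A v u' then 1 else 0 else A FB v

noncomputable def recordGo : Arrays n :=
  Function.update A GO fun u =>
    if A GO u ≠ 0 ∨ ∃ v, A ACT v ≠ 0 ∧ A SEL v ≠ 0 ∧ A FB v = (u : ℕ) then 1 else 0

noncomputable def findNew (c : ℕ) : Arrays n :=
  Function.update A NEW fun u => if A INF u = 0 ∧ InClass A c u ∧
    ((∃! w, N.graph.Adj u w ∧ A ACT w ≠ 0) ∨ ∃! w, N.graph.Adj u w ∧ A ACT w ≠ 0 ∧ A SEL w ≠ 0)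
    then 1 else 0

/-- Candidates for the next turn are the fresh nodes and those that survived the pruning of this
turn; levels that were not due keep theirs. -/
noncomputable def updateCandidates (c : ℕ) : Arrays n :=
  Function.update A CAND fun v =>
    if A NEW v ≠ 0 then 1 else if InClass A c v then A ACT v else A CAND v

noncomputable def inform : Arrays n :=
  Function.update A INF fun v => if A INF v ≠ 0 ∨ A NEW v ≠ 0 then 1 else 0

noncomputable def finish (c c' : ℕ) : Arrays n :=
  Function.update (inform (updateCandidates (findNew N (recordGo (select N (chooseFeedback N
    (recordStay (recordJoin A))))) c') c)) STARTED fun _ => 1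

noncomputable def block (c c' : ℕ) : Arrays n := finish N (chooseActive N A c) c c'

noncomputable def output : Arrays n :=
  Function.update (Function.update (Function.update (Function.update (Function.update A
    OUT₀ fun v => if A JOIN v ≠ 0 then 1 else 0)
    OUT₁ fun v => if InClass A 2 v then 1 else 0)
    OUT₂ fun v => if InClass A 1 v then 1 else 0)
    OUT₃ fun v => if A STAY v ≠ 0 then 1 else 0)
    OUT₄ fun v => if A GO v ≠ 0 then 1 else 0

/-- The residues are constants of the program, so three blocks form the body of the sweep, which
simulates 3n blocks. -/
noncomputable def labels : Arrays n :=
  output (sweep (fun (_ : Fin n) B => block N (block N (block N B 0 1) 1 2) 2 0) n (prepare N A))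

/-! ### Computability -/

section Computability

variable {k : ℕ}

theorem decides_inClass (c : ℕ) (i : Fin k) :
    Decides (fun _ _ A (x : Fin k → _) => InClass A c (x i)) :=
  .exists (.eq (.array _ _) (.add (.const_mul 3 (.var _)) (.const c)))

theorem transforms_markSource (a : ℕ) :
    Transforms (k := k) (fun _ N A _ => markSource N A a) :=
  .update _ (.ite (.eq_source _) (.const 1) (.const 0))

theorem transforms_start : Transforms (k := k) (fun _ N A _ => start N A) :=
  .comp (H := fun n _ A _ => Function.update A FB fun _ => n)
    (.comp (H := fun _ _ A _ => Function.update A POW fun _ => 1)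
      (.comp (.comp (transforms_markSource BALL) (transforms_markSource INF))
        (transforms_markSource CAND)) (.update _ (.const 1))) (.update _ .size)

theorem transforms_grow : Transforms (k := k) (fun _ N A _ => grow N A) := by
  have h1 : Transforms (k := k) (fun _ N A _ => growDist A) := by
    unfold growDist
    exact .update _ (.add (.array _ _)
      (.ite (.eq (.array _ _) (.const 0)) (.const 1) (.const 0)))
  have h2 : Transforms (k := k) (fun _ N A _ => growBall N A) := by
    unfold growBall
    exact .update _ (.ite (.or (.ne (.array _ _) (.const 0)) (.exists (.and (.adj _ _)
      (.ne (.array _ _) (.const 0))))) (.const 1) (.const 0))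
  have h3 : Transforms (k := k) (fun _ N A _ => growLog A) := by
    unfold growLog
    exact .update _ (.add (.array _ _) (.ite (.lt (.array _ _) .size) (.const 1) (.const 0)))
  have h4 : Transforms (k := k) (fun _ N A _ => growPow A) := by
    unfold growPow
    exact .update _ (.add (.array _ _) (.array _ _))
  exact ((h1.comp h2).comp h3).comp h4

theorem transforms_prepare : Transforms (k := k) (fun _ N A _ => prepare N A) := by
  have h : Transforms (k := k) (fun _ N A _ => setLength A) := by
    unfold setLength
    exact .update _ (.const_mul 15
      (.sum (.ite (.lt (.var _) (.array _ _)) (.array _ _) (.const 0))))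
  exact (transforms_start.comp (.sweep (F := fun _ N A _ _ => grow N A) transforms_grow)).comp h

theorem transforms_chooseActive (c : ℕ) :
    Transforms (k := k) (fun _ N A _ => chooseActive N A c) := by
  have h1 : Transforms (k := k) (fun _ N A _ => saveInformed A) := by
    unfold saveInformed
    exact .update _ (.ite (.eq (.array _ _) (.const 0)) (.array _ _) (.array _ _))
  have h2 : Transforms (k := k) (fun _ N A _ => advanceCounter A) := by
    unfold advanceCounter
    exact .update _ (.ite (.eq (.add (.array _ _) (.const 1)) (.array _ _)) (.const 0)
      (.add (.array _ _) (.const 1)))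
  have h3 : Transforms (k := k) (fun _ N A _ => activate A c) := by
    unfold activate
    exact .update _ (.ite (.and (.ne (.array _ _) (.const 0)) (decides_inClass c _))
      (.const 1) (.const 0))
  have h4 : Transforms (k := k + 1) (fun _ N A x => prune N A (x (Fin.last k))) := by
    unfold prune Redundant
    exact .update _ (.ite (.and (.var_eq _ _) (.and (.ne (.array _ _) (.const 0)) (.forall
      (.imp (.eq (.array _ _) (.const 0)) (.imp (.eq (.array _ _) (.add (.array _ _) (.const 1)))
      (.imp (.adj _ _) (.exists (.and (.var_ne _ _) (.and (.ne (.array _ _) (.const 0))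
      (.and (.eq (.array _ _) (.array _ _)) (.adj _ _)))))))))))
      (.const 0) (.array _ _))
  exact ((h1.comp h2).comp h3).comp (.sweep (F := fun _ N A _ i => prune N A i) h4)

theorem decides_selectable (i j : Fin k) :
    Decides (fun _ _ A (x : Fin k → _) => Selectable A (x i) (x j)) :=
  .and (.ne (.array _ _) (.const 0)) (.and (.ne (.array _ _) (.const 0))
    (.eq (.array _ _) (.var _)))

theorem decides_frontier (i j : Fin k) :
    Decides (fun _ _ A (x : Fin k → _) => Frontier A (x i) (x j)) :=
  .and (.eq (.array _ _) (.const 0)) (.eq (.array _ _) (.add (.var _) (.const 1)))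

theorem computes_degreeIn (i j : Fin k) :
    Computes (fun _ N A (x : Fin k → _) => degreeIn N.graph (Selectable A (x i)) (x j)) := by
  unfold degreeIn
  exact .sum (.ite (.and (decides_selectable i.castSucc (Fin.last k)) (.adj _ _))
    (.const 1) (.const 0))

theorem decides_bucket (i j l : Fin k) :
    Decides (fun _ N A (x : Fin k → _) => Bucket N A (x i) (x j) (x l)) :=
  .and (decides_frontier i l) (.and (.le (.add (.var _) (.const 1)) (computes_degreeIn _ _))
    (.lt (computes_degreeIn _ _) (.const_mul 2 (.add (.var _) (.const 1)))))

theorem computes_cover (j : Fin k) :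
    Computes (fun _ N A (x : Fin k → _) => cover N.graph (A CUR) (x j)) := by
  unfold cover
  exact .sum (.ite (.and (.ne (.array _ _) (.const 0)) (.adj _ _)) (.const 1) (.const 0))

theorem computes_score (i : Fin k) :
    Computes (fun _ N A (x : Fin k → _) => score N.graph (Frontier A (x i)) (A CUR)) := by
  unfold score
  exact .sum (.ite (.and (decides_frontier i.castSucc (Fin.last k))
    (.eq (computes_cover _) (.const 1))) (.const 1) (.const 0))

theorem decides_improving (i j l : Fin k) : Decides (fun _ N A (x : Fin k → _) =>
    Improving N.graph (Selectable A (x i)) (Bucket N A (x i) (x j)) (A CUR) (x l)) := by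
  have h : Decides (k := k + 1) (fun _ N A (x : Fin (k + 1) → _) =>
      Bucket N A (x i.castSucc) (x j.castSucc) (x (Fin.last k)) ∧
        N.graph.Adj (x l.castSucc) (x (Fin.last k))) := .and (decides_bucket _ _ _) (.adj _ _)
  unfold Improving
  exact .and (decides_selectable _ _) (.or
    (.and (.eq (.array _ _) (.const 0)) (.lt (.sum (.ite h (.const_mul 2 (computes_cover _))
      (.const 0))) (.sum (.ite h (.const 1) (.const 0)))))
    (.and (.ne (.array _ _) (.const 0)) (.lt (.sum (.ite h (.const 3) (.const 0)))
      (.sum (.ite h (.const_mul 2 (computes_cover _)) (.const 0))))))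

theorem transforms_searchStep (i j : Fin k) :
    Transforms (fun _ N A (x : Fin k → _) => searchStep N A (x i) (x j)) := by
  unfold searchStep improve
  refine .update _ (.ite (.and (decides_improving i.castSucc j.castSucc (Fin.last k)) (.forall
    (.imp (.of_iff (.lt (.var _) (.var _)) fun _ _ _ _ => Fin.lt_def)
      (.not (decides_improving i.castSucc.castSucc j.castSucc.castSucc (Fin.last _))))))
    (.sub (.const 1) (.array _ _)) (.array _ _))

theorem transforms_search (i j : Fin k) :
    Transforms (fun _ N A (x : Fin k → _) => search N A (x i) (x j)) :=
  .comp (F := fun _ _ A _ => Function.update A CUR fun _ => 0) (.update _ (.const 0))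
    (.sweep (F := fun _ N A x _ => searchStep N A (x i) (x j)) (transforms_searchStep _ _))

theorem transforms_searchBuckets (i : Fin k) :
    Transforms (fun _ N A (x : Fin k → _) => searchBuckets N A (x i)) := by
  have h1 : Transforms (k := k + 1) (fun _ N A (x : Fin (k + 1) → _) =>
      keepSet N A (x i.castSucc)) := by
    unfold keepSet
    exact .update _ (.ite (.lt (.array _ _) (computes_score i.castSucc.castSucc))
      (.array _ _) (.array _ _))
  have h2 : Transforms (k := k + 1) (fun _ N A (x : Fin (k + 1) → _) =>
      keepScore N A (x i.castSucc)) := by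
    unfold keepScore
    exact .update _ (.ite (.lt (.array _ _) (computes_score i.castSucc.castSucc))
      (computes_score i.castSucc.castSucc) (.array _ _))
  exact .sweep (F := fun _ N A x d =>
    keepScore N (keepSet N (search N A (x i) d) (x i)) (x i))
    (((transforms_search i.castSucc (Fin.last k)).comp h1).comp h2)

theorem transforms_select : Transforms (k := k) (fun _ N A _ => select N A) := by
  have h : Transforms (k := k + 1) (fun _ N A x => storeSelection A (x (Fin.last k))) :=
    .comp (F := fun _ _ A (x : Fin (k + 1) → _) => Function.update (Function.update A SEL fun v =>
        if A DIST v = x (Fin.last k) then A BSET v else A SEL v) BSET fun _ => 0)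
      (H := fun _ _ A _ => Function.update A BEST fun _ => 0)
      (.comp (F := fun _ _ A (x : Fin (k + 1) → _) => Function.update A SEL fun v =>
          if A DIST v = x (Fin.last k) then A BSET v else A SEL v)
        (H := fun _ _ A _ => Function.update A BSET fun _ => 0)
        (.update _ (.ite (.eq (.array _ _) (.var _)) (.array _ _) (.array _ _)))
        (.update _ (.const 0))) (.update _ (.const 0))
  exact .sweep (F := fun _ N A _ l => storeSelection (searchBuckets N A l) l)
    ((transforms_searchBuckets _).comp h)

theorem decides_eligible (i j : Fin k) :
    Decides (fun _ N A (x : Fin k → _) => Eligible N A (x i) (x j)) :=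
  .and (.eq (.array _ _) (.const 0)) (.and (.eq (.array _ _) (.add (.array _ _) (.const 1)))
    (.and (.adj _ _) (.forall (.imp (.ne (.array _ _) (.const 0))
      (.imp (.adj _ _) (.var_eq _ _))))))

theorem transforms_finish (c c' : ℕ) :
    Transforms (k := k) (fun _ N A _ => finish N A c c') := by
  have h1 : Transforms (k := k) (fun _ N A _ => recordJoin A) := by
    unfold recordJoin
    exact .update _ (.ite (.or (.ne (.array _ _) (.const 0)) (.ne (.array _ _) (.const 0)))
      (.const 1) (.const 0))
  have h2 : Transforms (k := k) (fun _ N A _ => recordStay A) := by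
    unfold recordStay
    exact .update _ (.ite (.or (.ne (.array _ _) (.const 0)) (.exists (.and
      (.ne (.array _ _) (.const 0)) (.eq (.array _ _) (.var _))))) (.const 1) (.const 0))
  have h3 : Transforms (k := k) (fun _ N A _ => chooseFeedback N A) := by
    unfold chooseFeedback
    exact .update _ (.ite (.ne (.array _ _) (.const 0)) (.sum (.ite (.forall (.imp
      (.le (.var _) (.var _))
      (.not (decides_eligible (Fin.last k).castSucc.castSucc (Fin.last _)))))
      (.const 1) (.const 0))) (.array _ _))
  have h4 : Transforms (k := k) (fun _ N A _ => recordGo A) := by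
    unfold recordGo
    exact .update _ (.ite (.or (.ne (.array _ _) (.const 0)) (.exists (.and
      (.ne (.array _ _) (.const 0)) (.and (.ne (.array _ _) (.const 0))
      (.eq (.array _ _) (.var _)))))) (.const 1) (.const 0))
  have h5 : Transforms (k := k) (fun _ N A _ => findNew N A c') := by
    unfold findNew ExistsUnique
    exact .update _ (.ite (.and (.eq (.array _ _) (.const 0)) (.and (decides_inClass _ _) (.or
      (.exists (.and (.and (.adj _ _) (.ne (.array _ _) (.const 0)))
        (.forall (.imp (.and (.adj _ _) (.ne (.array _ _) (.const 0))) (.var_eq _ _)))))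
      (.exists (.and (.and (.adj _ _) (.and (.ne (.array _ _) (.const 0))
          (.ne (.array _ _) (.const 0))))
        (.forall (.imp (.and (.adj _ _) (.and (.ne (.array _ _) (.const 0))
          (.ne (.array _ _) (.const 0)))) (.var_eq _ _))))))))
      (.const 1) (.const 0))
  have h6 : Transforms (k := k) (fun _ N A _ => updateCandidates A c) := by
    unfold updateCandidates
    exact .update _ (.ite (.ne (.array _ _) (.const 0)) (.const 1)
      (.ite (decides_inClass _ _) (.array _ _) (.array _ _)))
  have h7 : Transforms (k := k) (fun _ N A _ => inform A) := by
    unfold inform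
    exact .update _ (.ite (.or (.ne (.array _ _) (.const 0)) (.ne (.array _ _) (.const 0)))
      (.const 1) (.const 0))
  exact (((((((h1.comp h2).comp h3).comp transforms_select).comp h4).comp h5).comp h6).comp h7).comp
    (H := fun _ _ A _ => Function.update A STARTED fun _ => 1) (.update _ (.const 1))

theorem transforms_block (c c' : ℕ) : Transforms (k := k) (fun _ N A _ => block N A c c') :=
  (transforms_chooseActive c).comp (transforms_finish c c')

theorem transforms_output : Transforms (k := k) (fun _ _ A _ => output A) := by
  have h (a b : ℕ) : Transforms (k := k) (fun _ _ A _ =>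
      Function.update A b fun v => if A a v ≠ 0 then 1 else 0) :=
    .update _ (.ite (.ne (.array _ _) (.const 0)) (.const 1) (.const 0))
  have h' (c b : ℕ) : Transforms (k := k) (fun _ _ A _ =>
      Function.update A b fun v => if InClass A c v then 1 else 0) :=
    .update _ (.ite (decides_inClass _ _) (.const 1) (.const 0))
  exact ((((h JOIN OUT₀).comp (h' 2 OUT₁)).comp (h' 1 OUT₂)).comp (h STAY OUT₃)).comp (h GO OUT₄)

theorem transforms_labels : Transforms (k := k) (fun _ N A _ => labels N A) :=
  (transforms_prepare.comp (.sweep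
    (F := fun _ N A _ _ => block N (block N (block N A 0 1) 1 2) 2 0)
    (((transforms_block 0 1).comp (transforms_block 1 2)).comp (transforms_block 2 0)))).comp
    transforms_output

end Computability

end Definitions

section Preparation

/-! ### Correctness of the preparation and of the choice of the active nodes -/

variable {n : ℕ} {N : Network n} {A B : Arrays n}

theorem inClass_congr (h : B DIST = A DIST) (c : ℕ) (v : Fin n) :
    InClass B c v ↔ InClass A c v := by
  unfold InClass
  rw [h]

/-- Distances are smaller than n, so the quotient by 3 is among the nodes and division becomes a
bounded search. -/
theorem inClass_iff (hN : N.graph.Connected)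
    (hA : ∀ v, A DIST v = N.graph.dist N.source v) {c : ℕ} (hc : c < 3) (v : Fin n) :
    InClass A c v ↔ N.graph.dist N.source v % 3 = c := by
  have := hN.dist_lt_card N.source v
  rw [Fintype.card_fin] at this
  unfold InClass
  rw [hA]
  constructor
  · rintro ⟨q, hq⟩
    omega
  · intro h
    exact ⟨⟨N.graph.dist N.source v / 3, by omega⟩, by simp only; omega⟩

theorem start_apply_of_notMem {a : ℕ} (ha : a ∉ [BALL, POW, INF, CAND, FB]) :
    start N A a = A a := by
  simp only [List.mem_cons, not_or] at ha
  obtain ⟨h1, h2, h3, h4, h5, -⟩ := ha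
  simp only [start, markSource, ne_eq, h1, h2, h3, h4, h5, not_false_eq_true,
    Function.update_of_ne]

structure GrowInv (N : Network n) (A : Arrays n) (m : ℕ) (B : Arrays n) : Prop where
  dist : ∀ v, B DIST v = min m (N.graph.dist N.source v)
  ball : ∀ v, B BALL v ≠ 0 ↔ N.graph.dist N.source v ≤ m
  pow : ∀ v, B POW v = 2 ^ m
  clog : ∀ v, B CLOG v = min m (Nat.clog 2 n)
  other : ∀ a ∉ [DIST, BALL, POW, CLOG], B a = A a

theorem GrowInv.grow (hN : N.graph.Connected) {m : ℕ} (h : GrowInv N A m B) :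
    GrowInv N A (m + 1) (grow N B) where
  dist v := by
    have h1 := h.dist v
    have h2 := h.ball v
    change (B DIST v + if B BALL v = 0 then 1 else 0) = _
    split_ifs with h3
    · have := mt h2.2 (not_not.2 h3)
      omega
    · have := h2.1 h3
      omega
  ball v := by
    change (if B BALL v ≠ 0 ∨ ∃ u, N.graph.Adj u v ∧ B BALL u ≠ 0 then 1 else 0) ≠ 0 ↔ _
    simp only [h.ball, ne_eq, ite_eq_right_iff, one_ne_zero, imp_false, not_not]
    constructor
    · rintro (h1 | ⟨u, h1, h2⟩)
      · omega
      · have := h1.dist_le_succ (s := N.source)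
        omega
    · intro h1
      by_cases hv : N.graph.dist N.source v = 0
      · left
        omega
      · obtain ⟨u, hu, hd⟩ := hN.exists_adj_dist_eq (s := N.source)
          (l := N.graph.dist N.source v - 1) (w := v) (by omega)
        exact Or.inr ⟨u, hu, by omega⟩
  pow v := by
    have := h.pow v
    change B POW v + B POW v = _
    rw [this, pow_succ, mul_two]
  clog v := by
    have h1 := h.pow v
    have h2 := h.clog v
    have h3 : 2 ^ m < n ↔ m < Nat.clog 2 n := (Nat.lt_clog_iff_pow_lt one_lt_two).symm
    change (B CLOG v + if B POW v < n then 1 else 0) = _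
    simp only [h1, h2, h3]
    split_ifs <;> omega
  other a ha := by
    rw [← h.other a ha]
    simp only [List.mem_cons, not_or] at ha
    obtain ⟨h1, h2, h3, h4, -⟩ := ha
    simp only [Construction.grow, growPow, growLog, growBall, growDist, ne_eq, h1, h2, h3, h4,
      not_false_eq_true, Function.update_of_ne]

theorem prepare_spec (hN : N.graph.Connected) (hA : ∀ a v, A a v = 0) :
    (∀ v, prepare N A DIST v = N.graph.dist N.source v) ∧
    (∀ v, prepare N A LEN v = stageLength n) ∧
    (∀ v, prepare N A INF v ≠ 0 ↔ v = N.source) ∧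
    (∀ v, prepare N A CAND v ≠ 0 ↔ v = N.source) ∧
    (∀ v, prepare N A FB v = n) ∧
    ∀ a ∉ [DIST, BALL, POW, CLOG, LEN, INF, CAND, FB], ∀ v, prepare N A a v = 0 := by
  obtain ⟨B, hB⟩ : ∃ B, B = sweep (fun (_ : Fin n) B => grow N B) n (start N A) := ⟨_, rfl⟩
  have hinv : GrowInv N (start N A) n B := by
    rw [hB]
    refine sweep_induction (GrowInv N (start N A)) ⟨fun v => ?_, fun v => ?_, fun v => ?_,
      fun v => ?_, fun a _ => rfl⟩ fun m y hy => hy.grow hN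
    · rw [start_apply_of_notMem (by decide), hA, Nat.zero_min]
    · rw [Nat.le_zero, hN.dist_eq_zero_iff]
      simp [start, markSource, eq_comm]
    · simp [start]
    · rw [start_apply_of_notMem (by decide), hA, Nat.zero_min]
  have hp : prepare N A = setLength B := by rw [hB]; rfl
  have hlt : ∀ v, N.graph.dist N.source v < n := fun v => by
    simpa using hN.dist_lt_card N.source v
  have hcl : Nat.clog 2 n ≤ n := Nat.clog_le_of_le_pow (Nat.lt_two_pow_self).le
  have hoff : ∀ a ∉ [DIST, BALL, POW, CLOG, LEN], setLength B a = start N A a := by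
    intro a ha
    rw [setLength, Function.update_of_ne (by rintro rfl; simp at ha)]
    exact hinv.other a (by simp_all)
  rw [hp]
  refine ⟨fun v => ?_, fun v => ?_, fun v => ?_, fun v => ?_, fun v => ?_, fun a ha v => ?_⟩
  · rw [setLength, Function.update_of_ne (by decide), hinv.dist, min_eq_right (hlt v).le]
  · rw [setLength, Function.update_self, hinv.clog, min_eq_right hcl, ← Finset.sum_filter,
      Finset.sum_const, smul_eq_mul, stageLength, sq]
    congr 2
    have := Fin.card_filter_val_lt (n := n) (m := Nat.clog 2 n)
    rwa [min_eq_right hcl] at this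
  · rw [hoff _ (by decide)]
    simp [start, markSource]
  · rw [hoff _ (by decide)]
    simp [start, markSource]
  · rw [hoff _ (by decide)]
    simp [start, markSource]
  · rw [hoff _ (by simp_all), start_apply_of_notMem (by simp_all), hA]

/-- What holds when the redundancy of the first `m` nodes has been checked. -/
structure PruneInv (N : Network n) (A : Arrays n) (c m : ℕ) (B : Arrays n) : Prop where
  other : ∀ a, a ≠ ACT → B a = A a
  subset : ∀ v, B ACT v ≠ 0 → A CAND v ≠ 0 ∧ InClass A c v
  first : ∀ v, A STARTED v = 0 → A CAND v ≠ 0 → InClass A c v → B ACT v ≠ 0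
  dominates : ∀ v w, A CAND v ≠ 0 → InClass A c v → A INF w = 0 → A DIST w = A DIST v + 1 →
    N.graph.Adj v w → ∃ v', B ACT v' ≠ 0 ∧ A DIST v' = A DIST v ∧ N.graph.Adj v' w
  irredundant : ∀ v : Fin n, v < m → A STARTED v ≠ 0 → B ACT v ≠ 0 →
    ∃ w, A INF w = 0 ∧ A DIST w = A DIST v + 1 ∧ N.graph.Adj v w ∧
      ∀ v', B ACT v' ≠ 0 → A DIST v' = A DIST v → N.graph.Adj v' w → v' = v

/-- Discarding a redundant node loses no domination, since other active nodes of its level cover its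
frontier nodes. A node found irredundant stays so, because active sets only shrink and its private
frontier node remains private. One pass therefore suffices. -/
theorem PruneInv.prune {c m : ℕ} (h : PruneInv N A c m B) (i : Fin n) (hi : (i : ℕ) = m) :
    PruneInv N A c (m + 1) (prune N B i) := by
  have hsub : ∀ v, Construction.prune N B i ACT v ≠ 0 → B ACT v ≠ 0 := by
    intro v hv
    rw [Construction.prune, Function.update_self] at hv
    split_ifs at hv
    · exact absurd rfl hv
    · exact hv
  have hkeep : ∀ v, v ≠ i → B ACT v ≠ 0 → Construction.prune N B i ACT v ≠ 0 := by
    intro v hv hB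
    rwa [Construction.prune, Function.update_self, if_neg fun h => hv h.1]
  have hred : Redundant N B i ↔ A STARTED i ≠ 0 ∧ ∀ w, A INF w = 0 → A DIST w = A DIST i + 1 →
      N.graph.Adj i w → ∃ v', v' ≠ i ∧ B ACT v' ≠ 0 ∧ A DIST v' = A DIST i ∧
        N.graph.Adj v' w := by
    unfold Redundant
    rw [h.other STARTED (by decide), h.other INF (by decide), h.other DIST (by decide)]
  have hkeep' : ¬Redundant N B i → Construction.prune N B i ACT = B ACT := by
    intro hr
    rw [Construction.prune, Function.update_self]
    ext v
    exact if_neg fun (h : v = i ∧ Redundant N B v) => hr (h.1 ▸ h.2)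
  refine ⟨fun a ha => ?_, fun v hv => h.subset v (hsub v hv), fun v h1 h2 h3 => ?_,
    fun v w h1 h2 h3 h4 h5 => ?_, fun v hv h1 h2 => ?_⟩
  · rw [Construction.prune, Function.update_of_ne ha, h.other a ha]
  · by_cases hr : Redundant N B i
    · refine hkeep v ?_ (h.first v h1 h2 h3)
      rintro rfl
      exact (hred.1 hr).1 h1
    · rw [hkeep' hr]
      exact h.first v h1 h2 h3
  · obtain ⟨v', k1, k2, k3⟩ := h.dominates v w h1 h2 h3 h4 h5
    by_cases hr : Redundant N B i
    · by_cases hv' : v' = i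
      · subst hv'
        obtain ⟨v'', j1, j2, j3, j4⟩ := (hred.1 hr).2 w h3 (by omega) k3
        exact ⟨v'', hkeep v'' j1 j2, by omega, j4⟩
      · exact ⟨v', hkeep v' hv' k1, k2, k3⟩
    · rw [hkeep' hr]
      exact ⟨v', k1, k2, k3⟩
  · by_cases hvi : v = i
    · subst hvi
      have hr : ¬Redundant N B v := by
        intro hr
        rw [Construction.prune, Function.update_self, if_pos ⟨rfl, hr⟩] at h2
        exact h2 rfl
      rw [hred] at hr
      push Not at hr
      obtain ⟨w, k1, k2, k3, k4⟩ := hr h1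
      refine ⟨w, k1, k2, k3, fun v' j1 j2 j3 => ?_⟩
      by_contra hne
      exact k4 v' hne (hsub v' j1) j2 j3
    · have : (v : ℕ) ≠ i := fun h => hvi (Fin.ext h)
      obtain ⟨w, k1, k2, k3, k4⟩ := h.irredundant v (by omega) h1 (hsub v h2)
      exact ⟨w, k1, k2, k3, fun v' j1 => k4 v' (hsub v' j1)⟩

theorem chooseActive_spec (c : ℕ) : PruneInv N (advanceCounter (saveInformed A)) c n
    (chooseActive N A c) := by
  obtain ⟨A', hA'⟩ : ∃ A', A' = advanceCounter (saveInformed A) := ⟨_, rfl⟩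
  rw [chooseActive, ← hA']
  have h : ∀ v, activate A' c ACT v ≠ 0 ↔ A' CAND v ≠ 0 ∧ InClass A' c v := by
    intro v
    rw [activate, Function.update_self]
    split_ifs with h <;> simp [h]
  refine (sweep_induction (fun m B => PruneInv N A' c m B) ?_ fun m y hy => hy.prune m rfl)
  exact ⟨fun a ha => by rw [activate, Function.update_of_ne ha], fun v hv => (h v).1 hv,
    fun v _ h1 h2 => (h v).2 ⟨h1, h2⟩, fun v w h1 h2 _ _ h5 => ⟨v, (h v).2 ⟨h1, h2⟩, rfl, h5⟩,
    fun v hv => absurd hv (Nat.not_lt_zero _)⟩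

end Preparation

section Selection

/-! ### Correctness of the selection -/

variable {n : ℕ} {N : Network n} {A B : Arrays n}

theorem score_mono {V : Type*} [Fintype V] {G : SimpleGraph V} {Q Q' : V → Prop} {x : V → ℕ}
    (h : ∀ b, Q b → Q' b) : score G Q x ≤ score G Q' x := by
  refine Finset.sum_le_sum fun b _ => ?_
  by_cases hb : Q b ∧ cover G x b = 1
  · rw [if_pos hb, if_pos ⟨h b hb.1, hb.2⟩]
  · rw [if_neg hb]
    exact Nat.zero_le _

/-- From the empty selection, with potential 0, each of the n steps gains at least 1 unless a local
optimum has been reached; either way the result is locally optimal. Its score is then taken on the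
whole frontier, where results of different degree classes can be compared. -/
theorem search_spec (l d : Fin n) : ∃ x : Fin n → ℕ, search N A l d = Function.update A CUR x ∧
    (∀ v, x v ≠ 0 → Selectable A l v) ∧
    (d + 1 : ℕ) * (Finset.univ.filter (Bucket N A l d)).card ≤
      (4 * (d + 1 : ℕ) - 3) * (2 * score N.graph (Frontier A l) x) := by
  obtain ⟨x, h1, h2, h3, h4⟩ := sweep_induction (F := fun (_ : Fin n) B => searchStep N B l d)
    (x := Function.update A CUR fun _ => 0)
    (fun m B => ∃ x : Fin n → ℕ, B = Function.update A CUR x ∧ (∀ v, x v ≤ 1) ∧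
      (∀ v, x v ≠ 0 → Selectable A l v) ∧
      ((m : ℤ) ≤ potential N.graph (Bucket N A l d) x ∨
        ∀ a, ¬Improving N.graph (Selectable A l) (Bucket N A l d) x a))
    ⟨_, rfl, fun _ => Nat.zero_le _, fun _ h => absurd rfl h, Or.inl (by
      simp [potential, cover])⟩
    (by
      rintro m y ⟨x, rfl, h2, h3, h4⟩
      refine ⟨improve N.graph (Selectable A l) (Bucket N A l d) x, ?_, improve_le_one h2,
        fun v => of_improve_ne_zero h3, improve_progress h2 h4⟩
      rw [searchStep, Function.update_idem]
      rfl)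
  refine ⟨x, h1, h3, ?_⟩
  have hopt := not_improving_of_card_le_potential h2 (by rwa [Fintype.card_fin])
  refine (mul_card_le_mul_score h3 hopt (by omega) fun b hb => hb.2).trans ?_
  exact Nat.mul_le_mul_left _ (Nat.mul_le_mul_left _ (score_mono fun b hb => hb.1))

/-- The nodes of level `l` that `y` selects are as required by the selection lemma. -/
def IsGoodSelection (N : Network n) (A : Arrays n) (l : Fin n) (y : Fin n → ℕ) : Prop :=
  (∀ v, A DIST v = l → y v ≠ 0 → Selectable A l v) ∧
    ((Finset.univ.filter fun b =>
        Frontier A l b ∧ 0 < degreeIn N.graph (Selectable A l) b).card : ℝ) ≤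
      15 * max 1 (Real.logb 2 (Finset.univ.filter (Selectable A l)).card) *
        score N.graph (Frontier A l) (fun v => if A DIST v = l then y v else 0)

/-- The arrays differ only in those that the selection uses. -/
def AgreeOffSelection (A B : Arrays n) : Prop := ∀ a ∉ [SEL, CUR, BEST, BSET], B a = A a

theorem AgreeOffSelection.selectable (h : AgreeOffSelection A B) (l : Fin n) :
    Selectable B l = Selectable A l := by
  unfold Selectable
  rw [h ACT (by decide), h OLD (by decide), h DIST (by decide)]

theorem AgreeOffSelection.frontier (h : AgreeOffSelection A B) (l : Fin n) :
    Frontier B l = Frontier A l := by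
  unfold Frontier
  rw [h INF (by decide), h DIST (by decide)]

theorem AgreeOffSelection.bucket (h : AgreeOffSelection A B) (l d : Fin n) :
    Bucket N B l d = Bucket N A l d := by
  unfold Bucket
  rw [h.selectable, h.frontier]

theorem AgreeOffSelection.update (h : AgreeOffSelection A B) {a : ℕ}
    (ha : a ∈ [SEL, CUR, BEST, BSET]) (x : Fin n → ℕ) :
    AgreeOffSelection A (Function.update B a x) := fun a' ha' => by
  rw [Function.update_of_ne (by rintro rfl; exact ha' ha), h a' ha']

/-- `BEST` runs through the maxima of the scores, so in the end the estimate of every degree class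
holds with the same number, as `card_le_mul_of_buckets` demands. -/
theorem searchBuckets_spec (l : Fin n) (hbest : ∀ v, A BEST v = 0) (hset : ∀ v, A BSET v = 0) :
    AgreeOffSelection A (searchBuckets N A l) ∧ searchBuckets N A l SEL = A SEL ∧
      (∀ v, searchBuckets N A l BSET v ≠ 0 → Selectable A l v) ∧
      ((Finset.univ.filter fun b =>
          Frontier A l b ∧ 0 < degreeIn N.graph (Selectable A l) b).card : ℝ) ≤
        15 * max 1 (Real.logb 2 (Finset.univ.filter (Selectable A l)).card) *
          score N.graph (Frontier A l) (searchBuckets N A l BSET) := by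
  have key := sweep_induction
    (F := fun (d : Fin n) B => keepScore N (keepSet N (search N B l d) l) l) (x := A)
    (fun m B => AgreeOffSelection A B ∧ B SEL = A SEL ∧
      (∀ v, B BSET v ≠ 0 → Selectable A l v) ∧
      ∃ best, (∀ v, B BEST v = best) ∧ best ≤ score N.graph (Frontier A l) (B BSET) ∧
        ∀ d : Fin n, d < m → (d + 1 : ℕ) * (Finset.univ.filter (Bucket N A l d)).card ≤
          (4 * (d + 1 : ℕ) - 3) * (2 * best))
    ⟨fun _ _ => rfl, rfl, fun v hv => absurd (hset v) hv, 0, hbest, Nat.zero_le _,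
      fun d hd => absurd hd (Nat.not_lt_zero _)⟩
    (by
      rintro d y ⟨h1, h2, h3, best, h4, h5, h6⟩
      obtain ⟨x, k1, k2, k3⟩ := search_spec (N := N) (A := y) l d
      rw [h1.selectable] at k2
      rw [h1.bucket, h1.frontier] at k3
      rw [k1]
      have hfr : Frontier (Function.update y CUR x) l = Frontier A l :=
        (h1.update (by decide) x).frontier l
      obtain ⟨σ, hσ⟩ : ∃ σ, σ = score N.graph (Frontier A l) x := ⟨_, rfl⟩
      have e1 : keepSet N (Function.update y CUR x) l = Function.update (Function.update y CUR x)
          BSET (if best < σ then x else y BSET) := by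
        unfold keepSet
        rw [hfr, Function.update_self, ← hσ]
        congr 1
        ext v
        rw [Function.update_of_ne (by decide), Function.update_of_ne (by decide), h4]
        split_ifs <;> rfl
      have hfr' : ∀ z, Frontier (Function.update (Function.update y CUR x) BSET z) l =
          Frontier A l := fun z =>
        ((h1.update (a := CUR) (by decide) x).update (a := BSET) (by decide) z).frontier l
      have e2 : keepScore N (keepSet N (Function.update y CUR x) l) l =
          Function.update (Function.update (Function.update y CUR x)
            BSET (if best < σ then x else y BSET)) BEST fun _ => max best σ := by
        rw [e1]
        unfold keepScore
        rw [hfr', Function.update_of_ne (show CUR ≠ BSET by decide), Function.update_self, ← hσ]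
        congr 1
        ext v
        rw [Function.update_of_ne (by decide), Function.update_of_ne (by decide), h4]
        split_ifs <;> omega
      rw [e2]
      refine ⟨((h1.update (by decide) _).update (by decide) _).update (by decide) _, ?_, ?_,
        max best σ, fun v => by rw [Function.update_self], ?_, fun d' hd' => ?_⟩
      · rw [Function.update_of_ne (by decide), Function.update_of_ne (by decide),
          Function.update_of_ne (by decide), h2]
      · rw [Function.update_of_ne (by decide), Function.update_self]
        split_ifs
        · exact k2
        · exact h3
      · rw [Function.update_of_ne (by decide), Function.update_self]
        split_ifs with h
        · rw [max_eq_right h.le, hσ]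
        · rw [max_eq_left (not_lt.1 h)]
          exact h5
      · rcases Nat.lt_succ_iff_lt_or_eq.1 hd' with h | h
        · exact (h6 d' h).trans
            (Nat.mul_le_mul_left _ (Nat.mul_le_mul_left _ (le_max_left _ _)))
        · obtain rfl := Fin.ext h
          rw [← hσ] at k3
          exact k3.trans (Nat.mul_le_mul_left _ (Nat.mul_le_mul_left _ (le_max_right _ _))))
  obtain ⟨h1, h2, h3, best, h4, h5, h6⟩ := key
  refine ⟨h1, h2, h3, (card_le_mul_of_buckets fun d hd hdn => ?_).trans
    (mul_le_mul_of_nonneg_left (Nat.cast_le.2 h5) (by positivity))⟩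
  rw [Fintype.card_fin] at hdn
  obtain ⟨d, rfl⟩ : ∃ d', d = d' + 1 := ⟨d - 1, by omega⟩
  convert h6 ⟨d, by omega⟩ hdn
  exact Iff.rfl

/-- The levels do not interfere: level `l` overwrites only its own entries of `SEL`, and the
auxiliary arrays are reset after each level. -/
theorem select_spec (hbest : ∀ v, A BEST v = 0) (hset : ∀ v, A BSET v = 0) :
    AgreeOffSelection A (select N A) ∧ (∀ v, select N A BEST v = 0) ∧
      (∀ v, select N A BSET v = 0) ∧ ∀ l, IsGoodSelection N A l (select N A SEL) := by
  have key := sweep_induction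
    (F := fun (l : Fin n) B => storeSelection (searchBuckets N B l) l) (x := A)
    (fun m B => AgreeOffSelection A B ∧ (∀ v, B BEST v = 0) ∧ (∀ v, B BSET v = 0) ∧
      ∀ l : Fin n, l < m → IsGoodSelection N A l (B SEL))
    ⟨fun _ _ => rfl, hbest, hset, fun d hd => absurd hd (Nat.not_lt_zero _)⟩
    (by
      rintro l y ⟨h1, h2, h3, h4⟩
      obtain ⟨k1, k2, k3, k4⟩ := searchBuckets_spec (N := N) (A := y) l h2 h3
      rw [h1.selectable] at k3 k4
      rw [h1.frontier] at k4
      obtain ⟨z, hz⟩ : ∃ z, z = searchBuckets N y l := ⟨_, rfl⟩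
      rw [← hz] at k1 k2 k3 k4 ⊢
      have hz1 : AgreeOffSelection A z := fun a ha => (k1 a ha).trans (h1 a ha)
      have hdist : z DIST = A DIST := hz1 _ (by decide)
      have hsel : storeSelection z l SEL = fun v => if A DIST v = l then z BSET v else y SEL v := by
        rw [storeSelection, Function.update_of_ne (by decide), Function.update_of_ne (by decide),
          Function.update_self, hdist, k2]
      refine ⟨((hz1.update (by decide) _).update (by decide) _).update (by decide) _, fun v => ?_,
        fun v => ?_, fun l' hl' => ?_⟩
      · rw [storeSelection, Function.update_self]
      · rw [storeSelection, Function.update_of_ne (by decide), Function.update_self]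
      · rw [hsel]
        rcases Nat.lt_succ_iff_lt_or_eq.1 hl' with h | h
        · obtain ⟨j1, j2⟩ := h4 l' h
          have hne : ∀ v, A DIST v = l' → A DIST v ≠ l := fun v hv => by omega
          refine ⟨fun v hv hs => j1 v hv ?_, j2.trans_eq ?_⟩
          · simpa only [if_neg (hne v hv)] using hs
          · congr 3
            ext v
            by_cases hv : A DIST v = l'
            · simp only [if_pos hv, if_neg (hne v hv)]
            · simp only [if_neg hv]
        · obtain rfl := Fin.ext h
          refine ⟨fun v hv hs => k3 v ?_, k4.trans_eq ?_⟩
          · simpa only [if_pos hv] using hs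
          · congr 3
            ext v
            split_ifs with i1
            · simp only [if_pos i1]
            · by_contra hn
              exact i1 (k3 v hn).2.2)
  obtain ⟨h1, h2, h3, h4⟩ := key
  exact ⟨h1, h2, h3, fun l => h4 l l.2⟩

end Selection

section Block

/-! ### The effect of a block -/

variable {n : ℕ} {N : Network n} {A B : Arrays n}

/-- With `u` the least node satisfying `p`, the summand is 1 exactly at the `u` smaller nodes. If
there is none, the sum is `n`, which is not the index of a node. -/
theorem first_index_spec (p : Fin n → Prop) :
    (∀ u : Fin n,
      (∑ u : Fin n, if ∀ u' : Fin n, (u' : ℕ) ≤ (u : ℕ) → ¬p u' then 1 else 0) = (u : ℕ) → p u) ∧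
    ((∃ u, p u) → ∃ u : Fin n,
      (∑ u : Fin n, if ∀ u' : Fin n, (u' : ℕ) ≤ (u : ℕ) → ¬p u' then 1 else 0) = (u : ℕ)) := by
  by_cases h : ∃ u, p u
  · obtain ⟨u, hu, hmin⟩ := Finset.exists_min_image (Finset.univ.filter p) id
      (by simpa [Finset.filter_nonempty_iff] using h)
    have hu : p u := (Finset.mem_filter.1 hu).2
    have hsum : (∑ u : Fin n, if ∀ u' : Fin n, (u' : ℕ) ≤ (u : ℕ) → ¬p u' then 1 else 0) =
        (u : ℕ) := by
      rw [← Finset.card_filter]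
      have := Fin.card_filter_val_lt (n := n) (m := u)
      rw [min_eq_right u.2.le] at this
      rw [← this]
      congr 1
      ext u'
      simp only [Finset.mem_filter, Finset.mem_univ, true_and]
      constructor
      · intro h'
        by_contra hle
        exact h' u (not_lt.1 hle) hu
      · intro hlt w hw hp
        have : (u : ℕ) ≤ w := hmin w (Finset.mem_filter.2 ⟨Finset.mem_univ _, hp⟩)
        omega
    rw [hsum]
    refine ⟨fun v hv => ?_, fun _ => ⟨u, rfl⟩⟩
    rwa [← Fin.ext hv]
  · refine ⟨fun u hu => ?_, fun h' => absurd h' h⟩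
    push Not at h
    have := u.2
    simp [h] at hu
    omega

/-- `u` is uninformed and receives the payload in the Broadcast step or in the Go step; `A` are the
arrays before the block, and `B` those after it. -/
def Receives (N : Network n) (A : Arrays n) (c : ℕ) (B : Arrays n) (u : Fin n) : Prop :=
  A INF u = 0 ∧ InClass A c u ∧ ((∃! w, N.graph.Adj u w ∧ B ACT w ≠ 0) ∨
    ∃! w, N.graph.Adj u w ∧ B ACT w ≠ 0 ∧ B SEL w ≠ 0)

/-- The effect of a block on the arrays `A`. -/
structure BlockSpec (N : Network n) (A : Arrays n) (c c' : ℕ) (B : Arrays n) : Prop where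
  dist : B DIST = A DIST
  length : B LEN = A LEN
  old : ∀ v, B OLD v = if A CNT v = 0 then A INF v else A OLD v
  counter : ∀ v, B CNT v = if A CNT v + 1 = A LEN v then 0 else A CNT v + 1
  act_subset : ∀ v, B ACT v ≠ 0 → A CAND v ≠ 0 ∧ InClass A c v
  act_first : ∀ v, A STARTED v = 0 → A CAND v ≠ 0 → InClass A c v → B ACT v ≠ 0
  act_dominates : ∀ v w, A CAND v ≠ 0 → InClass A c v → A INF w = 0 → A DIST w = A DIST v + 1 →
    N.graph.Adj v w → ∃ v', B ACT v' ≠ 0 ∧ A DIST v' = A DIST v ∧ N.graph.Adj v' w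
  act_irredundant : ∀ v, A STARTED v ≠ 0 → B ACT v ≠ 0 →
    ∃ w, A INF w = 0 ∧ A DIST w = A DIST v + 1 ∧ N.graph.Adj v w ∧
      ∀ v', B ACT v' ≠ 0 → A DIST v' = A DIST v → N.graph.Adj v' w → v' = v
  join : ∀ v, B JOIN v ≠ 0 ↔ A JOIN v ≠ 0 ∨ B ACT v ≠ 0
  stay : ∀ u, B STAY u ≠ 0 ↔ A STAY u ≠ 0 ∨ ∃ v, B ACT v ≠ 0 ∧ A FB v = (u : ℕ)
  go : ∀ u, B GO u ≠ 0 ↔ A GO u ≠ 0 ∨ ∃ v, B ACT v ≠ 0 ∧ B SEL v ≠ 0 ∧ B FB v = (u : ℕ)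
  fb_inactive : ∀ v, B ACT v = 0 → B FB v = A FB v
  fb_eligible : ∀ v (u : Fin n), B ACT v ≠ 0 → B FB v = (u : ℕ) → A INF u = 0 ∧
    A DIST u = A DIST v + 1 ∧ N.graph.Adj v u ∧ ∀ w, B ACT w ≠ 0 → N.graph.Adj w u → w = v
  fb_exists : ∀ v u, B ACT v ≠ 0 → A INF u = 0 → A DIST u = A DIST v + 1 → N.graph.Adj v u →
    (∀ w, B ACT w ≠ 0 → N.graph.Adj w u → w = v) → ∃ u : Fin n, B FB v = (u : ℕ)
  cand : ∀ v, B CAND v ≠ 0 ↔ Receives N A c' B v ∨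
    if InClass A c v then B ACT v ≠ 0 else A CAND v ≠ 0
  inf : ∀ v, B INF v ≠ 0 ↔ A INF v ≠ 0 ∨ Receives N A c' B v
  started : ∀ v, B STARTED v = 1
  best : ∀ v, B BEST v = 0
  bset : ∀ v, B BSET v = 0
  selection : ∃ C : Arrays n, C ACT = B ACT ∧ C OLD = B OLD ∧ C DIST = A DIST ∧ C INF = A INF ∧
    ∀ l, IsGoodSelection N C l (B SEL)

/-- Every stage of a block writes few arrays. The proof tracks which arrays are still those of the
start, and reads off each written array at the stage where it is written. -/
theorem block_spec (hbest : ∀ v, A BEST v = 0) (hset : ∀ v, A BSET v = 0) (c c' : ℕ) :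
    BlockSpec N A c c' (block N A c c') := by
  obtain ⟨P, hP⟩ : ∃ P, P = chooseActive N A c := ⟨_, rfl⟩
  have hinv := chooseActive_spec (N := N) (A := A) c
  rw [← hP] at hinv
  obtain ⟨A', hA'⟩ : ∃ A', A' = advanceCounter (saveInformed A) := ⟨_, rfl⟩
  have hPo : ∀ a ∉ [OLD, CNT, ACT], P a = A a := by
    intro a ha
    simp only [List.mem_cons, not_or] at ha
    obtain ⟨h1, h2, h3, -⟩ := ha
    rw [hinv.other a h3, advanceCounter, Function.update_of_ne h2, saveInformed,
      Function.update_of_ne h1]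
  obtain ⟨Q, hQ⟩ : ∃ Q, Q = chooseFeedback N (recordStay (recordJoin P)) := ⟨_, rfl⟩
  have hQo : ∀ a ∉ [JOIN, STAY, FB], Q a = P a := by
    intro a ha
    simp only [List.mem_cons, not_or] at ha
    obtain ⟨h1, h2, h3, -⟩ := ha
    rw [hQ, chooseFeedback, Function.update_of_ne h3, recordStay, Function.update_of_ne h2,
      recordJoin, Function.update_of_ne h1]
  obtain ⟨h1, h2, h3, h4⟩ := select_spec (N := N) (A := Q)
    (fun v => by rw [hQo _ (by decide), hPo _ (by decide), hbest])
    (fun v => by rw [hQo _ (by decide), hPo _ (by decide), hset])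
  obtain ⟨S, hS⟩ : ∃ S, S = select N Q := ⟨_, rfl⟩
  rw [← hS] at h1 h2 h3 h4
  obtain ⟨B, hB⟩ : ∃ B, B = block N A c c' := ⟨_, rfl⟩
  have hBS : B = Function.update (inform (updateCandidates (findNew N (recordGo S) c') c))
      STARTED fun _ => 1 := by
    rw [hB, hS, hQ, hP]
    rfl
  have hBo : ∀ a ∉ [GO, NEW, CAND, INF, STARTED], B a = S a := by
    intro a ha
    simp only [List.mem_cons, not_or] at ha
    obtain ⟨h1, h2, h3, h4, h5, -⟩ := ha
    rw [hBS, Function.update_of_ne h5, inform, Function.update_of_ne h4, updateCandidates,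
      Function.update_of_ne h3, findNew, Function.update_of_ne h2, recordGo,
      Function.update_of_ne h1]
  have hBP : ∀ a ∉ [JOIN, STAY, FB, SEL, CUR, BEST, BSET, GO, NEW, CAND, INF, STARTED],
      B a = P a := by
    intro a ha
    simp only [List.mem_cons, not_or] at ha
    rw [hBo a (by simp; tauto), h1 a (by simp; tauto), hQo a (by simp; tauto)]
  have hact : B ACT = P ACT := hBP _ (by decide)
  have hold : B OLD = fun v => if A CNT v = 0 then A INF v else A OLD v := by
    rw [hBP _ (by decide), hinv.other _ (by decide)]
    rfl
  have hcls : ∀ (C : Arrays n), C DIST = A DIST → ∀ c v, InClass C c v ↔ InClass A c v :=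
    fun C hC => inClass_congr hC
  have hSA : ∀ a ∉ [JOIN, STAY, FB, SEL, CUR, BEST, BSET, OLD, CNT, ACT], S a = A a := by
    intro a ha
    simp only [List.mem_cons, not_or] at ha
    rw [h1 a (by simp; tauto), hQo a (by simp; tauto), hPo a (by simp; tauto)]
  have hSB : ∀ a ∉ [GO, NEW, CAND, INF, STARTED], S a = B a := fun a ha => (hBo a ha).symm
  have hnew : ∀ v, B NEW v ≠ 0 ↔ Receives N A c' B v := by
    intro v
    have : B NEW v = if S INF v = 0 ∧ InClass S c' v ∧
        ((∃! w, N.graph.Adj v w ∧ S ACT w ≠ 0) ∨ ∃! w, N.graph.Adj v w ∧ S ACT w ≠ 0 ∧ S SEL w ≠ 0)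
        then 1 else 0 := by
      rw [hBS]
      rfl
    rw [this, hSA INF (by decide), hcls S (hSA _ (by decide)), hSB ACT (by decide),
      hSB SEL (by decide)]
    unfold Receives
    split_ifs with h <;> simp [h]
  have hcand : ∀ v, B CAND v = if B NEW v ≠ 0 then 1 else
      if InClass A c v then B ACT v else A CAND v := by
    intro v
    rw [← hSA CAND (by decide), ← hSB ACT (by decide),
      ← hcls (findNew N (recordGo S) c') (hSA DIST (by decide)), hBS]
    rfl
  have hinf : ∀ v, B INF v = if A INF v ≠ 0 ∨ B NEW v ≠ 0 then 1 else 0 := by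
    intro v
    rw [← hSA INF (by decide), hBS]
    rfl
  have hjoin : ∀ v, B JOIN v = if A JOIN v ≠ 0 ∨ B ACT v ≠ 0 then 1 else 0 := by
    intro v
    rw [hBo _ (by decide), h1 _ (by decide), ← hPo JOIN (by decide), hact, hQ]
    rfl
  have hstay : ∀ u, B STAY u = if A STAY u ≠ 0 ∨ ∃ v, B ACT v ≠ 0 ∧ A FB v = (u : ℕ)
      then 1 else 0 := by
    intro u
    rw [hBo _ (by decide), h1 _ (by decide), ← hPo STAY (by decide), hact, ← hPo FB (by decide), hQ]
    rfl
  have hgo : ∀ u, B GO u = if A GO u ≠ 0 ∨ ∃ v, B ACT v ≠ 0 ∧ B SEL v ≠ 0 ∧ B FB v = (u : ℕ)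
      then 1 else 0 := by
    intro u
    rw [← hSA GO (by decide), ← hSB ACT (by decide), ← hSB SEL (by decide), ← hSB FB (by decide),
      hBS]
    rfl
  have hel : ∀ v u, Eligible N (recordStay (recordJoin P)) v u ↔ A INF u = 0 ∧
      A DIST u = A DIST v + 1 ∧ N.graph.Adj v u ∧
        ∀ w, B ACT w ≠ 0 → N.graph.Adj w u → w = v := by
    intro v u
    rw [hact, ← hPo INF (by decide), ← hPo DIST (by decide)]
    exact Iff.rfl
  have hfb : ∀ v, B FB v = if B ACT v ≠ 0 then ∑ u : Fin n, if ∀ u' : Fin n, (u' : ℕ) ≤ (u : ℕ) →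
      ¬Eligible N (recordStay (recordJoin P)) v u' then 1 else 0 else A FB v := by
    intro v
    rw [hBo _ (by decide), h1 _ (by decide), hact, ← hPo FB (by decide), hQ]
    rfl
  rw [← hB]
  have hPDIST : advanceCounter (saveInformed A) DIST = A DIST := rfl
  exact {
    dist := by rw [hBP _ (by decide), hPo _ (by decide)]
    length := by rw [hBP _ (by decide), hPo _ (by decide)]
    old := fun v => by rw [hold]
    counter := fun v => by
      rw [hBP _ (by decide), hinv.other _ (by decide)]
      rfl
    act_subset := by
      rw [hact]
      exact fun v hv => (hinv.subset v hv)
    act_first := by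
      rw [hact]
      exact fun v => hinv.first v
    act_dominates := by
      rw [hact]
      exact fun v => hinv.dominates v
    act_irredundant := by
      rw [hact]
      exact fun v => hinv.irredundant v v.2
    join := fun v => by rw [hjoin]; split_ifs with h <;> simp [h]
    stay := fun v => by rw [hstay]; split_ifs with h <;> simp [h]
    go := fun v => by rw [hgo]; split_ifs with h <;> simp [h]
    fb_inactive := fun v hv => by rw [hfb, if_neg (not_not.2 hv)]
    fb_eligible := fun v u hv hu => by
      rw [hfb, if_pos hv] at hu
      exact (hel v u).1 ((first_index_spec _).1 u hu)
    fb_exists := fun v u hv h1 h2 h3 h4 => by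
      rw [hfb, if_pos hv]
      exact (first_index_spec _).2 ⟨u, (hel v u).2 ⟨h1, h2, h3, h4⟩⟩
    cand := fun v => by
      rw [hcand, ← hnew]
      by_cases h : B NEW v = 0
      · simp only [h, ne_eq, not_true_eq_false, if_false, false_or]
        split_ifs <;> rfl
      · simp [h]
    inf := fun v => by
      rw [hinf, ← hnew]
      split_ifs with h <;> simp [h]
    started := fun v => by rw [hBS]; rfl
    best := fun v => by rw [hBo _ (by decide), h2]
    bset := fun v => by rw [hBo _ (by decide), h3]
    selection := by
      -- `Q` is the memory on which the selection ran: the active set is already that of this block,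
      -- the informed nodes are still the old ones.
      refine ⟨Q, ?_, ?_, ?_, ?_, fun l => ?_⟩
      · rw [hact, hQo _ (by decide)]
      · rw [hBP _ (by decide), hQo _ (by decide)]
      · rw [hQo _ (by decide), hPo _ (by decide)]
      · rw [hQo _ (by decide), hPo _ (by decide)]
      · rw [hBo _ (by decide)]
        exact h4 l }

end Block

/-! ### The schedule of the construction -/

section Schedule

variable {n : ℕ} (N : Network n)

/-- the arrays at the beginning of block `r` -/
noncomputable def state : ℕ → Arrays n
  | 0 => prepare N fun _ _ => 0
  | r + 1 => block N (state r) (r % 3) ((r + 1) % 3)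

/-- The arrays for transmitters, feedback and selection are written during block r, hence the index
shift against the informed nodes. -/
noncomputable def schedule : Schedule (Fin n) where
  inf r := {v | state N r INF v ≠ 0}
  act r := {v | state N (r + 1) ACT v ≠ 0}
  fb r v := if h : state N (r + 1) ACT v ≠ 0 ∧ state N (r + 1) FB v < n then
    some ⟨state N (r + 1) FB v, h.2⟩ else none
  sel r := {v | state N (r + 1) SEL v ≠ 0}

variable {N}

theorem fb_eq_some_iff {r : ℕ} {v u : Fin n} : (schedule N).fb r v = some u ↔
    state N (r + 1) ACT v ≠ 0 ∧ state N (r + 1) FB v = (u : ℕ) := by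
  simp only [schedule]
  split_ifs with h
  · rw [Option.some_inj, Fin.ext_iff]
    exact ⟨fun h' => ⟨h.1, h'⟩, fun h' => h'.2⟩
  · refine ⟨fun h' => absurd h' (by simp), fun h' => absurd ⟨h'.1, ?_⟩ h⟩
    rw [h'.2]
    exact u.2

variable (hN : N.graph.Connected)

include hN

theorem state_succ_spec (r : ℕ) :
    BlockSpec N (state N r) (r % 3) ((r + 1) % 3) (state N (r + 1)) := by
  induction r with
  | zero =>
    obtain ⟨-, -, -, -, -, h⟩ := prepare_spec hN (A := fun _ _ => 0) fun _ _ => rfl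
    exact block_spec (h BEST (by decide)) (h BSET (by decide)) _ _
  | succ r ih => exact block_spec ih.best ih.bset _ _

theorem state_dist (r : ℕ) (v : Fin n) : state N r DIST v = N.graph.dist N.source v := by
  induction r with
  | zero => exact (prepare_spec hN fun _ _ => rfl).1 v
  | succ r ih => rw [(state_succ_spec hN r).dist, ih]

theorem state_length (r : ℕ) (v : Fin n) : state N r LEN v = stageLength n := by
  induction r with
  | zero => exact (prepare_spec hN fun _ _ => rfl).2.1 v
  | succ r ih => rw [(state_succ_spec hN r).length, ih]

theorem state_inClass_iff (r : ℕ) {c : ℕ} (hc : c < 3) (v : Fin n) :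
    InClass (state N r) c v ↔ N.graph.dist N.source v % 3 = c :=
  inClass_iff hN (state_dist hN r) hc v

theorem state_zero_inf (v : Fin n) : state N 0 INF v ≠ 0 ↔ v = N.source :=
  (prepare_spec hN fun _ _ => rfl).2.2.1 v

theorem state_zero_cand (v : Fin n) : state N 0 CAND v ≠ 0 ↔ v = N.source :=
  (prepare_spec hN fun _ _ => rfl).2.2.2.1 v

theorem state_zero_fb (v : Fin n) : state N 0 FB v = n :=
  (prepare_spec hN fun _ _ => rfl).2.2.2.2.1 v

theorem state_zero_other {a : ℕ} (ha : a ∉ [DIST, BALL, POW, CLOG, LEN, INF, CAND, FB])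
    (v : Fin n) : state N 0 a v = 0 :=
  (prepare_spec hN fun _ _ => rfl).2.2.2.2.2 a ha v

theorem receives_iff (r : ℕ) (u : Fin n) :
    Receives N (state N r) ((r + 1) % 3) (state N (r + 1)) u ↔
      u ∉ (schedule N).inf r ∧ N.graph.dist N.source u % 3 = (r + 1) % 3 ∧
        ((∃! w, N.graph.Adj u w ∧ w ∈ (schedule N).act r) ∨
          ∃! w, N.graph.Adj u w ∧ w ∈ (schedule N).act r ∧ w ∈ (schedule N).sel r) := by
  unfold Receives
  rw [state_inClass_iff hN r (Nat.mod_lt _ three_pos)]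
  exact and_congr_left' not_not.symm

theorem mem_inf_succ_iff (r : ℕ) (u : Fin n) : u ∈ (schedule N).inf (r + 1) ↔
    u ∈ (schedule N).inf r ∨ Receives N (state N r) ((r + 1) % 3) (state N (r + 1)) u :=
  (state_succ_spec hN r).inf u

theorem cand_succ_iff (r : ℕ) (v : Fin n) : state N (r + 1) CAND v ≠ 0 ↔
    Receives N (state N r) ((r + 1) % 3) (state N (r + 1)) v ∨
      if N.graph.dist N.source v % 3 = r % 3 then v ∈ (schedule N).act r
      else state N r CAND v ≠ 0 := by
  rw [(state_succ_spec hN r).cand]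
  simp only [state_inClass_iff hN r (Nat.mod_lt _ three_pos)]
  exact Iff.rfl

theorem mem_cand_of_mem_act {r : ℕ} {v : Fin n} (hv : v ∈ (schedule N).act r) :
    state N r CAND v ≠ 0 ∧ N.graph.dist N.source v % 3 = r % 3 := by
  have := (state_succ_spec hN r).act_subset v hv
  rwa [state_inClass_iff hN r (Nat.mod_lt _ three_pos)] at this

theorem mem_inf_of_mem_cand (r : ℕ) (v : Fin n) (hv : state N r CAND v ≠ 0) :
    v ∈ (schedule N).inf r := by
  induction r with
  | zero => exact (state_zero_inf hN v).2 ((state_zero_cand hN v).1 hv)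
  | succ r ih =>
    rw [mem_inf_succ_iff hN]
    rcases (cand_succ_iff hN r v).1 hv with h | h
    · exact Or.inr h
    · left
      split_ifs at h
      · exact ih (mem_cand_of_mem_act hN h).1
      · exact ih h

/-- The candidates dominate the uninformed nodes that have an informed neighbour on the previous
level. -/
theorem exists_cand (r : ℕ) (v w : Fin n) (hv : v ∈ (schedule N).inf r)
    (hw : w ∉ (schedule N).inf r) (hvw : N.graph.Adj v w)
    (hd : N.graph.dist N.source w = N.graph.dist N.source v + 1) :
    ∃ v', state N r CAND v' ≠ 0 ∧ N.graph.dist N.source v' = N.graph.dist N.source v ∧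
      N.graph.Adj v' w := by
  induction r generalizing v with
  | zero => exact ⟨v, (state_zero_cand hN v).2 ((state_zero_inf hN v).1 hv), rfl, hvw⟩
  | succ r ih =>
    have hw' : w ∉ (schedule N).inf r := fun h => hw ((mem_inf_succ_iff hN r w).2 (Or.inl h))
    rcases (mem_inf_succ_iff hN r v).1 hv with h | h
    · obtain ⟨v', h1, h2, h3⟩ := ih v h hw' hvw hd
      by_cases hc : N.graph.dist N.source v % 3 = r % 3
      · obtain ⟨v'', k1, k2, k3⟩ := (state_succ_spec hN r).act_dominates v' w h1
          ((state_inClass_iff hN r (Nat.mod_lt _ three_pos) v').2 (by omega)) (not_not.1 hw')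
          (by rw [state_dist hN, state_dist hN]; omega) h3
        rw [state_dist hN, state_dist hN] at k2
        refine ⟨v'', (cand_succ_iff hN r v'').2 (Or.inr ?_), by omega, k3⟩
        rw [if_pos (by omega)]
        exact k1
      · refine ⟨v', (cand_succ_iff hN r v').2 (Or.inr ?_), h2, h3⟩
        rwa [if_neg (by omega)]
    · exact ⟨v, (cand_succ_iff hN r v).2 (Or.inl h), rfl, hvw⟩

theorem exists_act (r : ℕ) (v w : Fin n) (hv : v ∈ (schedule N).inf r)
    (hw : w ∉ (schedule N).inf r) (hvw : N.graph.Adj v w)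
    (hd : N.graph.dist N.source w = N.graph.dist N.source v + 1)
    (hr : N.graph.dist N.source v % 3 = r % 3) :
    ∃ v' ∈ (schedule N).act r, N.graph.dist N.source v' = N.graph.dist N.source v ∧
      N.graph.Adj v' w := by
  obtain ⟨v', h1, h2, h3⟩ := exists_cand hN r v w hv hw hvw hd
  obtain ⟨v'', k1, k2, k3⟩ := (state_succ_spec hN r).act_dominates v' w h1
    ((state_inClass_iff hN r (Nat.mod_lt _ three_pos) v').2 (by omega)) (not_not.1 hw)
    (by rw [state_dist hN, state_dist hN]; omega) h3
  rw [state_dist hN, state_dist hN] at k2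
  exact ⟨v'', k1, by omega, k3⟩

theorem state_started {r : ℕ} (hr : 1 ≤ r) (v : Fin n) : state N r STARTED v = 1 := by
  obtain ⟨r, rfl⟩ : ∃ r', r = r' + 1 := ⟨r - 1, by omega⟩
  exact (state_succ_spec hN r).started v

/-- Follow the candidate mark backwards. It can be set anew only when the node is informed, which is
excluded in block r + 2 by hypothesis and in blocks r + 1 and r by the residue; so it stems from
being active in block r. -/
theorem mem_act_of_mem_act_add_three {r : ℕ} {v : Fin n} (hv : v ∈ (schedule N).act (r + 3))
    (hv' : v ∈ (schedule N).inf (r + 2)) : v ∈ (schedule N).act r := by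
  obtain ⟨h3, hd⟩ := mem_cand_of_mem_act hN hv
  have h2 : state N (r + 2) CAND v ≠ 0 := by
    rcases (cand_succ_iff hN (r + 2) v).1 h3 with h | h
    · exact absurd hv' ((receives_iff hN _ _).1 h).1
    · rwa [if_neg (by omega)] at h
  have h1 : state N (r + 1) CAND v ≠ 0 := by
    rcases (cand_succ_iff hN (r + 1) v).1 h2 with h | h
    · have := ((receives_iff hN _ _).1 h).2.1
      omega
    · rwa [if_neg (by omega)] at h
  rcases (cand_succ_iff hN r v).1 h1 with h | h
  · have := ((receives_iff hN _ _).1 h).2.1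
    omega
  · rwa [if_pos (by omega)] at h

theorem state_counter (r : ℕ) (v : Fin n) : state N r CNT v = r % stageLength n := by
  induction r with
  | zero => rw [state_zero_other hN (by decide), Nat.zero_mod]
  | succ r ih =>
    rw [(state_succ_spec hN r).counter, ih, state_length hN]
    rw [Nat.add_mod r 1]
    -- For n = 1 a stage has length 0. The counter is never reset, in accordance with `r % 0 = r`,
    -- and the only stage starts with block 0.
    rcases Nat.eq_zero_or_pos (stageLength n) with h | h
    · simp [h]
    · have hlt := Nat.mod_lt r h
      rcases Nat.lt_or_ge 1 (stageLength n) with h1 | h1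
      · rw [Nat.mod_eq_of_lt h1]
        split_ifs with h'
        · rw [h', Nat.mod_self]
        · exact (Nat.mod_eq_of_lt (by omega)).symm
      · have : stageLength n = 1 := by omega
        simp [this, Nat.mod_one]

theorem mem_old_iff (r : ℕ) (v : Fin n) :
    state N (r + 1) OLD v ≠ 0 ↔ v ∈ (schedule N).inf (stageStart n r) := by
  induction r with
  | zero =>
    rw [(state_succ_spec hN 0).old, state_counter hN, Nat.zero_mod, if_pos rfl]
    simp [stageStart, schedule]
  | succ r ih =>
    rw [(state_succ_spec hN (r + 1)).old, state_counter hN]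
    split_ifs with h
    · have : stageStart n (r + 1) = r + 1 := Nat.mul_div_cancel' (Nat.dvd_of_mod_eq_zero h)
      rw [this]
      exact Iff.rfl
    · have : stageStart n (r + 1) = stageStart n r := by
        unfold stageStart
        rw [Nat.succ_div_of_not_dvd fun h' => h (Nat.mod_eq_zero_of_dvd h')]
      rw [ih, this]

theorem informs_iff (r : ℕ) (v u : Fin n) :
    (schedule N).Informs N.graph N.source r v u ↔ state N (r + 1) ACT v ≠ 0 ∧
      state N r INF u = 0 ∧ state N r DIST u = state N r DIST v + 1 ∧ N.graph.Adj v u ∧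
        ∀ w, state N (r + 1) ACT w ≠ 0 → N.graph.Adj w u → w = v := by
  rw [state_dist hN, state_dist hN]
  exact and_congr_right' (and_congr_left' not_not)

theorem exists_isSelection (r l : ℕ) : ∃ B',
    IsSelection N.graph ((schedule N).selectable N.graph N.source l r)
      {w ∈ level N.graph N.source (l + 1) \ (schedule N).inf r |
        ∃ u ∈ (schedule N).selectable N.graph N.source l r, N.graph.Adj u w}
      ((schedule N).sel r ∩ level N.graph N.source l) B' := by
  obtain ⟨C, hact, hold, hdist, hinf, hsel⟩ := (state_succ_spec hN r).selection
  by_cases hl : l < n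
  swap
  -- The arrays treat only levels below n; all others are empty.
  · have hempty : level N.graph N.source l = ∅ := by
      refine Set.eq_empty_of_forall_notMem fun v hv => hl ?_
      have hv : N.graph.dist N.source v = l := hv
      have := hN.dist_lt_card N.source v
      rwa [Fintype.card_fin, hv] at this
    have hsel' : (schedule N).selectable N.graph N.source l r = ∅ := by
      rw [Schedule.selectable, hempty, Set.inter_empty]
    refine ⟨∅, ?_, Set.empty_subset _, fun b hb => absurd hb (Set.notMem_empty b), ?_⟩
    · rw [hempty, Set.inter_empty]
      exact Set.empty_subset _
    · simp [hsel']
  obtain ⟨h1, h2⟩ := hsel ⟨l, hl⟩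
  set P := Selectable C ⟨l, hl⟩ with hP
  set F := Frontier C ⟨l, hl⟩ with hF
  set x : Fin n → ℕ := fun v => if C DIST v = l then state N (r + 1) SEL v else 0 with hx
  have hCd : ∀ v, C DIST v = N.graph.dist N.source v := fun v => by rw [hdist, state_dist hN]
  have hPset : (schedule N).selectable N.graph N.source l r = {v | P v} := by
    ext v
    have h3 : state N (r + 1) OLD v ≠ 0 ↔
        v ∈ (schedule N).inf (stageStart (Nat.card (Fin n)) r) := by
      rw [Nat.card_eq_fintype_card, Fintype.card_fin]
      exact mem_old_iff hN r v
    simp only [Schedule.selectable, Set.mem_inter_iff, ← h3, hP, Selectable, hact, hold, hCd,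
      Set.mem_ofPred_eq]
    simp only [schedule, level, Set.mem_ofPred_eq]
    tauto
  have hFset : ∀ w, w ∈ level N.graph N.source (l + 1) \ (schedule N).inf r ↔ F w := by
    intro w
    simp only [hF, Frontier, hinf, hCd]
    simp only [schedule, level, Set.mem_sdiff, Set.mem_ofPred_eq, not_not]
    tauto
  have hxset : (schedule N).sel r ∩ level N.graph N.source l = {v | x v ≠ 0} := by
    ext v
    simp only [hx, hCd]
    simp only [schedule, level, Set.mem_inter_iff, Set.mem_ofPred_eq]
    split_ifs with h <;> simp [h]
  have hxP : ∀ v, x v ≠ 0 → P v := by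
    intro v hv
    simp only [hx] at hv
    split_ifs at hv with h
    · exact h1 v h hv
    · exact absurd rfl hv
  have hB : {w ∈ level N.graph N.source (l + 1) \ (schedule N).inf r |
      ∃ u ∈ (schedule N).selectable N.graph N.source l r, N.graph.Adj u w} =
      {b | F b ∧ 0 < degreeIn N.graph P b} := by
    ext w
    rw [Set.mem_ofPred_eq, hFset, hPset, Set.mem_ofPred_eq]
    refine and_congr_right' ?_
    rw [degreeIn, ← Finset.card_filter, Finset.card_pos, Finset.filter_nonempty_iff]
    simp
  have hcover : ∀ b, cover N.graph x b = 1 → ∃! a, x a ≠ 0 ∧ N.graph.Adj a b := by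
    intro b hb
    rw [cover, ← Finset.card_filter, Finset.card_eq_one] at hb
    obtain ⟨a, ha⟩ := hb
    have : ∀ a', (x a' ≠ 0 ∧ N.graph.Adj a' b) ↔ a' = a := by
      intro a'
      rw [← Finset.mem_singleton, ← ha]
      simp
    exact ⟨a, (this a).2 rfl, fun a' => (this a').1⟩
  rw [hB, hxset, hPset]
  -- B' consists of the frontier nodes counted by the score.
  refine ⟨{b | F b ∧ cover N.graph x b = 1}, fun v hv => hxP v hv, ?_, ?_, ?_⟩
  · rintro b ⟨hb, hc⟩
    refine ⟨hb, ?_⟩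
    obtain ⟨a, ⟨ha, hab⟩, -⟩ := hcover b hc
    rw [degreeIn, ← Finset.card_filter, Finset.card_pos, Finset.filter_nonempty_iff]
    exact ⟨a, Finset.mem_univ _, hxP a ha, hab⟩
  · rintro b ⟨-, hc⟩
    exact hcover b hc
  · have hncard : ∀ p : Fin n → Prop, {v | p v}.ncard = (Finset.univ.filter p).card := by
      intro p
      rw [← Set.ncard_coe_finset]
      simp
    rw [hncard, hncard, hncard]
    have hs : score N.graph F x = (Finset.univ.filter fun b => F b ∧ cover N.graph x b = 1).card :=
      (Finset.card_filter _ _).symm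
    rw [hs] at h2
    convert h2

theorem schedule_isValid : (schedule N).IsValid N.graph N.source where
  inf_zero := Set.ext fun v => state_zero_inf hN v
  act_zero := by
    ext v
    refine ⟨fun hv => (state_zero_cand hN v).1 (mem_cand_of_mem_act hN hv).1, fun hv => ?_⟩
    -- Pruning is switched off in block 0, so the source transmits even if it has no neighbour.
    obtain rfl : v = N.source := hv
    exact (state_succ_spec hN 0).act_first _ (state_zero_other hN (by decide) _)
      ((state_zero_cand hN _).2 rfl) ((state_inClass_iff hN 0 (by omega) _).2 (by simp))
  mem_inf_succ r u := by
    rw [mem_inf_succ_iff hN, receives_iff hN]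
    tauto
  act_subset r v hv := mem_inf_of_mem_cand hN r v (mem_cand_of_mem_act hN hv).1
  act_level r v hv := (mem_cand_of_mem_act hN hv).2
  act_minimal r l hr hl := by
    refine DominatesFrontier.minimal ⟨?_, ?_⟩ ?_
    · rintro v ⟨hv, hv'⟩
      exact ⟨mem_inf_of_mem_cand hN r v (mem_cand_of_mem_act hN hv).1, hv'⟩
    · rintro w ⟨hw, hw'⟩ ⟨v, ⟨hv, hvl⟩, hvw⟩
      have hw : N.graph.dist N.source w = l + 1 := hw
      have hvl : N.graph.dist N.source v = l := hvl
      obtain ⟨v', h1, h2, h3⟩ := exists_act hN r v w hv hw' hvw (by omega) (by omega)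
      exact ⟨v', ⟨h1, h2.trans hvl⟩, h3⟩
    · rintro v ⟨hv, hvl⟩
      have hvl : N.graph.dist N.source v = l := hvl
      obtain ⟨w, h1, h2, h3, h4⟩ := (state_succ_spec hN r).act_irredundant v
        (by rw [state_started hN hr]; exact one_ne_zero) hv
      simp only [state_dist hN] at h2 h4
      refine ⟨w, ⟨h2.trans (by rw [hvl]), not_not.2 h1⟩, h3, ?_⟩
      rintro v' ⟨hv', hvl'⟩ hvw
      exact h4 v' hv' (hvl'.trans hvl.symm) hvw
  act_old r v hv hv' := mem_act_of_mem_act_add_three hN hv hv'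
  fb_informs r v u h := by
    obtain ⟨h1, h2⟩ := fb_eq_some_iff.1 h
    exact (informs_iff hN r v u).2 ⟨h1, (state_succ_spec hN r).fb_eligible v u h1 h2⟩
  fb_exists r v h := by
    obtain ⟨u, hu⟩ := h
    obtain ⟨h1, h2, h3, h4, h5⟩ := (informs_iff hN r v u).1 hu
    obtain ⟨u', hu'⟩ := (state_succ_spec hN r).fb_exists v u h1 h2 h3 h4 h5
    exact ⟨u', fb_eq_some_iff.2 ⟨h1, hu'⟩⟩
  selection r l _ := exists_isSelection hN r l

end Schedule

/-! ### The labels -/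

section Labels

variable {n : ℕ} {N : Network n} (hN : N.graph.Connected)

include hN

theorem state_join_iff (r : ℕ) (v : Fin n) :
    state N r JOIN v ≠ 0 ↔ ∃ r' < r, v ∈ (schedule N).act r' := by
  induction r with
  | zero =>
    rw [state_zero_other hN (by decide)]
    simp
  | succ r ih =>
    rw [(state_succ_spec hN r).join, ih, Nat.exists_lt_succ_right]
    rfl

theorem state_go_iff (r : ℕ) (u : Fin n) : state N r GO u ≠ 0 ↔
    ∃ r' < r, ∃ v, (schedule N).fb r' v = some u ∧ v ∈ (schedule N).sel r' := by
  induction r with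
  | zero =>
    rw [state_zero_other hN (by decide)]
    simp
  | succ r ih =>
    rw [(state_succ_spec hN r).go, ih, Nat.exists_lt_succ_right]
    refine or_congr_right (exists_congr fun v => ?_)
    rw [fb_eq_some_iff]
    exact ⟨fun ⟨h1, h2, h3⟩ => ⟨⟨h1, h3⟩, h2⟩, fun ⟨⟨h1, h3⟩, h2⟩ => ⟨h1, h2, h3⟩⟩

theorem state_fb_eq_of_lt {r : ℕ} {v : Fin n} (h : state N r FB v < n) :
    ∃ r' < r, v ∈ (schedule N).act r' := by
  induction r with
  | zero =>
    rw [state_zero_fb hN] at h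
    exact absurd h (lt_irrefl n)
  | succ r ih =>
    by_cases hv : state N (r + 1) ACT v = 0
    · rw [(state_succ_spec hN r).fb_inactive v hv] at h
      obtain ⟨r', h1, h2⟩ := ih h
      exact ⟨r', by omega, h2⟩
    · exact ⟨r, Nat.lt_succ_self r, hv⟩

/-- A feedback entry is rewritten only when its node is active, and the level of `v` is not due in
blocks r + 1 and r + 2. -/
theorem state_fb_add_three {r : ℕ} {v : Fin n} (hd : N.graph.dist N.source v % 3 = r % 3) :
    state N (r + 3) FB v = state N (r + 1) FB v := by
  have h : ∀ r', N.graph.dist N.source v % 3 ≠ r' % 3 → state N (r' + 1) FB v = state N r' FB v :=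
    fun r' hr' => (state_succ_spec hN r').fb_inactive v
      (not_not.1 fun hn => hr' (mem_cand_of_mem_act hN hn).2)
  rw [h (r + 2) (by omega), h (r + 1) (by omega)]

/-- An entry below `n` shows that `v` has been active before. By `act_old` it was then active at its
previous turn r - 3, and the entry is the choice made in that block. -/
theorem feedback_of_active {r : ℕ} {v u : Fin n} (hv : v ∈ (schedule N).act r)
    (hu : state N r FB v = (u : ℕ)) : ∃ r', r = r' + 3 ∧ (schedule N).fb r' v = some u := by
  have hvalid := schedule_isValid hN
  obtain ⟨r₁, hlt, hact⟩ := state_fb_eq_of_lt hN (hu ▸ u.2 : state N r FB v < n)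
  have hd := hvalid.act_level r v hv
  have hd₁ := hvalid.act_level r₁ v hact
  obtain ⟨r', rfl⟩ : ∃ r', r = r' + 3 := ⟨r - 3, by omega⟩
  have hact' := hvalid.act_old r' v hv (hvalid.inf_mono (by omega) (hvalid.act_subset r₁ hact))
  refine ⟨r', rfl, fb_eq_some_iff.2 ⟨hact', ?_⟩⟩
  rw [← hu, state_fb_add_three hN (by omega)]

theorem state_stay_iff (r : ℕ) (u : Fin n) : state N r STAY u ≠ 0 ↔
    ∃ r', r' + 3 < r ∧ ∃ v, (schedule N).fb r' v = some u ∧ v ∈ (schedule N).act (r' + 3) := by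
  induction r with
  | zero =>
    rw [state_zero_other hN (by decide)]
    simp
  | succ r ih =>
    rw [(state_succ_spec hN r).stay, ih]
    constructor
    · rintro (⟨r', h1, h2⟩ | ⟨v, h1, h2⟩)
      · exact ⟨r', by omega, h2⟩
      · obtain ⟨r', rfl, h3⟩ := feedback_of_active hN h1 h2
        exact ⟨r', Nat.lt_succ_self _, v, h3, h1⟩
    · rintro ⟨r', h1, v, h2, h3⟩
      rcases Nat.lt_succ_iff_lt_or_eq.1 h1 with h | h
      · exact Or.inl ⟨r', h, v, h2, h3⟩
      · subst h
        refine Or.inr ⟨v, h3, ?_⟩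
        have hd := (schedule_isValid hN).act_level _ v h3
        rw [state_fb_add_three hN (by omega)]
        exact (fb_eq_some_iff.1 h2).2

omit hN in
theorem labels_eq_output : labels N (fun _ _ => 0) = output (state N (3 * n)) := by
  have := sweep_induction (F := fun (_ : Fin n) B => block N (block N (block N B 0 1) 1 2) 2 0)
    (x := prepare N fun _ _ => 0) (fun m B => B = state N (3 * m)) rfl (by
      rintro m B rfl
      rw [show 3 * ((m : ℕ) + 1) = 3 * m + 1 + 1 + 1 by ring, state, state, state,
        show 3 * (m : ℕ) % 3 = 0 by omega, show (3 * (m : ℕ) + 1) % 3 = 1 by omega,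
        show (3 * (m : ℕ) + 1 + 1) % 3 = 2 by omega,
        show (3 * (m : ℕ) + 1 + 1 + 1) % 3 = 0 by omega])
  rw [labels, this]

/-- the labels as binary strings -/
noncomputable def labelOf (N : Network n) (v : Fin n) : List Bool :=
  [decide (state N (3 * n) JOIN v ≠ 0), decide (N.graph.dist N.source v % 3 = 2),
    decide (N.graph.dist N.source v % 3 = 1), decide (state N (3 * n) STAY v ≠ 0),
    decide (state N (3 * n) GO v ≠ 0)]

/-- The labels quantify over all blocks while the program simulates 3n of them; nobody is active
afterwards, so nothing is missed. -/
theorem labelOf_isLabels : (schedule N).Labels N.graph N.source (labelOf N) := by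
  have hvalid := schedule_isValid hN
  have hempty : ∀ r v, v ∈ (schedule N).act r → r < 3 * n := fun r v hv => by
    by_contra hr
    exact hvalid.act_eq_empty hN (by rw [Fintype.card_fin]; omega) v hv
  have hjoin : ∀ v, state N (3 * n) JOIN v ≠ 0 ↔ ∃ r, v ∈ (schedule N).act r := fun v => by
    rw [state_join_iff hN]
    exact ⟨fun ⟨r, _, h⟩ => ⟨r, h⟩, fun ⟨r, h⟩ => ⟨r, hempty r v h, h⟩⟩
  have hstay : ∀ u, state N (3 * n) STAY u ≠ 0 ↔ ∃ r v, (schedule N).fb r v = some u ∧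
      v ∈ (schedule N).act (r + 3) := fun u => by
    rw [state_stay_iff hN]
    exact ⟨fun ⟨r, _, h⟩ => ⟨r, h⟩, fun ⟨r, v, h⟩ => ⟨r, hempty (r + 3) v h.2, v, h⟩⟩
  have hgo : ∀ u, state N (3 * n) GO u ≠ 0 ↔ ∃ r v, (schedule N).fb r v = some u ∧
      v ∈ (schedule N).sel r := fun u => by
    rw [state_go_iff hN]
    exact ⟨fun ⟨r, _, h⟩ => ⟨r, h⟩,
      fun ⟨r, v, h⟩ => ⟨r, hempty r v (hvalid.fb_informs r v u h.1).1, v, h⟩⟩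
  -- The source is informed from the outset, so it is never a feedback node and its Stay and Go bits
  -- are 0.
  have hsource : ∀ r v, (schedule N).fb r v ≠ some N.source := fun r v h =>
    (hvalid.fb_informs r v _ h).2.1 (hvalid.source_mem_inf r)
  refine ⟨fun v => rfl, fun v => ?_, ?_, fun v => ?_, fun u => ?_, fun u => ?_⟩
  · have : N.graph.dist N.source v % 3 = 0 ∨ N.graph.dist N.source v % 3 = 1 ∨
        N.graph.dist N.source v % 3 = 2 := by omega
    rcases this with h | h | h <;> simp [labelOf, lev, h]
  · have h1 := (hjoin N.source).2 ⟨0, by rw [hvalid.act_zero]; rfl⟩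
    have h2 := mt (hstay N.source).1 fun ⟨r, v, h, _⟩ => hsource r v h
    have h3 := mt (hgo N.source).1 fun ⟨r, v, h, _⟩ => hsource r v h
    simp only [labelOf, h2, h3, SimpleGraph.dist_self]
    simpa using h1
  · rw [← hjoin]
    simp [labelOf, joinBit]
  · rw [← hstay]
    simp [labelOf, stayBit]
  · rw [← hgo]
    simp [labelOf, goBit]

theorem output_eq_labelOf (v : Fin n) (j : ℕ) (hj : j < (labelOf N v).length) :
    labels N (fun _ _ => 0) (OUT₀ + j) v = ((labelOf N v)[j]).toNat := by
  rw [labels_eq_output]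
  have hcls : ∀ c < 3, (InClass (state N (3 * n)) c v ↔ N.graph.dist N.source v % 3 = c) :=
    fun c hc => state_inClass_iff hN _ hc v
  have hj' : j < 5 := hj
  have hbit : ∀ (p : Prop) [Decidable p] (q : Prop) [Decidable q], (p ↔ q) →
      (if p then 1 else 0) = (decide q).toNat := fun p _ q _ hpq => by
    by_cases hq : q <;> simp [hpq, hq]
  obtain ⟨B, hB⟩ : ∃ B, B = state N (3 * n) := ⟨_, rfl⟩
  simp only [labelOf, ← hB] at hcls ⊢
  interval_cases j
  · exact hbit (B JOIN v ≠ 0) (B JOIN v ≠ 0) Iff.rfl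
  · exact hbit _ (N.graph.dist N.source v % 3 = 2)
      (hcls 2 (by omega))
  · exact hbit _ (N.graph.dist N.source v % 3 = 1)
      (hcls 1 (by omega))
  · exact hbit (B STAY v ≠ 0) (B STAY v ≠ 0) Iff.rfl
  · exact hbit (B GO v ≠ 0) (B GO v ≠ 0) Iff.rfl

end Labels

theorem exists_construction : ∃ (P : Program) (p : Polynomial ℕ),
    ∀ (n : ℕ) (G : SimpleGraph (Fin n)) (s : Fin n), G.Connected →
      ∃ (ℓ : Fin n → List Bool) (t : ℕ) (τ : Memory), IsLabeling G s ℓ ∧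
        Exec P (input G s) t τ ∧ t ≤ p.eval n ∧ HoldsLabels 5 τ ℓ := by
  obtain ⟨P, p, hP⟩ := (transforms_labels (k := 0)).exists_program fun j => OUT₀ + j
  refine ⟨P, p, fun n G s hG => ?_⟩
  obtain ⟨t, τ, h1, h2, h3⟩ := hP n ⟨G, s⟩
  have hN : (⟨G, s⟩ : Network n).graph.Connected := hG
  exact ⟨labelOf ⟨G, s⟩, t, τ, ⟨_, (schedule_isValid hN).isLabelingWith (labelOf_isLabels hN)⟩,
    h1, h2, fun v => ⟨rfl, fun j hj => (h3 v j hj).trans (output_eq_labelOf hN v j hj)⟩⟩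

end LevelledExecutor.Construction

theorem corollary4p3 :
    -- with every labeling produced by the scheme (all labels have 5 bits), the algorithm
    -- accomplishes broadcast in O(D log² n) rounds
    (∃ C : ℝ, ∀ (V : Type*) [Fintype V] (G : SimpleGraph V) (s : V) (ℓ : V → List Bool),
      G.Connected → LevelledExecutor.IsLabeling G s ℓ →
        (∀ v, (ℓ v).length = 5) ∧
        ∃ R : ℕ, (R : ℝ) ≤ C * G.diam * Real.logb 2 (Fintype.card V) ^ 2 ∧
          ∀ (M : Type*) (m : M),
            (LevelledExecutor.algorithm M).BroadcastsIn G s ℓ m R) ∧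
    -- a single program constructs such a labeling of every network in polynomial time
    (∃ (P : RAM.Program) (p : Polynomial ℕ),
      ∀ (n : ℕ) (G : SimpleGraph (Fin n)) (s : Fin n), G.Connected →
        ∃ (ℓ : Fin n → List Bool) (t : ℕ) (τ : RAM.Memory),
          LevelledExecutor.IsLabeling G s ℓ ∧
          RAM.Exec P (RAM.input G s) t τ ∧ t ≤ p.eval n ∧ RAM.HoldsLabels 5 τ ℓ) := by
  refine ⟨⟨540, fun V _ G s ℓ hG hℓ => ?_⟩, LevelledExecutor.Construction.exists_construction⟩
  obtain ⟨fb, h⟩ := hℓ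
  exact ⟨h.length_eq, h.exists_broadcastsIn hG⟩
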